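/- **Setting.** Let $N\ge 2$, masses $m_\alpha>0$ and charges $e_\alpha\neq 0$ ($1\le\alpha\le N$). For $v\in\mathbb R^3$ put $v_\alpha^0=\sqrt{m_\alpha^2+|v|^2}$ and $\widehat{v_\alpha}=v/v_\alpha^0$. The relativistic Vlasov–Maxwell system (RVM) for densities $f_\alpha(t,x,v)$ and an electromagnetic field $(E,B)(t,x)$ is $$\partial_t f_\alpha+\widehat{v_\alpha}\cdot\nabla_x f_\alpha+e_\alpha(E+\widehat{v_\alpha}\times B)\cdot\nabla_v f_\alpha=0,\qquad 1\le\alpha\le N,$$ $$\partial_tE=\nabla\times B-4\pi j,\quad \nabla\cdot E=4\pi\rho,\quad \partial_tB=-\nabla\times E,\quad \nabla\cdot B=0,$$ $$\rho=\sum_\alpha e_\alpha\int_{\mathbb R^3} f_\alpha\,dv,\qquad j=\sum_\alpha e_\alpha\int_{\mathbb R^3}\widehat{v_\alpha}f_\alpha\,dv .$$ A solution on $[T_0,\infty)\times\mathbb R^3\times\mathbb R^3$ means a $C^1$ solution (up to $t=T_0$, with one-sided time derivatives there) whose densities are integrable in $v$. **Hypothesis (H) with radius $k>0$.** $(f_\alpha,E,B)$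 is a solution of RVM on $[0,\infty)\times\mathbb R^3\times\mathbb R^3$ such that: the $f_\alpha(0,\cdot)$ are nonnegative $C^1$ functions supported in $\{|x|\le k,\ |v|\le k\}$; $E(0,\cdot),B(0,\cdot)$ are $C^1$ and supported in $\{|x|\le k\}$; $\nabla\cdot E(0,\cdot)=4\pi\sum_\alpha e_\alpha\int f_\alpha(0,\cdot,v)\,dv$, $\nabla\cdot B(0,\cdot)=0$ and $\sum_\alpha e_\alpha\iint f_\alpha(0,x,v)\,dv\,dx=0$; and there is $C_0>0$ such that for all $t\ge0$ and $|x|\le t+k$ (outside this region the field vanishes by finite speed of propagation) $$|(E,B)(t,x)|\le\frac{C_0}{(t+|x|+2k)(t-|x|+2k)},\qquad |\nabla_x(E,B)(t,x)|\le\frac{C_0\log(t+|x|+2k)}{(t+|x|+2k)(t-|x|+2k)^2}.$$ **Lorentz transform of a solution.** Let $(f_\alpha,E,B)$ satisfy (H) with radius $k$, and let $$F=\begin{pmatrix}0&E^1&E^2&E^3\\-E^1&0&B^3&-B^2\\-E^2&-B^3&0&B^1\\-E^3&B^2&-B^1&0\end{pmatrix}.$$ Extend $(f_\alpha,F)$ by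 $0$ to negative times, so that it is defined on $\Omega\times\mathbb R^3_v$, where $\Omega=([0,\infty)\times\mathbb R^3)\cup\{(t,x): t\le 0,\ |x|\ge -t+k\}$. Let $\mathrm{SO}_0(3,1)$ be the restricted Lorentz group, i.e. the real $4\times4$ matrices $A$ with $A^{T}\eta A=\eta$ for $\eta=\mathrm{diag}(-1,1,1,1)$, $\det A=1$ and $A_{00}>0$. Write $A(t,x)=(A^0(t,x),A^s(t,x))\in\mathbb R\times\mathbb R^3$. For $A\in \mathrm{SO}_0(3,1)$ define, whenever $A(t,x)\in\Omega$, $$f^A_\alpha(t,x,v)=f_\alpha\big(A(t,x),A^s(v^0_\alpha,v)\big),\qquad F^A(t,x)=A^{-1}F(A(t,x))(A^{-1})^{T},$$ and let $(E^A,B^A)$ be the electromagnetic field whose Faraday tensor is $F^A$. **Statement.** For every $(f_\alpha,E,B)$ satisfying (H) with radius $k$ and every $A\in\mathrm{SO}_0(3,1)$ there exists $T_A>0$ such that $A(t,x)\in\Omega$ for all $t\ge T_A$ and $x\in\mathbb R^3$, and $(f^A_\alpha,E^A,B^A)$ is a solution of RVM on $[T_A,\infty)\times\mathbb R^3\times\mathbb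 R^3$. Moreover, the time-shifted solution $(t,x,v)\mapsto(f^A_\alpha,E^A,B^A)(t+T_A,x,v)$ satisfies (H) for some radius $k'>0$ (and some constant $C_0'>0$). -/

import Mathlib

open MeasureTheory Set

namespace VlasovMaxwell

noncomputable section

/-- Physical space (and momentum space) with the Euclidean norm. -/
abbrev E3 : Type := EuclideanSpace ℝ (Fin 3)

/-! ## Vector calculus on three-dimensional space -/

/-- The partial derivative of a scalar function in the `i`-th coordinate direction. -/
def partialDeriv (i : Fin 3) (g : E3 → ℝ) (x : E3) : ℝ :=
  fderiv ℝ g x (EuclideanSpace.single i 1)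

/-- Divergence of a vector field. -/
def divergence (F : E3 → E3) (x : E3) : ℝ :=
  ∑ i : Fin 3, partialDeriv i (fun y => F y i) x

/-- Curl of a vector field. -/
def curl (F : E3 → E3) (x : E3) : E3 :=
  !₂[partialDeriv 1 (fun y => F y 2) x - partialDeriv 2 (fun y => F y 1) x,
     partialDeriv 2 (fun y => F y 0) x - partialDeriv 0 (fun y => F y 2) x,
     partialDeriv 0 (fun y => F y 1) x - partialDeriv 1 (fun y => F y 0) x]

/-- Cross product of two vectors. -/
def cross (a b : E3) : E3 :=
  !₂[a 1 * b 2 - a 2 * b 1, a 2 * b 0 - a 0 * b 2, a 0 * b 1 - a 1 * b 0]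

/-- Squared Euclidean (Frobenius) norm of the Jacobian matrix of a vector field. -/
def gradNormSq (F : E3 → E3) (x : E3) : ℝ :=
  ∑ i : Fin 3, ∑ j : Fin 3, (partialDeriv j (fun y => F y i) x) ^ 2

/-! ## The relativistic Vlasov-Maxwell system -/

/-- Energy `√(m² + |v|²)` of a particle of mass `m` and momentum `v`. -/
def energy (m : ℝ) (v : E3) : ℝ := Real.sqrt (m ^ 2 + ‖v‖ ^ 2)

/-- Relativistic velocity `v / √(m² + |v|²)`. -/
def velocity (m : ℝ) (v : E3) : E3 := (energy m v)⁻¹ • v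

/-- Charge density at time `t` and position `x`. -/
def chargeDensity {N : ℕ} (e : Fin N → ℝ) (f : Fin N → ℝ → E3 → E3 → ℝ)
    (t : ℝ) (x : E3) : ℝ :=
  ∑ α, e α * ∫ v : E3, f α t x v

/-- Current density at time `t` and position `x`. -/
def currentDensity {N : ℕ} (m e : Fin N → ℝ) (f : Fin N → ℝ → E3 → E3 → ℝ)
    (t : ℝ) (x : E3) : E3 :=
  ∑ α, e α • ∫ v : E3, f α t x v • velocity (m α) v

/-- `(f, E, B)` is a `C¹` solution of the relativistic Vlasov-Maxwell system with masses `m` and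
charges `e` on `[T₀, ∞) × ℝ³ × ℝ³`.  Regularity holds up to the boundary `t = T₀`, where time
derivatives are one-sided.  Only values at times `t ≥ T₀` matter. -/
structure IsSolution {N : ℕ} (m e : Fin N → ℝ) (T₀ : ℝ)
    (f : Fin N → ℝ → E3 → E3 → ℝ) (E B : ℝ → E3 → E3) : Prop where
  contDiff_f : ∀ α, ContDiffOn ℝ 1 (fun p : ℝ × E3 × E3 => f α p.1 p.2.1 p.2.2)
    (Ici T₀ ×ˢ univ)
  contDiff_E : ContDiffOn ℝ 1 (fun p : ℝ × E3 => E p.1 p.2) (Ici T₀ ×ˢ univ)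
  contDiff_B : ContDiffOn ℝ 1 (fun p : ℝ × E3 => B p.1 p.2) (Ici T₀ ×ˢ univ)
  /-- The velocity averages in the charge and current densities are well defined. -/
  integrable_f : ∀ α, ∀ t, T₀ ≤ t → ∀ x, Integrable (fun v : E3 => f α t x v)
  vlasov : ∀ α, ∀ t, T₀ ≤ t → ∀ x v,
    derivWithin (fun s => f α s x v) (Ici T₀) t
      + fderiv ℝ (fun y => f α t y v) x (velocity (m α) v)
      + e α * fderiv ℝ (fun w => f α t x w) v (E t x + cross (velocity (m α) v) (B t x)) = 0
  ampere : ∀ t, T₀ ≤ t → ∀ x,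
    derivWithin (fun s => E s x) (Ici T₀) t
      = curl (B t) x - (4 * Real.pi) • currentDensity m e f t x
  gauss : ∀ t, T₀ ≤ t → ∀ x, divergence (E t) x = 4 * Real.pi * chargeDensity e f t x
  faraday : ∀ t, T₀ ≤ t → ∀ x,
    derivWithin (fun s => B s x) (Ici T₀) t = - curl (E t) x
  gauss_magnetic : ∀ t, T₀ ≤ t → ∀ x, divergence (B t) x = 0

/-- The standing hypothesis, with support radius `k`: `(f, E, B)` is a `C¹` solution on
`[0, ∞) × ℝ³ × ℝ³` with compactly supported, constrained, neutral initial data, and the field and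
its spatial gradient obey the decay estimates in the region `|x| ≤ t + k`
(outside of which the field vanishes, by finite speed of propagation). -/
structure StandingHypothesis {N : ℕ} (m e : Fin N → ℝ) (k : ℝ)
    (f : Fin N → ℝ → E3 → E3 → ℝ) (E B : ℝ → E3 → E3) : Prop where
  solution : IsSolution m e 0 f E B
  k_pos : 0 < k
  init_f_nonneg : ∀ α x v, 0 ≤ f α 0 x v
  init_f_contDiff : ∀ α, ContDiff ℝ 1 (fun p : E3 × E3 => f α 0 p.1 p.2)
  init_f_support : ∀ α x v, f α 0 x v ≠ 0 → ‖x‖ ≤ k ∧ ‖v‖ ≤ k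
  init_E_contDiff : ContDiff ℝ 1 (E 0)
  init_B_contDiff : ContDiff ℝ 1 (B 0)
  init_E_support : ∀ x, E 0 x ≠ 0 → ‖x‖ ≤ k
  init_B_support : ∀ x, B 0 x ≠ 0 → ‖x‖ ≤ k
  init_gauss : ∀ x, divergence (E 0) x = 4 * Real.pi * ∑ α, e α * ∫ v : E3, f α 0 x v
  init_gauss_magnetic : ∀ x, divergence (B 0) x = 0
  init_neutral : ∑ α, e α * ∫ p : E3 × E3, f α 0 p.1 p.2 = 0
  decay : ∃ C₀ : ℝ, 0 < C₀ ∧ ∀ t x, 0 ≤ t → ‖x‖ ≤ t + k →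
    Real.sqrt (‖E t x‖ ^ 2 + ‖B t x‖ ^ 2)
        ≤ C₀ / ((t + ‖x‖ + 2 * k) * (t - ‖x‖ + 2 * k)) ∧
    Real.sqrt (gradNormSq (E t) x + gradNormSq (B t) x)
        ≤ C₀ * Real.log (t + ‖x‖ + 2 * k)
          / ((t + ‖x‖ + 2 * k) * (t - ‖x‖ + 2 * k) ^ 2)

/-! ## The restricted Lorentz group and its action on solutions -/

/-- The Minkowski metric `diag(-1, 1, 1, 1)`. -/
def minkowski : Matrix (Fin 4) (Fin 4) ℝ := Matrix.diagonal ![-1, 1, 1, 1]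

/-- The restricted (proper, orthochronous) Lorentz group `SO₀(3,1)`, as a set of matrices. -/
def restrictedLorentz : Set (Matrix (Fin 4) (Fin 4) ℝ) :=
  {A | A.transpose * minkowski * A = minkowski ∧ A.det = 1 ∧ 0 < A 0 0}

/-- The four-vector `(t, x)`. -/
def fourVec (t : ℝ) (x : E3) : Fin 4 → ℝ := ![t, x 0, x 1, x 2]

/-- The time component `A⁰(t, x)` of `A (t, x)`. -/
def timePart (A : Matrix (Fin 4) (Fin 4) ℝ) (t : ℝ) (x : E3) : ℝ :=
  (A.mulVec (fourVec t x)) 0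

/-- The space component `Aˢ(t, x)` of `A (t, x)`. -/
def spacePart (A : Matrix (Fin 4) (Fin 4) ℝ) (t : ℝ) (x : E3) : E3 :=
  !₂[(A.mulVec (fourVec t x)) 1, (A.mulVec (fourVec t x)) 2, (A.mulVec (fourVec t x)) 3]

/-- The Faraday tensor (with upper indices) of an electromagnetic field. -/
def faradayTensor (E B : E3) : Matrix (Fin 4) (Fin 4) ℝ :=
  !![0, E 0, E 1, E 2;
     -E 0, 0, B 2, -B 1;
     -E 1, -B 2, 0, B 0;
     -E 2, B 1, -B 0, 0]

/-- The electric field read off from a Faraday tensor. -/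
def electricPart (F : Matrix (Fin 4) (Fin 4) ℝ) : E3 := !₂[F 0 1, F 0 2, F 0 3]

/-- The magnetic field read off from a Faraday tensor. -/
def magneticPart (F : Matrix (Fin 4) (Fin 4) ℝ) : E3 := !₂[F 2 3, F 3 1, F 1 2]

/-- The domain `Ω` to which a solution with data supported in `|x| ≤ k` is extended by zero. -/
def extendedDomain (k : ℝ) : Set (ℝ × E3) :=
  {p | 0 ≤ p.1} ∪ {p | p.1 ≤ 0 ∧ -p.1 + k ≤ ‖p.2‖}

open Classical in
/-- Extension by zero to negative times (meaningful on `extendedDomain k` only). -/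
def extendZero {V : Type*} [Zero V] (g : ℝ → V) (t : ℝ) : V := if 0 ≤ t then g t else 0

/-- The transformed densities `f_α^A(t,x,v) = f_α(A(t,x), Aˢ(v_α⁰, v))`. -/
def lorentzDensity {N : ℕ} (m : Fin N → ℝ) (A : Matrix (Fin 4) (Fin 4) ℝ)
    (f : Fin N → ℝ → E3 → E3 → ℝ) (α : Fin N) (t : ℝ) (x v : E3) : ℝ :=
  extendZero (f α) (timePart A t x) (spacePart A t x) (spacePart A (energy (m α) v) v)

/-- The transformed Faraday tensor `F^A(t,x) = A⁻¹ F(A(t,x)) (A⁻¹)ᵀ`. -/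
def lorentzTensor (A : Matrix (Fin 4) (Fin 4) ℝ) (E B : ℝ → E3 → E3) (t : ℝ) (x : E3) :
    Matrix (Fin 4) (Fin 4) ℝ :=
  A⁻¹ * faradayTensor (extendZero E (timePart A t x) (spacePart A t x))
      (extendZero B (timePart A t x) (spacePart A t x)) * (A⁻¹).transpose

/-- The transformed electric field `E^A`. -/
def lorentzE (A : Matrix (Fin 4) (Fin 4) ℝ) (E B : ℝ → E3 → E3) (t : ℝ) (x : E3) : E3 :=
  electricPart (lorentzTensor A E B t x)

/-- The transformed magnetic field `B^A`. -/
def lorentzB (A : Matrix (Fin 4) (Fin 4) ℝ) (E B : ℝ → E3 → E3) (t : ℝ) (x : E3) : E3 :=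
  magneticPart (lorentzTensor A E B t x)

end

end VlasovMaxwell

open VlasovMaxwell

namespace VlasovMaxwell

/-! ## The restricted Lorentz group -/

/-! The Vlasov–Maxwell system is Lorentz covariant; the work lies in showing that the support and
decay conditions survive a change of frame. Covariance is algebra: Maxwell's equations become
relations between derivatives of the Faraday tensor and the four-current
(`MaxwellRelations.lorentz`), the current transforms as a vector because `dv / v⁰` is invariant on
the mass shell (`integral_momentumMap`), and the Vlasov operator multiplied by the energy is a
vector field that the transformation carries to itself (`momentumDeriv_force`). Together these give
`RegularSolution.lorentz`.

The extension by zero has to be a genuine `C¹` solution where it is used. Characteristics move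
slower than light, so the densities vanish for `|x| > t + k`; an energy estimate with a cone weight
gives the same for the field (`maxwell_finite_speed`). The extended solution is therefore regular on
the open set `extendedRegion k`. If `β = boost A` is the length of the spatial part of the first
column of `A`, every slice `t ≥ T` with `T > β k` is mapped into that set
(`lorentz_mem_extendedRegion`).

Decay is the analytic core. The weights `t ± |x|` in the two frames are comparable, the one for `t -
|x|` because `t² - |x|²` is invariant (`exists_weight_comparison`). But the transformed spatial
gradient contains time derivatives in the old frame, and `∂ₜE = ∇×B - 4πj` requires decay of `j`,
which is not assumed. Momenta are first bounded uniformly by a bootstrap along characteristics,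
which keeps particles inside a strictly smaller cone (`StandingHypothesis.exists_trajectory_bound`).
Two particles meeting at time `t` then have relative velocity `O(1/t)`, by comparison with free
motion (`exists_relative_velocity_bound`). The momentum support at a spacetime point thus has volume
`O(t⁻³)`, and since the densities are bounded, `j` is `O(t⁻³)`, enough for
`StandingHypothesis.exists_fderiv_bound` and `StandingHypothesis.exists_lorentz_decay`.

The data at the new initial time are compactly supported by the same cone argument and momentum
bound, and neutrality follows from Gauss's law (`neutral_of_gauss`). -/

lemma minkowski_mul_self : minkowski * minkowski = 1 := by
  ext i j; fin_cases i <;> fin_cases j <;> simp [minkowski]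

lemma minkowski_transpose : minkowski.transpose = minkowski := by
  simp [minkowski]

section Lorentz

variable {A : Matrix (Fin 4) (Fin 4) ℝ}

lemma lorentz_left_inv (hA : A ∈ restrictedLorentz) :
    (minkowski * A.transpose * minkowski) * A = 1 := by
  rw [Matrix.mul_assoc, Matrix.mul_assoc, ← Matrix.mul_assoc A.transpose, hA.1,
    minkowski_mul_self]

lemma lorentz_inv_eq (hA : A ∈ restrictedLorentz) :
    A⁻¹ = minkowski * A.transpose * minkowski :=
  Matrix.inv_eq_left_inv (lorentz_left_inv hA)

lemma lorentz_inv_mul (hA : A ∈ restrictedLorentz) : A⁻¹ * A = 1 := by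
  rw [lorentz_inv_eq hA, lorentz_left_inv hA]

lemma lorentz_mul_inv (hA : A ∈ restrictedLorentz) : A * A⁻¹ = 1 :=
  mul_eq_one_comm.mp (lorentz_inv_mul hA)

/-- A left inverse of a square matrix is a right inverse, so orthonormality of columns passes to
rows. This is what closes the group under inversion. -/
lemma lorentz_mul_minkowski_mul_transpose (hA : A ∈ restrictedLorentz) :
    A * minkowski * A.transpose = minkowski := by
  have h := lorentz_mul_inv hA
  rw [lorentz_inv_eq hA] at h
  calc A * minkowski * A.transpose
      = (A * (minkowski * A.transpose * minkowski)) * minkowski := by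
        simp only [Matrix.mul_assoc, minkowski_mul_self, Matrix.mul_one]
    _ = minkowski := by rw [h, Matrix.one_mul]

lemma lorentz_inv_mem (hA : A ∈ restrictedLorentz) : A⁻¹ ∈ restrictedLorentz := by
  have h2 := lorentz_mul_minkowski_mul_transpose hA
  have h3 := hA.1
  refine ⟨?_, ?_, ?_⟩
  · rw [lorentz_inv_eq hA]
    simp only [Matrix.transpose_mul, Matrix.transpose_transpose, minkowski_transpose]
    calc minkowski * (A * minkowski) * minkowski * (minkowski * A.transpose * minkowski)
        = minkowski * (A * minkowski * (minkowski * minkowski) * A.transpose) * minkowski := by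
          simp only [Matrix.mul_assoc]
      _ = minkowski := by
          rw [minkowski_mul_self, Matrix.mul_one, h2, minkowski_mul_self, Matrix.one_mul]
  · rw [Matrix.det_nonsing_inv, hA.2.1]; simp
  · rw [lorentz_inv_eq hA]
    have : (minkowski * A.transpose * minkowski) 0 0 = A 0 0 := by
      simp [minkowski]
    rw [this]; exact hA.2.2

lemma lorentz_inv_inv (hA : A ∈ restrictedLorentz) : A⁻¹⁻¹ = A :=
  Matrix.inv_eq_left_inv (lorentz_mul_inv hA)

/-- The entries of the inverse of a Lorentz matrix. -/
lemma lorentz_inv_apply (hA : A ∈ restrictedLorentz) (i j : Fin 4) :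
    A⁻¹ i j = ![-1, 1, 1, 1] i * A j i * ![-1, 1, 1, 1] j := by
  rw [lorentz_inv_eq hA]
  simp [minkowski]

/-- Orthonormality of the columns of a Lorentz matrix. -/
lemma lorentz_col (hA : A ∈ restrictedLorentz) (i j : Fin 4) :
    -(A 0 i * A 0 j) + A 1 i * A 1 j + A 2 i * A 2 j + A 3 i * A 3 j
      = Matrix.diagonal ![-1, 1, 1, 1] i j := by
  have h := congrFun (congrFun hA.1 i) j
  rw [Matrix.mul_apply, Fin.sum_univ_four] at h
  simp only [minkowski, Matrix.mul_diagonal, Matrix.transpose_apply] at h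
  simpa using h

/-! ### Coordinates and the linear action on spacetime. -/

lemma norm_sq_E3 (x : E3) : ‖x‖ ^ 2 = x 0 ^ 2 + x 1 ^ 2 + x 2 ^ 2 := by
  rw [EuclideanSpace.norm_sq_eq, Fin.sum_univ_three]; simp

lemma timePart_eq (A : Matrix (Fin 4) (Fin 4) ℝ) (t : ℝ) (x : E3) :
    timePart A t x = A 0 0 * t + A 0 1 * x 0 + A 0 2 * x 1 + A 0 3 * x 2 := by
  simp [timePart, Matrix.mulVec, dotProduct, fourVec, Fin.sum_univ_four]

lemma spacePart_zero (A : Matrix (Fin 4) (Fin 4) ℝ) (t : ℝ) (x : E3) :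
    spacePart A t x 0 = A 1 0 * t + A 1 1 * x 0 + A 1 2 * x 1 + A 1 3 * x 2 := by
  simp [spacePart, Matrix.mulVec, dotProduct, fourVec, Fin.sum_univ_four]

lemma spacePart_one (A : Matrix (Fin 4) (Fin 4) ℝ) (t : ℝ) (x : E3) :
    spacePart A t x 1 = A 2 0 * t + A 2 1 * x 0 + A 2 2 * x 1 + A 2 3 * x 2 := by
  simp [spacePart, Matrix.mulVec, dotProduct, fourVec, Fin.sum_univ_four]

lemma spacePart_two (A : Matrix (Fin 4) (Fin 4) ℝ) (t : ℝ) (x : E3) :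
    spacePart A t x 2 = A 3 0 * t + A 3 1 * x 0 + A 3 2 * x 1 + A 3 3 * x 2 := by
  simp [spacePart, Matrix.mulVec, dotProduct, fourVec, Fin.sum_univ_four]

lemma E3_ext {x y : E3} (h0 : x 0 = y 0) (h1 : x 1 = y 1) (h2 : x 2 = y 2) : x = y := by
  ext i; fin_cases i <;> assumption

lemma fourVec_parts (A : Matrix (Fin 4) (Fin 4) ℝ) (t : ℝ) (x : E3) :
    fourVec (timePart A t x) (spacePart A t x) = A.mulVec (fourVec t x) := by
  ext i; fin_cases i <;> simp [fourVec, timePart, spacePart]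

lemma timePart_mul (A C : Matrix (Fin 4) (Fin 4) ℝ) (t : ℝ) (x : E3) :
    timePart A (timePart C t x) (spacePart C t x) = timePart (A * C) t x := by
  simp only [timePart, ← Matrix.mulVec_mulVec]
  rw [← fourVec_parts C]; rfl

lemma spacePart_mul (A C : Matrix (Fin 4) (Fin 4) ℝ) (t : ℝ) (x : E3) :
    spacePart A (timePart C t x) (spacePart C t x) = spacePart (A * C) t x := by
  simp only [spacePart, ← Matrix.mulVec_mulVec]
  rw [← fourVec_parts C]; rfl

lemma timePart_one (t : ℝ) (x : E3) : timePart 1 t x = t := by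
  simp [timePart, fourVec]

lemma spacePart_one_matrix (t : ℝ) (x : E3) : spacePart 1 t x = x := by
  apply E3_ext <;> simp [spacePart, fourVec]

lemma timePart_inv_apply (hA : A ∈ restrictedLorentz) (t : ℝ) (x : E3) :
    timePart A⁻¹ (timePart A t x) (spacePart A t x) = t := by
  rw [timePart_mul, lorentz_inv_mul hA, timePart_one]

lemma spacePart_inv_apply (hA : A ∈ restrictedLorentz) (t : ℝ) (x : E3) :
    spacePart A⁻¹ (timePart A t x) (spacePart A t x) = x := by
  rw [spacePart_mul, lorentz_inv_mul hA, spacePart_one_matrix]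

/-- Lorentz transformations preserve the Minkowski form. -/
lemma minkowski_form_invariant (hA : A ∈ restrictedLorentz) (t : ℝ) (x : E3) :
    ‖spacePart A t x‖ ^ 2 - timePart A t x ^ 2 = ‖x‖ ^ 2 - t ^ 2 := by
  have h := lorentz_col hA
  have h00 := h 0 0; have h01 := h 0 1; have h02 := h 0 2; have h03 := h 0 3
  have h11 := h 1 1; have h12 := h 1 2; have h13 := h 1 3
  have h22 := h 2 2; have h23 := h 2 3; have h33 := h 3 3
  simp [Matrix.diagonal] at h00 h01 h02 h03 h11 h12 h13 h22 h23 h33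
  rw [norm_sq_E3, norm_sq_E3, spacePart_zero, spacePart_one, spacePart_two, timePart_eq]
  linear_combination t ^ 2 * h00 + 2 * t * x 0 * h01 + 2 * t * x 1 * h02 + 2 * t * x 2 * h03
    + x 0 ^ 2 * h11 + 2 * x 0 * x 1 * h12 + 2 * x 0 * x 2 * h13 + x 1 ^ 2 * h22
    + 2 * x 1 * x 2 * h23 + x 2 ^ 2 * h33

/-- Length of the space part of the first column. -/
noncomputable def boost (A : Matrix (Fin 4) (Fin 4) ℝ) : ℝ := ‖(!₂[A 1 0, A 2 0, A 3 0] : E3)‖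

lemma boost_nonneg (A : Matrix (Fin 4) (Fin 4) ℝ) : 0 ≤ boost A := norm_nonneg _

lemma boost_sq (hA : A ∈ restrictedLorentz) : A 0 0 ^ 2 = 1 + boost A ^ 2 := by
  have h := lorentz_col hA 0 0
  simp [Matrix.diagonal] at h
  rw [boost, norm_sq_E3]
  simp
  linear_combination -h

/-- The first column is a unit timelike vector, so its time component strictly dominates its spatial
length. The gap `A 0 0 - boost A > 0` later turns cone conditions into bounds on time. -/
lemma boost_lt (hA : A ∈ restrictedLorentz) : boost A < A 0 0 := by
  have h := boost_sq hA
  have := boost_nonneg A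
  have := hA.2.2
  nlinarith

lemma inner_E3 (x y : E3) : inner ℝ x y = x 0 * y 0 + x 1 * y 1 + x 2 * y 2 := by
  rw [PiLp.inner_apply, Fin.sum_univ_three]
  simp [mul_comm]

/-- The first row of `A⁻¹` is, up to signs, the first column of `A`, so this is Cauchy–Schwarz. The
inverse comes first because `boost` is read off a column. -/
lemma abs_timePart_inv_sub_le (hA : A ∈ restrictedLorentz) (t : ℝ) (x : E3) :
    |timePart A⁻¹ t x - A 0 0 * t| ≤ boost A * ‖x‖ := by
  have h := abs_real_inner_le_norm (!₂[A 1 0, A 2 0, A 3 0] : E3) x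
  rw [inner_E3] at h
  rw [timePart_eq]
  simp only [lorentz_inv_apply hA]
  simp at h ⊢
  rw [boost]
  refine le_trans (le_of_eq ?_) h
  rw [← abs_neg]; congr 1; ring

lemma boost_inv (hA : A ∈ restrictedLorentz) : boost A⁻¹ = boost A := by
  have h1 := boost_sq hA
  have h2 := boost_sq (lorentz_inv_mem hA)
  have h3 : A⁻¹ 0 0 = A 0 0 := by rw [lorentz_inv_apply hA]; simp
  rw [h3] at h2
  have := boost_nonneg A
  have := boost_nonneg A⁻¹
  nlinarith

lemma abs_timePart_sub_le (hA : A ∈ restrictedLorentz) (t : ℝ) (x : E3) :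
    |timePart A t x - A 0 0 * t| ≤ boost A * ‖x‖ := by
  have h := abs_timePart_inv_sub_le (lorentz_inv_mem hA) t x
  rw [lorentz_inv_inv hA, boost_inv hA] at h
  have h3 : A⁻¹ 0 0 = A 0 0 := by rw [lorentz_inv_apply hA]; simp
  rwa [h3] at h

/-! ### Action on the mass shell -/

lemma energy_sq (m : ℝ) (v : E3) : energy m v ^ 2 = m ^ 2 + ‖v‖ ^ 2 :=
  Real.sq_sqrt (by positivity)

lemma energy_pos {m : ℝ} (hm : 0 < m) (v : E3) : 0 < energy m v :=
  Real.sqrt_pos.mpr (by positivity)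

lemma norm_le_energy (m : ℝ) (v : E3) : ‖v‖ ≤ energy m v :=
  Real.le_sqrt_of_sq_le (by nlinarith [sq_nonneg m])

lemma norm_lt_energy {m : ℝ} (hm : 0 < m) (v : E3) : ‖v‖ < energy m v :=
  Real.lt_sqrt_of_sq_lt (by nlinarith [sq_pos_of_pos hm])

/-- Momentum after a Lorentz transformation. -/
noncomputable def momentumMap (A : Matrix (Fin 4) (Fin 4) ℝ) (m : ℝ) (v : E3) : E3 :=
  spacePart A (energy m v) v

/-- The vector `(v⁰, v)` is future timelike for positive mass, and `boost A < A 0 0` keeps it so. -/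
lemma timePart_energy_pos (hA : A ∈ restrictedLorentz) {m : ℝ} (hm : 0 < m) (v : E3) :
    0 < timePart A (energy m v) v := by
  have h := abs_le.mp (abs_timePart_sub_le hA (energy m v) v)
  have h1 := boost_lt hA
  have h2 := norm_lt_energy hm v
  have h3 := boost_nonneg A
  nlinarith [norm_nonneg v, h.1, hA.2.2]

/-- Invariance of the Minkowski form fixes the new energy up to sign, and positivity of the time
component selects the root. Hence the mass shell is mapped to itself. -/
lemma energy_momentumMap (hA : A ∈ restrictedLorentz) {m : ℝ} (hm : 0 < m) (v : E3) :
    energy m (momentumMap A m v) = timePart A (energy m v) v := by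
  have h := minkowski_form_invariant hA (energy m v) v
  rw [energy_sq] at h
  rw [energy, Real.sqrt_eq_iff_mul_self_eq_of_pos (timePart_energy_pos hA hm v), momentumMap]
  linear_combination -h

lemma momentumMap_inv_apply (hA : A ∈ restrictedLorentz) {m : ℝ} (hm : 0 < m) (v : E3) :
    momentumMap A⁻¹ m (momentumMap A m v) = v := by
  rw [momentumMap, energy_momentumMap hA hm, momentumMap, spacePart_inv_apply hA]

lemma momentumMap_apply_inv (hA : A ∈ restrictedLorentz) {m : ℝ} (hm : 0 < m) (v : E3) :
    momentumMap A m (momentumMap A⁻¹ m v) = v := by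
  have := momentumMap_inv_apply (lorentz_inv_mem hA) hm v
  rwa [lorentz_inv_inv hA] at this

end Lorentz

/-! ## Tensor form of the Maxwell equations -/

/-- The coordinate basis of spacetime. -/
noncomputable def stBasis (μ : Fin 4) : ℝ × E3 :=
  ![(1, 0), (0, EuclideanSpace.single 0 1), (0, EuclideanSpace.single 1 1),
    (0, EuclideanSpace.single 2 1)] μ

/-- The Maxwell equations as algebraic relations between the partial derivatives `DE γ = ∂_γ E`,
`DB γ = ∂_γ B` and the four-current `J`. -/
structure MaxwellRelations (DE DB : Fin 4 → E3) (J : Fin 4 → ℝ) : Prop where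
  source : ∀ μ, ∑ ν, faradayTensor (DE ν) (DB ν) μ ν = 4 * Real.pi * J μ
  bianchi : ∀ l μ ν,
    (minkowski * faradayTensor (DE l) (DB l) * minkowski) μ ν
      + (minkowski * faradayTensor (DE μ) (DB μ) * minkowski) ν l
      + (minkowski * faradayTensor (DE ν) (DB ν) * minkowski) l μ = 0

/-- The source relation packs Gauss (`μ = 0`) and Ampère (`μ = 1, 2, 3`); the cyclic relation packs
Faraday and the absence of magnetic charge. Index triples with a repeated entry hold by
antisymmetry. -/
lemma maxwellRelations_iff (DE DB : Fin 4 → E3) (ρ : ℝ) (j : E3) :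
    MaxwellRelations DE DB (fourVec ρ j) ↔
      (DE 0 = !₂[DB 2 2 - DB 3 1, DB 3 0 - DB 1 2, DB 1 1 - DB 2 0] - (4 * Real.pi) • j) ∧
      (DE 1 0 + DE 2 1 + DE 3 2 = 4 * Real.pi * ρ) ∧
      (DB 0 = -!₂[DE 2 2 - DE 3 1, DE 3 0 - DE 1 2, DE 1 1 - DE 2 0]) ∧
      (DB 1 0 + DB 2 1 + DB 3 2 = 0) := by
  constructor
  · rintro ⟨hs, hb⟩
    have s0 := hs 0; have s1 := hs 1; have s2 := hs 2; have s3 := hs 3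
    have b1 := hb 0 1 2; have b2 := hb 0 2 3; have b3 := hb 0 3 1; have b4 := hb 1 2 3
    simp [Fin.sum_univ_four, faradayTensor, fourVec, minkowski] at s0 s1 s2 s3 b1 b2 b3 b4
    refine ⟨?_, by linarith, ?_, by linarith⟩ <;> apply E3_ext <;> simp <;> linarith
  · rintro ⟨h1, h2, h3, h4⟩
    have a0 := congrArg (fun z : E3 => z 0) h1
    have a1 := congrArg (fun z : E3 => z 1) h1
    have a2 := congrArg (fun z : E3 => z 2) h1
    have c0 := congrArg (fun z : E3 => z 0) h3
    have c1 := congrArg (fun z : E3 => z 1) h3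
    have c2 := congrArg (fun z : E3 => z 2) h3
    simp at a0 a1 a2 c0 c1 c2
    constructor
    · intro μ
      fin_cases μ <;> simp [Fin.sum_univ_four, faradayTensor, fourVec] <;> linarith
    · intro l μ ν
      fin_cases l <;> fin_cases μ <;> fin_cases ν <;> simp [faradayTensor, minkowski] <;> linarith

/-! ### Transformation law of the field values. -/

lemma faradayTensor_transpose (E B : E3) : (faradayTensor E B).transpose = -faradayTensor E B := by
  ext i j; fin_cases i <;> fin_cases j <;> simp [faradayTensor]

lemma faradayTensor_parts {F : Matrix (Fin 4) (Fin 4) ℝ} (hF : F.transpose = -F) :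
    faradayTensor (electricPart F) (magneticPart F) = F := by
  have h : ∀ i j, F j i = -F i j := fun i j => congrFun (congrFun hF i) j
  ext i j
  have h0 := h 0 0; have h1 := h 1 1; have h2 := h 2 2; have h3 := h 3 3
  have := h 0 1; have := h 0 2; have := h 0 3; have := h 1 2; have := h 1 3; have := h 2 3
  fin_cases i <;> fin_cases j <;> simp [faradayTensor, electricPart, magneticPart] <;> linarith

/-- The Lorentz transform of the Faraday tensor of the field values `(E, B)`. -/
noncomputable def fieldTensor (A : Matrix (Fin 4) (Fin 4) ℝ) (E B : E3) :
    Matrix (Fin 4) (Fin 4) ℝ :=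
  A⁻¹ * faradayTensor E B * (A⁻¹).transpose

lemma fieldTensor_transpose (A : Matrix (Fin 4) (Fin 4) ℝ) (E B : E3) :
    (fieldTensor A E B).transpose = -fieldTensor A E B := by
  simp [fieldTensor, Matrix.transpose_mul, faradayTensor_transpose, Matrix.mul_assoc]

lemma faradayTensor_linear (c d : ℝ) (E B E' B' : E3) :
    faradayTensor (c • E + d • E') (c • B + d • B')
      = c • faradayTensor E B + d • faradayTensor E' B' := by
  ext i j; fin_cases i <;> fin_cases j <;> simp [faradayTensor] <;> ring

lemma faradayTensor_add (E B E' B' : E3) :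
    faradayTensor (E + E') (B + B') = faradayTensor E B + faradayTensor E' B' := by
  simpa using faradayTensor_linear 1 1 E B E' B'

lemma faradayTensor_smul (c : ℝ) (E B : E3) :
    faradayTensor (c • E) (c • B) = c • faradayTensor E B := by
  simpa using faradayTensor_linear c 0 E B 0 0

/-- The transformed electric field as a linear function of the field values. -/
noncomputable def electricMap (A : Matrix (Fin 4) (Fin 4) ℝ) : E3 × E3 →L[ℝ] E3 :=
  LinearMap.toContinuousLinearMap
    { toFun := fun p => electricPart (fieldTensor A p.1 p.2)
      map_add' := fun p q => by
        simp only [fieldTensor, Prod.fst_add, Prod.snd_add, faradayTensor_add, Matrix.mul_add,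
          Matrix.add_mul]
        apply E3_ext <;> simp [electricPart]
      map_smul' := fun c p => by
        simp only [fieldTensor, Prod.smul_fst, Prod.smul_snd, faradayTensor_smul, Matrix.mul_smul,
          Matrix.smul_mul]
        apply E3_ext <;> simp [electricPart] }

/-- The transformed magnetic field as a linear function of the field values. -/
noncomputable def magneticMap (A : Matrix (Fin 4) (Fin 4) ℝ) : E3 × E3 →L[ℝ] E3 :=
  LinearMap.toContinuousLinearMap
    { toFun := fun p => magneticPart (fieldTensor A p.1 p.2)
      map_add' := fun p q => by
        simp only [fieldTensor, Prod.fst_add, Prod.snd_add, faradayTensor_add, Matrix.mul_add,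
          Matrix.add_mul]
        apply E3_ext <;> simp [magneticPart]
      map_smul' := fun c p => by
        simp only [fieldTensor, Prod.smul_fst, Prod.smul_snd, faradayTensor_smul, Matrix.mul_smul,
          Matrix.smul_mul]
        apply E3_ext <;> simp [magneticPart] }

lemma electricMap_apply (A : Matrix (Fin 4) (Fin 4) ℝ) (p : E3 × E3) :
    electricMap A p = electricPart (fieldTensor A p.1 p.2) := rfl

lemma magneticMap_apply (A : Matrix (Fin 4) (Fin 4) ℝ) (p : E3 × E3) :
    magneticMap A p = magneticPart (fieldTensor A p.1 p.2) := rfl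

lemma faradayTensor_maps (A : Matrix (Fin 4) (Fin 4) ℝ) (E B : E3) :
    faradayTensor (electricMap A (E, B)) (magneticMap A (E, B)) = fieldTensor A E B := by
  rw [electricMap_apply, magneticMap_apply, faradayTensor_parts (fieldTensor_transpose A E B)]

lemma faradayTensor_sum {ι : Type*} (s : Finset ι) (c : ι → ℝ) (E B : ι → E3) :
    faradayTensor (∑ i ∈ s, c i • E i) (∑ i ∈ s, c i • B i)
      = ∑ i ∈ s, c i • faradayTensor (E i) (B i) := by
  classical
  induction s using Finset.induction_on with
  | empty => ext i j; fin_cases i <;> fin_cases j <;> simp [faradayTensor]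
  | insert a s ha ih =>
    rw [Finset.sum_insert ha, Finset.sum_insert ha, Finset.sum_insert ha, faradayTensor_add,
      faradayTensor_smul, ih]

lemma minkowski_mul_inv {A : Matrix (Fin 4) (Fin 4) ℝ} (hA : A ∈ restrictedLorentz) :
    minkowski * A⁻¹ = A.transpose * minkowski := by
  rw [lorentz_inv_eq hA, ← Matrix.mul_assoc, ← Matrix.mul_assoc, minkowski_mul_self,
    Matrix.one_mul]

lemma inv_transpose_mul_minkowski {A : Matrix (Fin 4) (Fin 4) ℝ} (hA : A ∈ restrictedLorentz) :
    (A⁻¹).transpose * minkowski = minkowski * A := by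
  have := congrArg Matrix.transpose (minkowski_mul_inv hA)
  simpa [Matrix.transpose_mul, minkowski_transpose] using this

lemma minkowski_fieldTensor {A : Matrix (Fin 4) (Fin 4) ℝ} (hA : A ∈ restrictedLorentz)
    (E B : E3) :
    minkowski * fieldTensor A E B * minkowski
      = A.transpose * (minkowski * faradayTensor E B * minkowski) * A := by
  rw [fieldTensor]
  calc minkowski * (A⁻¹ * faradayTensor E B * (A⁻¹).transpose) * minkowski
      = (minkowski * A⁻¹) * faradayTensor E B * ((A⁻¹).transpose * minkowski) := by
        simp only [Matrix.mul_assoc]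
    _ = _ := by
        rw [minkowski_mul_inv hA, inv_transpose_mul_minkowski hA]; simp only [Matrix.mul_assoc]

lemma transpose_mul_mul_apply (A H : Matrix (Fin 4) (Fin 4) ℝ) (μ ν : Fin 4) :
    (A.transpose * H * A) μ ν = ∑ b, ∑ c, A b μ * A c ν * H b c := by
  simp only [Matrix.mul_apply, Matrix.transpose_apply, Finset.sum_mul]
  rw [Finset.sum_comm]
  refine Finset.sum_congr rfl fun b _ => Finset.sum_congr rfl fun c _ => by ring

/-- Lorentz covariance of the Maxwell equations. -/
lemma MaxwellRelations.lorentz {A : Matrix (Fin 4) (Fin 4) ℝ} (hA : A ∈ restrictedLorentz)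
    {DE DB : Fin 4 → E3} {J : Fin 4 → ℝ} (h : MaxwellRelations DE DB J) :
    MaxwellRelations (fun ν => electricMap A (∑ μ, A μ ν • (DE μ, DB μ)))
      (fun ν => magneticMap A (∑ μ, A μ ν • (DE μ, DB μ))) (A⁻¹.mulVec J) := by
  have key : ∀ ν, faradayTensor (electricMap A (∑ μ, A μ ν • (DE μ, DB μ)))
      (magneticMap A (∑ μ, A μ ν • (DE μ, DB μ))) = ∑ μ, A μ ν • fieldTensor A (DE μ) (DB μ) := by
    intro ν
    simp only [map_sum, map_smul]
    rw [faradayTensor_sum]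
    simp only [faradayTensor_maps]
  constructor
  · intro μ
    simp only [key]
    -- The factor `A` produced by the chain rule cancels the second factor `(A⁻¹)ᵀ` of the tensor,
    -- leaving only `A⁻¹` on the free index.
    have h1 : ∀ γ, ∑ ν, A γ ν * fieldTensor A (DE γ) (DB γ) μ ν
        = (A⁻¹ * faradayTensor (DE γ) (DB γ)) μ γ := by
      intro γ
      have : fieldTensor A (DE γ) (DB γ) * A.transpose = A⁻¹ * faradayTensor (DE γ) (DB γ) := by
        rw [fieldTensor, Matrix.mul_assoc, ← Matrix.transpose_mul, lorentz_mul_inv hA,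
          Matrix.transpose_one, Matrix.mul_one]
      rw [← this, Matrix.mul_apply]
      exact Finset.sum_congr rfl fun ν _ => by rw [Matrix.transpose_apply, mul_comm]
    simp only [Matrix.sum_apply, Matrix.smul_apply, smul_eq_mul]
    rw [Finset.sum_comm]
    simp only [h1, Matrix.mul_apply]
    rw [Finset.sum_comm]
    simp only [← Finset.mul_sum, h.source, Matrix.mulVec, dotProduct]
    rw [Finset.mul_sum]
    exact Finset.sum_congr rfl fun ν _ => by ring
  · intro l μ ν
    simp only [key, Finset.mul_sum, Finset.sum_mul, Matrix.mul_smul, Matrix.smul_mul,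
      minkowski_fieldTensor hA, Matrix.sum_apply, Matrix.smul_apply, smul_eq_mul,
      transpose_mul_mul_apply]
    set H := fun a => minkowski * faradayTensor (DE a) (DB a) * minkowski with hH
    -- Renaming the summation indices gives all three cyclic sums the common factor `A a l * A b μ *
    -- A c ν`, after which the untransformed identity applies term by term.
    have e1 : ∑ a, ∑ b, ∑ c, A a μ * (A b ν * A c l * H a b c)
        = ∑ a, ∑ b, ∑ c, A a l * (A b μ * A c ν * H b c a) := by
      calc ∑ a, ∑ b, ∑ c, A a μ * (A b ν * A c l * H a b c)
          = ∑ a, ∑ c, ∑ b, A a μ * (A b ν * A c l * H a b c) :=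
            Finset.sum_congr rfl fun a _ => Finset.sum_comm
        _ = ∑ c, ∑ a, ∑ b, A a μ * (A b ν * A c l * H a b c) := Finset.sum_comm
        _ = _ := Finset.sum_congr rfl fun a _ => Finset.sum_congr rfl fun b _ =>
            Finset.sum_congr rfl fun c _ => by ring
    have e2 : ∑ a, ∑ b, ∑ c, A a ν * (A b l * A c μ * H a b c)
        = ∑ a, ∑ b, ∑ c, A a l * (A b μ * A c ν * H c a b) := by
      calc ∑ a, ∑ b, ∑ c, A a ν * (A b l * A c μ * H a b c)
          = ∑ b, ∑ a, ∑ c, A a ν * (A b l * A c μ * H a b c) := Finset.sum_comm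
        _ = ∑ b, ∑ c, ∑ a, A a ν * (A b l * A c μ * H a b c) :=
            Finset.sum_congr rfl fun a _ => Finset.sum_comm
        _ = _ := Finset.sum_congr rfl fun a _ => Finset.sum_congr rfl fun b _ =>
            Finset.sum_congr rfl fun c _ => by ring
    have e3 := h.bianchi
    change ∑ a, ∑ b, ∑ c, A a l * (A b μ * A c ν * H a b c)
      + ∑ a, ∑ b, ∑ c, A a μ * (A b ν * A c l * H a b c)
      + ∑ a, ∑ b, ∑ c, A a ν * (A b l * A c μ * H a b c) = 0
    rw [e1, e2]
    simp only [← Finset.sum_add_distrib]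
    refine Finset.sum_eq_zero fun a _ => Finset.sum_eq_zero fun b _ => Finset.sum_eq_zero
      fun c _ => ?_
    have := e3 a b c
    change H a b c + H b c a + H c a b = 0 at this
    linear_combination A a l * A b μ * A c ν * this

/-- The Lorentz transformation as a linear map of spacetime. -/
noncomputable def lorentzMap (A : Matrix (Fin 4) (Fin 4) ℝ) : ℝ × E3 →L[ℝ] ℝ × E3 :=
  LinearMap.toContinuousLinearMap
    { toFun := fun p => (timePart A p.1 p.2, spacePart A p.1 p.2)
      map_add' := fun p q => by
        ext1
        · simp [timePart_eq]; ring
        · apply E3_ext <;> simp [spacePart_zero, spacePart_one, spacePart_two] <;> ring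
      map_smul' := fun c p => by
        ext1
        · simp [timePart_eq]; ring
        · apply E3_ext <;> simp [spacePart_zero, spacePart_one, spacePart_two] <;> ring }

lemma lorentzMap_apply (A : Matrix (Fin 4) (Fin 4) ℝ) (p : ℝ × E3) :
    lorentzMap A p = (timePart A p.1 p.2, spacePart A p.1 p.2) := rfl

/-- This is the chain rule in coordinates: it says which old partial derivatives enter a new one. -/
lemma lorentzMap_stBasis (A : Matrix (Fin 4) (Fin 4) ℝ) (ν : Fin 4) :
    lorentzMap A (stBasis ν) = ∑ μ, A μ ν • stBasis μ := by
  rw [lorentzMap_apply, Fin.sum_univ_four]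
  ext1
  · fin_cases ν <;> simp [timePart_eq, stBasis]
  · fin_cases ν <;> apply E3_ext <;>
      simp [spacePart_zero, spacePart_one, spacePart_two, stBasis]

/-! ## Change of variables on the mass shell -/

/-- Derivative of the energy. -/
noncomputable def energyDeriv (m : ℝ) (v : E3) : E3 →L[ℝ] ℝ := (energy m v)⁻¹ • innerSL ℝ v

lemma energyDeriv_apply (m : ℝ) (v w : E3) :
    energyDeriv m v w = (energy m v)⁻¹ * inner ℝ v w := by
  simp [energyDeriv]

lemma hasFDerivAt_energy {m : ℝ} (hm : 0 < m) (v : E3) :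
    HasFDerivAt (energy m) (energyDeriv m v) v := by
  have h1 : HasFDerivAt (fun v : E3 => m ^ 2 + ‖v‖ ^ 2) (2 • innerSL ℝ v) v :=
    ((hasStrictFDerivAt_norm_sq v).hasFDerivAt).const_add (m ^ 2)
  have h2 := h1.sqrt (by positivity)
  refine h2.congr_fderiv ?_
  ext w
  have : Real.sqrt (m ^ 2 + ‖v‖ ^ 2) ≠ 0 := (energy_pos hm v).ne'
  simp [energyDeriv, energy]
  field_simp

lemma contDiff_energy {m : ℝ} (hm : 0 < m) {n : WithTop ℕ∞} : ContDiff ℝ n (energy m) := by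
  unfold energy
  exact (contDiff_const.add (contDiff_norm_sq ℝ)).sqrt fun v => by positivity

/-- Derivative of the momentum map. -/
noncomputable def momentumDeriv (A : Matrix (Fin 4) (Fin 4) ℝ) (m : ℝ) (v : E3) : E3 →L[ℝ] E3 :=
  (ContinuousLinearMap.snd ℝ ℝ E3).comp
    ((lorentzMap A).comp ((energyDeriv m v).prod (ContinuousLinearMap.id ℝ E3)))

lemma momentumDeriv_apply (A : Matrix (Fin 4) (Fin 4) ℝ) (m : ℝ) (v w : E3) :
    momentumDeriv A m v w = spacePart A (energyDeriv m v w) w := rfl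

lemma hasFDerivAt_momentumMap (A : Matrix (Fin 4) (Fin 4) ℝ) {m : ℝ} (hm : 0 < m) (v : E3) :
    HasFDerivAt (momentumMap A m) (momentumDeriv A m v) v := by
  have h := (hasFDerivAt_energy hm v).prodMk (hasFDerivAt_id v)
  exact ((ContinuousLinearMap.snd ℝ ℝ E3).comp (lorentzMap A)).hasFDerivAt.comp v h

lemma contDiff_momentumMap (A : Matrix (Fin 4) (Fin 4) ℝ) {m : ℝ} (hm : 0 < m)
    {n : WithTop ℕ∞} : ContDiff ℝ n (momentumMap A m) :=
  ((ContinuousLinearMap.snd ℝ ℝ E3).comp (lorentzMap A)).contDiff.comp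
    ((contDiff_energy hm).prodMk contDiff_id)

/-- The Jacobian determinant of the momentum map is the ratio of the energies. -/
lemma det_momentumDeriv {A : Matrix (Fin 4) (Fin 4) ℝ} (hA : A ∈ restrictedLorentz) {m : ℝ}
    (hm : 0 < m) (v : E3) :
    (momentumDeriv A m v).det = timePart A (energy m v) v / energy m v := by
  -- As `det A = 1`, the minors of the spatial rows are, up to sign, entries of the first row of
  -- `A`. The Jacobian is the spatial block plus a rank-one term from the energy; expanding it
  -- produces these minors, weighted by `v / v⁰`, and so the time component divided by the energy.
  have hadj : ∀ i j, A.adjugate i j = A⁻¹ i j := by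
    intro i j; rw [Matrix.inv_def, hA.2.1]; simp
  have c0 := hadj 0 0; have c1 := hadj 1 0; have c2 := hadj 2 0; have c3 := hadj 3 0
  simp only [Matrix.adjugate_fin_succ_eq_det_submatrix, lorentz_inv_apply hA] at c0 c1 c2 c3
  simp [Matrix.det_fin_three, Fin.succAbove] at c0 c1 c2 c3
  have hE := (energy_pos hm v).ne'
  rw [ContinuousLinearMap.det, ← LinearMap.det_toMatrix (EuclideanSpace.basisFun (Fin 3) ℝ).toBasis,
    Matrix.det_fin_three]
  simp only [LinearMap.toMatrix_apply]
  simp [momentumDeriv_apply, spacePart_zero, spacePart_one, spacePart_two, energyDeriv_apply,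
    timePart_eq, inner_E3]
  field_simp
  linear_combination energy m v ^ 2 * (energy m v * c0 - v 0 * c1 - v 1 * c2 - v 2 * c3)

/-- Invariance of `dv / v⁰` under Lorentz transformations. -/
lemma integral_momentumMap {A : Matrix (Fin 4) (Fin 4) ℝ} (hA : A ∈ restrictedLorentz) {m : ℝ}
    (hm : 0 < m) (g : E3 → ℝ) :
    ∫ v, timePart A (energy m v) v / energy m v * g (momentumMap A m v) = ∫ w, g w := by
  have hinj : Function.Injective (momentumMap A m) :=
    Function.LeftInverse.injective (momentumMap_inv_apply hA hm)
  have hsurj : Function.Surjective (momentumMap A m) :=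
    Function.RightInverse.surjective (momentumMap_apply_inv hA hm)
  have h := integral_image_eq_integral_abs_det_fderiv_smul volume MeasurableSet.univ
    (fun v _ => (hasFDerivAt_momentumMap A hm v).hasFDerivWithinAt) hinj.injOn g
  rw [image_univ, hsurj.range_eq] at h
  simp only [Measure.restrict_univ] at h
  rw [h]
  congr 1
  ext v
  rw [det_momentumDeriv hA hm, abs_of_pos (div_pos (timePart_energy_pos hA hm v) (energy_pos hm v)),
    smul_eq_mul]

lemma norm_velocity_lt {m : ℝ} (hm : 0 < m) (v : E3) : ‖velocity m v‖ < 1 := by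
  rw [velocity, norm_smul, norm_inv, Real.norm_eq_abs, abs_of_pos (energy_pos hm v),
    inv_mul_lt_iff₀ (energy_pos hm v), mul_one]
  exact norm_lt_energy hm v

lemma contDiff_velocity {m : ℝ} (hm : 0 < m) {n : WithTop ℕ∞} : ContDiff ℝ n (velocity m) :=
  ((contDiff_energy hm).inv fun v => (energy_pos hm v).ne').smul contDiff_id

lemma energy_smul_velocity {m : ℝ} (hm : 0 < m) (v : E3) : energy m v • velocity m v = v := by
  rw [velocity, smul_smul, mul_inv_cancel₀ (energy_pos hm v).ne', one_smul]

lemma fourVec_smul (c t : ℝ) (x : E3) : fourVec (c * t) (c • x) = c • fourVec t x := by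
  ext i; fin_cases i <;> simp [fourVec]

/-- The four-velocity `(1, v̂)` transforms up to the ratio of energies. -/
lemma fourVelocity_momentumMap {A : Matrix (Fin 4) (Fin 4) ℝ} (hA : A ∈ restrictedLorentz) {m : ℝ}
    (hm : 0 < m) (v : E3) :
    (timePart A (energy m v) v / energy m v) •
      A⁻¹.mulVec (fourVec 1 (velocity m (momentumMap A m v))) = fourVec 1 (velocity m v) := by
  have hE := (energy_pos hm v).ne'
  have hE' := (timePart_energy_pos hA hm v).ne'
  have h1 : ∀ w, fourVec 1 (velocity m w) = (energy m w)⁻¹ • fourVec (energy m w) w := by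
    intro w
    rw [← fourVec_smul, inv_mul_cancel₀ (energy_pos hm w).ne', velocity]
  rw [h1, h1, energy_momentumMap hA hm, momentumMap, fourVec_parts, Matrix.mulVec_smul,
    Matrix.mulVec_mulVec, lorentz_inv_mul hA, Matrix.one_mulVec, smul_smul]
  congr 1
  field_simp

/-- A single formula for all four components, with weight `(1, v̂)`, lets charge and current be
transformed together. Integrability of the current follows from that of the density because speeds
are below one. -/
lemma fourVec_density_apply {N : ℕ} {m : Fin N → ℝ} (hm : ∀ α, 0 < m α) (e : Fin N → ℝ)
    (f : Fin N → ℝ → E3 → E3 → ℝ) (t : ℝ) (x : E3)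
    (hf : ∀ α, Integrable fun v => f α t x v) (μ : Fin 4) :
    fourVec (chargeDensity e f t x) (currentDensity m e f t x) μ
      = ∑ α, e α * ∫ v, f α t x v * fourVec 1 (velocity (m α) v) μ := by
  have hint : ∀ α, Integrable fun v => f α t x v • velocity (m α) v := by
    intro α
    refine (hf α).smul_bdd 1 (contDiff_velocity (n := 1) (hm α)).continuous.aestronglyMeasurable
      (Filter.Eventually.of_forall fun v => (norm_velocity_lt (hm α) v).le)
  have hc : ∀ i : Fin 3, currentDensity m e f t x i
      = ∑ α, e α * ∫ v, f α t x v * velocity (m α) v i := by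
    intro i
    rw [currentDensity]
    have : (∑ α, e α • ∫ v, f α t x v • velocity (m α) v) i
        = ∑ α, e α * (∫ v, f α t x v • velocity (m α) v) i := by simp
    rw [this]
    refine Finset.sum_congr rfl fun α _ => ?_
    congr 1
    have := (EuclideanSpace.proj (𝕜 := ℝ) i : E3 →L[ℝ] ℝ).integral_comp_comm (hint α)
    simpa using this.symm
  fin_cases μ
  · simp [fourVec, chargeDensity]
  · simpa [fourVec] using hc 0
  · simpa [fourVec] using hc 1
  · simpa [fourVec] using hc 2

/-- Lorentz covariance of the four-current. -/
lemma fourVec_density_lorentz {N : ℕ} {m : Fin N → ℝ} (hm : ∀ α, 0 < m α) (e : Fin N → ℝ)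
    {A : Matrix (Fin 4) (Fin 4) ℝ} (hA : A ∈ restrictedLorentz)
    (f f' : Fin N → ℝ → E3 → E3 → ℝ) (t t' : ℝ) (x x' : E3)
    (hf : ∀ α, Integrable fun v => f α t x v) (hf' : ∀ α, Integrable fun v => f' α t' x' v)
    (h : ∀ α v, f' α t' x' v = f α t x (momentumMap A (m α) v)) :
    fourVec (chargeDensity e f' t' x') (currentDensity m e f' t' x')
      = A⁻¹.mulVec (fourVec (chargeDensity e f t x) (currentDensity m e f t x)) := by
  have hint : ∀ α μ, Integrable fun v => f α t x v * fourVec 1 (velocity (m α) v) μ := by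
    intro α μ
    refine (hf α).mul_bdd (c := 1) ?_ (Filter.Eventually.of_forall fun v => ?_)
    · have hv : ∀ i : Fin 3, Continuous fun v => velocity (m α) v i := fun i =>
        (EuclideanSpace.proj (𝕜 := ℝ) i : E3 →L[ℝ] ℝ).continuous.comp
          (contDiff_velocity (n := 1) (hm α)).continuous
      fin_cases μ
      · simpa [fourVec] using aestronglyMeasurable_const
      · simpa [fourVec] using (hv 0).aestronglyMeasurable
      · simpa [fourVec] using (hv 1).aestronglyMeasurable
      · simpa [fourVec] using (hv 2).aestronglyMeasurable
    · have hv : ∀ i : Fin 3, ‖velocity (m α) v i‖ ≤ 1 := fun i =>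
        (PiLp.norm_apply_le (velocity (m α) v) i).trans (norm_velocity_lt (hm α) v).le
      fin_cases μ
      · simp [fourVec]
      · simpa [fourVec] using hv 0
      · simpa [fourVec] using hv 1
      · simpa [fourVec] using hv 2
  ext μ
  rw [fourVec_density_apply hm e f' t' x' hf', Matrix.mulVec, dotProduct]
  simp only [fourVec_density_apply hm e f t x hf, Finset.mul_sum]
  rw [Finset.sum_comm]
  refine Finset.sum_congr rfl fun α _ => ?_
  -- The integrand as a function of the new momentum: the energy ratio by which the four-velocity
  -- fails to be a vector is exactly the Jacobian factor of the change of variables.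
  let g : E3 → ℝ := fun w => ∑ ν, A⁻¹ μ ν * (f α t x w * fourVec 1 (velocity (m α) w) ν)
  have h1 : ∀ v, f' α t' x' v * fourVec 1 (velocity (m α) v) μ
      = timePart A (energy (m α) v) v / energy (m α) v * g (momentumMap A (m α) v) := by
    intro v
    rw [← fourVelocity_momentumMap hA (hm α) v, h]
    simp only [g, Pi.smul_apply, Matrix.mulVec, dotProduct, smul_eq_mul, Finset.mul_sum]
    exact Finset.sum_congr rfl fun ν _ => by ring
  have h2 : ∫ v, f' α t' x' v * fourVec 1 (velocity (m α) v) μ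
      = ∑ ν, A⁻¹ μ ν * ∫ v, f α t x v * fourVec 1 (velocity (m α) v) ν := by
    rw [(integral_congr_ae (Filter.Eventually.of_forall h1)).trans
      (integral_momentumMap hA (hm α) g)]
    simp only [g]
    rw [integral_finsetSum _ fun ν _ => (hint α ν).const_mul _]
    exact Finset.sum_congr rfl fun ν _ => integral_const_mul _ _
  rw [h2, Finset.mul_sum]
  exact Finset.sum_congr rfl fun ν _ => by ring

/-! ## Regular solutions on a region of spacetime -/

/-- A solution of the relativistic Vlasov-Maxwell system which is `C¹` in a neighbourhood of each
point of `U` and whose densities have compact momentum support there. -/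
structure RegularSolution {N : ℕ} (m e : Fin N → ℝ) (U : Set (ℝ × E3))
    (f : Fin N → ℝ → E3 → E3 → ℝ) (E B : ℝ → E3 → E3) : Prop where
  contDiffAt_f : ∀ α, ∀ p ∈ U, ∀ v,
    ContDiffAt ℝ 1 (fun q : ℝ × E3 × E3 => f α q.1 q.2.1 q.2.2) (p.1, p.2, v)
  contDiffAt_E : ∀ p ∈ U, ContDiffAt ℝ 1 (fun q : ℝ × E3 => E q.1 q.2) p
  contDiffAt_B : ∀ p ∈ U, ContDiffAt ℝ 1 (fun q : ℝ × E3 => B q.1 q.2) p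
  support_f : ∀ α, ∀ p ∈ U, ∃ R, ∀ v, f α p.1 p.2 v ≠ 0 → ‖v‖ ≤ R
  vlasov : ∀ α, ∀ p ∈ U, ∀ v,
    fderiv ℝ (fun q : ℝ × E3 × E3 => f α q.1 q.2.1 q.2.2) (p.1, p.2, v)
      (energy (m α) v, v, e α • (energy (m α) v • E p.1 p.2 + cross v (B p.1 p.2))) = 0
  maxwell : ∀ p ∈ U,
    MaxwellRelations (fun γ => fderiv ℝ (fun q : ℝ × E3 => E q.1 q.2) p (stBasis γ))
      (fun γ => fderiv ℝ (fun q : ℝ × E3 => B q.1 q.2) p (stBasis γ))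
      (fourVec (chargeDensity e f p.1 p.2) (currentDensity m e f p.1 p.2))

lemma integrable_of_support_ball {g : E3 → ℝ} (hg : Continuous g) {R : ℝ}
    (hR : ∀ v, g v ≠ 0 → ‖v‖ ≤ R) : Integrable g := by
  refine hg.integrable_of_hasCompactSupport ?_
  refine HasCompactSupport.intro (isCompact_closedBall (0 : E3) R) fun v hv => ?_
  by_contra h
  exact hv (by simpa using hR v h)

section

variable {N : ℕ} {m e : Fin N → ℝ} {U : Set (ℝ × E3)} {f : Fin N → ℝ → E3 → E3 → ℝ}
  {E B : ℝ → E3 → E3}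

lemma RegularSolution.continuous_f (h : RegularSolution m e U f E B) (α : Fin N) {t : ℝ} {x : E3}
    (hp : (t, x) ∈ U) : Continuous fun v => f α t x v := by
  rw [continuous_iff_continuousAt]
  intro v
  have h1 : ContinuousAt (fun v : E3 => (t, x, v)) v := by fun_prop
  exact ContinuousAt.comp (f := fun v : E3 => (t, x, v))
    (g := fun q : ℝ × E3 × E3 => f α q.1 q.2.1 q.2.2) (h.contDiffAt_f α _ hp v).continuousAt h1

lemma RegularSolution.integrable_f (h : RegularSolution m e U f E B) (α : Fin N) {t : ℝ} {x : E3}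
    (hp : (t, x) ∈ U) : Integrable fun v => f α t x v := by
  obtain ⟨R, hR⟩ := h.support_f α _ hp
  exact integrable_of_support_ball (h.continuous_f α hp) hR

/-- The spatial part is the Lorentz force times the energy and the time part is the work. Written as
tensor times four-momentum, the force inherits its covariance from the tensor. -/
lemma faradayTensor_mulVec (E B : E3) (t : ℝ) (v : E3) :
    (faradayTensor E B * minkowski).mulVec (fourVec t v)
      = fourVec (inner ℝ v E) (t • E + cross v B) := by
  rw [inner_E3]
  ext i
  fin_cases i <;>
    simp [faradayTensor, minkowski, Matrix.mulVec, dotProduct, fourVec, Fin.sum_univ_four, cross]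
    <;> ring

lemma inner_cross_self (v w : E3) : inner ℝ v (cross v w) = 0 := by
  rw [inner_E3]; simp [cross]; ring

lemma fourVec_injective {t s : ℝ} {x y : E3} (h : fourVec t x = fourVec s y) : t = s ∧ x = y := by
  have h0 := congrFun h 0; have h1 := congrFun h 1; have h2 := congrFun h 2; have h3 := congrFun h 3
  simp [fourVec] at h0 h1 h2 h3
  exact ⟨h0, E3_ext h1 h2 h3⟩

/-- Lorentz covariance of the Lorentz force. -/
lemma momentumDeriv_force {A : Matrix (Fin 4) (Fin 4) ℝ} (hA : A ∈ restrictedLorentz) {m : ℝ}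
    (hm : 0 < m) (v E B : E3) :
    momentumDeriv A m v
        (energy m v • electricMap A (E, B) + cross v (magneticMap A (E, B)))
      = energy m (momentumMap A m v) • E + cross (momentumMap A m v) B := by
  have hE := (energy_pos hm v).ne'
  set E' := electricMap A (E, B) with hE'
  set B' := magneticMap A (E, B) with hB'
  -- The magnetic force does no work, so the energy component induced on the mass shell agrees with
  -- the time component of the four-force.
  have h1 : energyDeriv m v (energy m v • E' + cross v B') = inner ℝ v E' := by
    rw [energyDeriv_apply, inner_add_right, inner_cross_self, real_inner_smul_right]
    field_simp; ring
  rw [momentumDeriv_apply, h1]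
  have h2 : faradayTensor E' B' = fieldTensor A E B := faradayTensor_maps A E B
  have h3 : A.mulVec ((faradayTensor E' B' * minkowski).mulVec (fourVec (energy m v) v))
      = (faradayTensor E B * minkowski).mulVec
        (fourVec (energy m (momentumMap A m v)) (momentumMap A m v)) := by
    rw [energy_momentumMap hA hm, momentumMap, fourVec_parts, Matrix.mulVec_mulVec,
      Matrix.mulVec_mulVec, h2, fieldTensor]
    congr 1
    calc A * (A⁻¹ * faradayTensor E B * (A⁻¹).transpose * minkowski)
        = (A * A⁻¹) * faradayTensor E B * ((A⁻¹).transpose * minkowski) := by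
          simp only [Matrix.mul_assoc]
      _ = _ := by
          rw [lorentz_mul_inv hA, Matrix.one_mul, inv_transpose_mul_minkowski hA, Matrix.mul_assoc]
  rw [faradayTensor_mulVec, faradayTensor_mulVec, ← fourVec_parts] at h3
  exact (fourVec_injective h3).2

/-- Partial derivatives of the transformed fields. -/
lemma fderiv_fields_lorentz {A : Matrix (Fin 4) (Fin 4) ℝ} {E B : ℝ → E3 → E3} {p : ℝ × E3}
    (hE : ContDiffAt ℝ 1 (fun q : ℝ × E3 => E q.1 q.2) (lorentzMap A p))
    (hB : ContDiffAt ℝ 1 (fun q : ℝ × E3 => B q.1 q.2) (lorentzMap A p)) (γ : Fin 4) :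
    fderiv ℝ (fun q : ℝ × E3 => electricMap A (E (timePart A q.1 q.2) (spacePart A q.1 q.2),
        B (timePart A q.1 q.2) (spacePart A q.1 q.2))) p (stBasis γ)
      = electricMap A (∑ μ, A μ γ •
        (fderiv ℝ (fun q : ℝ × E3 => E q.1 q.2) (lorentzMap A p) (stBasis μ),
          fderiv ℝ (fun q : ℝ × E3 => B q.1 q.2) (lorentzMap A p) (stBasis μ))) ∧
    fderiv ℝ (fun q : ℝ × E3 => magneticMap A (E (timePart A q.1 q.2) (spacePart A q.1 q.2),
        B (timePart A q.1 q.2) (spacePart A q.1 q.2))) p (stBasis γ)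
      = magneticMap A (∑ μ, A μ γ •
        (fderiv ℝ (fun q : ℝ × E3 => E q.1 q.2) (lorentzMap A p) (stBasis μ),
          fderiv ℝ (fun q : ℝ × E3 => B q.1 q.2) (lorentzMap A p) (stBasis μ))) := by
  have hpair : HasFDerivAt
      (fun q : ℝ × E3 => (E (timePart A q.1 q.2) (spacePart A q.1 q.2),
        B (timePart A q.1 q.2) (spacePart A q.1 q.2)))
      (((fderiv ℝ (fun q : ℝ × E3 => E q.1 q.2) (lorentzMap A p)).prod
        (fderiv ℝ (fun q : ℝ × E3 => B q.1 q.2) (lorentzMap A p))).comp (lorentzMap A)) p :=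
    HasFDerivAt.comp (g := fun q : ℝ × E3 => (E q.1 q.2, B q.1 q.2))
      (f := lorentzMap A) p
      ((hE.differentiableAt one_ne_zero).hasFDerivAt.prodMk
        (hB.differentiableAt one_ne_zero).hasFDerivAt)
      (lorentzMap A).hasFDerivAt
  have h3 := ((electricMap A).hasFDerivAt.comp p hpair).fderiv
  have h4 := ((magneticMap A).hasFDerivAt.comp p hpair).fderiv
  simp only [Function.comp_def] at h3 h4
  rw [h3, h4]
  constructor <;> simp only [ContinuousLinearMap.comp_apply, lorentzMap_stBasis, map_sum, map_smul,
        ContinuousLinearMap.prod_apply]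

/-- Lorentz covariance of the relativistic Vlasov-Maxwell system. -/
theorem RegularSolution.lorentz (h : RegularSolution m e U f E B) (hm : ∀ α, 0 < m α)
    {A : Matrix (Fin 4) (Fin 4) ℝ} (hA : A ∈ restrictedLorentz) :
    RegularSolution m e (lorentzMap A ⁻¹' U)
      (fun α t x v => f α (timePart A t x) (spacePart A t x) (momentumMap A (m α) v))
      (fun t x => electricMap A
        (E (timePart A t x) (spacePart A t x), B (timePart A t x) (spacePart A t x)))
      (fun t x => magneticMap A
        (E (timePart A t x) (spacePart A t x), B (timePart A t x) (spacePart A t x))) := by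
  have hpair : ∀ p ∈ lorentzMap A ⁻¹' U, ContDiffAt ℝ 1
      (fun q : ℝ × E3 => (E (timePart A q.1 q.2) (spacePart A q.1 q.2),
        B (timePart A q.1 q.2) (spacePart A q.1 q.2))) p := fun p hp =>
    ContDiffAt.comp (g := fun q : ℝ × E3 => (E q.1 q.2, B q.1 q.2)) (f := lorentzMap A) p
      ((h.contDiffAt_E _ hp).prodMk (h.contDiffAt_B _ hp)) (lorentzMap A).contDiff.contDiffAt
  have hphase : ∀ α, ∀ p : ℝ × E3, ∀ v, HasFDerivAt
      (fun q : ℝ × E3 × E3 =>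
        ((timePart A q.1 q.2.1, spacePart A q.1 q.2.1, momentumMap A (m α) q.2.2) : ℝ × E3 × E3))
      ((((ContinuousLinearMap.fst ℝ ℝ E3).comp (lorentzMap A)).comp
          ((ContinuousLinearMap.fst ℝ ℝ (E3 × E3)).prod
            ((ContinuousLinearMap.fst ℝ E3 E3).comp (ContinuousLinearMap.snd ℝ ℝ (E3 × E3))))).prod
        ((((ContinuousLinearMap.snd ℝ ℝ E3).comp (lorentzMap A)).comp
          ((ContinuousLinearMap.fst ℝ ℝ (E3 × E3)).prod
            ((ContinuousLinearMap.fst ℝ E3 E3).comp (ContinuousLinearMap.snd ℝ ℝ (E3 × E3))))).prod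
        ((momentumDeriv A (m α) v).comp
          ((ContinuousLinearMap.snd ℝ E3 E3).comp (ContinuousLinearMap.snd ℝ ℝ (E3 × E3))))))
      (p.1, p.2, v) := by
    intro α p v
    have h1 := ((((ContinuousLinearMap.fst ℝ ℝ E3).comp (lorentzMap A)).comp
      ((ContinuousLinearMap.fst ℝ ℝ (E3 × E3)).prod ((ContinuousLinearMap.fst ℝ E3 E3).comp
        (ContinuousLinearMap.snd ℝ ℝ (E3 × E3)))))).hasFDerivAt (x := (p.1, p.2, v))
    have h2 := ((((ContinuousLinearMap.snd ℝ ℝ E3).comp (lorentzMap A)).comp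
      ((ContinuousLinearMap.fst ℝ ℝ (E3 × E3)).prod ((ContinuousLinearMap.fst ℝ E3 E3).comp
        (ContinuousLinearMap.snd ℝ ℝ (E3 × E3)))))).hasFDerivAt (x := (p.1, p.2, v))
    have h3 := ((ContinuousLinearMap.snd ℝ E3 E3).comp
      (ContinuousLinearMap.snd ℝ ℝ (E3 × E3))).hasFDerivAt (x := (p.1, p.2, v))
    have h4 := HasFDerivAt.comp (p.1, p.2, v) (hasFDerivAt_momentumMap A (hm α) v) h3
    exact h1.prodMk (h2.prodMk h4)
  have hsupp : ∀ α, ∀ p ∈ lorentzMap A ⁻¹' U, ∃ R, ∀ v,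
      f α (timePart A p.1 p.2) (spacePart A p.1 p.2) (momentumMap A (m α) v) ≠ 0 → ‖v‖ ≤ R := by
    intro α p hp
    obtain ⟨R, hR⟩ := h.support_f α _ hp
    -- Support in the new momentum is the image of a ball under the continuous inverse momentum map,
    -- hence bounded.
    obtain ⟨C, hC⟩ := ((isCompact_closedBall (0 : E3) R).image
      (contDiff_momentumMap (n := 1) A⁻¹ (hm α)).continuous).isBounded.exists_norm_le
    refine ⟨C, fun v hv => ?_⟩
    rw [← momentumMap_inv_apply hA (hm α) v]
    exact hC _ ⟨_, by simpa using hR _ hv, rfl⟩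
  have hf1 : ∀ α, ∀ p ∈ lorentzMap A ⁻¹' U, ∀ v,
    ContDiffAt ℝ 1 (fun q : ℝ × E3 × E3 => f α (timePart A q.1 q.2.1) (spacePart A q.1 q.2.1)
      (momentumMap A (m α) q.2.2)) (p.1, p.2, v) := by
    intro α p hp v
    refine ContDiffAt.comp (g := fun q : ℝ × E3 × E3 => f α q.1 q.2.1 q.2.2)
      (f := fun q : ℝ × E3 × E3 => (timePart A q.1 q.2.1, spacePart A q.1 q.2.1,
        momentumMap A (m α) q.2.2)) (p.1, p.2, v) (h.contDiffAt_f α _ hp _) ?_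
    have e1 : ContDiff ℝ 1 (fun q : ℝ × E3 × E3 => lorentzMap A (q.1, q.2.1)) :=
      (lorentzMap A).contDiff.comp (contDiff_fst.prodMk (contDiff_fst.comp contDiff_snd))
    have e2 : ContDiff ℝ 1 (fun q : ℝ × E3 × E3 => momentumMap A (m α) q.2.2) :=
      (contDiff_momentumMap A (hm α)).comp (contDiff_snd.comp contDiff_snd)
    exact ((contDiff_fst.comp e1).prodMk ((contDiff_snd.comp e1).prodMk e2)).contDiffAt
  constructor
  · exact hf1
  · exact fun p hp => (electricMap A).contDiff.contDiffAt.comp p (hpair p hp)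
  · exact fun p hp => (magneticMap A).contDiff.contDiffAt.comp p (hpair p hp)
  · exact hsupp
  · intro α p hp v
    have h1 := HasFDerivAt.comp (p.1, p.2, v)
      (g := fun q : ℝ × E3 × E3 => f α q.1 q.2.1 q.2.2)
      (((h.contDiffAt_f α _ hp (momentumMap A (m α) v)).differentiableAt one_ne_zero).hasFDerivAt)
      (hphase α p v)
    have h2 := h1.fderiv
    simp only [Function.comp_def] at h2
    rw [h2]
    -- With the equation multiplied by the energy, the differential of the phase space map sends the
    -- new transport vector exactly to the old one, with no leftover ratio of energies.
    have h3 := h.vlasov α _ hp (momentumMap A (m α) v)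
    rw [← momentumDeriv_force hA (hm α), energy_momentumMap hA (hm α), ← map_smul] at h3
    exact h3
  · intro p hp
    have h1 := (h.maxwell _ hp).lorentz hA
    have h2 := fourVec_density_lorentz hm e hA f (fun α t x v => f α (timePart A t x)
      (spacePart A t x) (momentumMap A (m α) v)) (timePart A p.1 p.2) p.1 (spacePart A p.1 p.2) p.2
      (fun α => h.integrable_f α hp) (fun α => by
        obtain ⟨R, hR⟩ := hsupp α p hp
        refine integrable_of_support_ball ?_ hR
        exact (h.continuous_f α hp).comp (contDiff_momentumMap (n := 1) A (hm α)).continuous)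
      (fun α v => rfl)
    rw [h2]
    convert h1 using 2 with γ γ
    · exact (fderiv_fields_lorentz (h.contDiffAt_E _ hp) (h.contDiffAt_B _ hp) γ).1
    · exact (fderiv_fields_lorentz (h.contDiffAt_E _ hp) (h.contDiffAt_B _ hp) γ).2
    · rfl

/-! ### Slices of spacetime derivatives -/

lemma deriv_slice {V : Type*} [NormedAddCommGroup V] [NormedSpace ℝ V] {g : ℝ × E3 → V} {t : ℝ}
    {x : E3} (hg : DifferentiableAt ℝ g (t, x)) :
    HasDerivAt (fun s => g (s, x)) (fderiv ℝ g (t, x) (stBasis 0)) t := by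
  have h1 : HasDerivAt (fun s : ℝ => (s, x)) ((1 : ℝ), (0 : E3)) t :=
    (hasDerivAt_id t).prodMk (hasDerivAt_const t x)
  exact hg.hasFDerivAt.comp_hasDerivAt t h1

lemma fderiv_slice {V : Type*} [NormedAddCommGroup V] [NormedSpace ℝ V] {g : ℝ × E3 → V} {t : ℝ}
    {x : E3} (hg : DifferentiableAt ℝ g (t, x)) :
    HasFDerivAt (fun y => g (t, y))
      ((fderiv ℝ g (t, x)).comp (ContinuousLinearMap.inr ℝ ℝ E3)) x := by
  have h1 : HasFDerivAt (fun y : E3 => (t, y)) (ContinuousLinearMap.inr ℝ ℝ E3) x :=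
    hasFDerivAt_prodMk_right t x
  exact hg.hasFDerivAt.comp x h1

lemma stBasis_succ (i : Fin 3) : stBasis i.succ = (0, EuclideanSpace.single i 1) := by
  fin_cases i <;> rfl

lemma partialDeriv_apply_eq {g : E3 → E3} {g' : E3 →L[ℝ] E3} {x : E3} (hg : HasFDerivAt g g' x)
    (i j : Fin 3) :
    partialDeriv i (fun y => g y j) x = g' (EuclideanSpace.single i 1) j := by
  have h := ((EuclideanSpace.proj (𝕜 := ℝ) j : E3 →L[ℝ] ℝ).hasFDerivAt.comp x hg).fderiv
  simp only [Function.comp_def] at h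
  rw [partialDeriv]
  erw [h]
  rfl

lemma partialDeriv_slice {F : ℝ → E3 → E3} {t : ℝ} {x : E3}
    (hF : DifferentiableAt ℝ (fun q : ℝ × E3 => F q.1 q.2) (t, x)) (i j : Fin 3) :
    partialDeriv i (fun y => F t y j) x
      = fderiv ℝ (fun q : ℝ × E3 => F q.1 q.2) (t, x) (stBasis i.succ) j := by
  rw [partialDeriv_apply_eq (fderiv_slice hF), stBasis_succ]
  rfl

lemma curl_slice {F : ℝ → E3 → E3} {t : ℝ} {x : E3}
    (hF : DifferentiableAt ℝ (fun q : ℝ × E3 => F q.1 q.2) (t, x)) :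
    curl (F t) x = !₂[
      fderiv ℝ (fun q : ℝ × E3 => F q.1 q.2) (t, x) (stBasis 2) 2
        - fderiv ℝ (fun q : ℝ × E3 => F q.1 q.2) (t, x) (stBasis 3) 1,
      fderiv ℝ (fun q : ℝ × E3 => F q.1 q.2) (t, x) (stBasis 3) 0
        - fderiv ℝ (fun q : ℝ × E3 => F q.1 q.2) (t, x) (stBasis 1) 2,
      fderiv ℝ (fun q : ℝ × E3 => F q.1 q.2) (t, x) (stBasis 1) 1
        - fderiv ℝ (fun q : ℝ × E3 => F q.1 q.2) (t, x) (stBasis 2) 0] := by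
  rw [curl]
  simp only [partialDeriv_slice hF]
  rfl

lemma divergence_slice {F : ℝ → E3 → E3} {t : ℝ} {x : E3}
    (hF : DifferentiableAt ℝ (fun q : ℝ × E3 => F q.1 q.2) (t, x)) :
    divergence (F t) x = fderiv ℝ (fun q : ℝ × E3 => F q.1 q.2) (t, x) (stBasis 1) 0
      + fderiv ℝ (fun q : ℝ × E3 => F q.1 q.2) (t, x) (stBasis 2) 1
      + fderiv ℝ (fun q : ℝ × E3 => F q.1 q.2) (t, x) (stBasis 3) 2 := by
  rw [divergence, Fin.sum_univ_three]
  simp only [partialDeriv_slice hF]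
  rfl

lemma derivWithin_Ici_of_hasDerivAt {V : Type*} [NormedAddCommGroup V] [NormedSpace ℝ V]
    {g : ℝ → V} {g' : V} {T t : ℝ} (ht : T ≤ t) (h : HasDerivAt g g' t) :
    derivWithin g (Ici T) t = g' :=
  h.hasDerivWithinAt.derivWithin (uniqueDiffOn_Ici T t ht)

/-- The Vlasov operator as a directional derivative in phase space. -/
lemma vlasov_operator_eq {m : ℝ} (hm : 0 < m) (e : ℝ) {g : ℝ → E3 → E3 → ℝ} {T t : ℝ} {x v : E3}
    (E B : E3) (ht : T ≤ t)
    (hg : DifferentiableAt ℝ (fun q : ℝ × E3 × E3 => g q.1 q.2.1 q.2.2) (t, x, v)) :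
    fderiv ℝ (fun q : ℝ × E3 × E3 => g q.1 q.2.1 q.2.2) (t, x, v)
        (energy m v, v, e • (energy m v • E + cross v B))
      = energy m v * (derivWithin (fun s => g s x v) (Ici T) t
        + fderiv ℝ (fun y => g t y v) x (velocity m v)
        + e * fderiv ℝ (fun w => g t x w) v (E + cross (velocity m v) B)) := by
  set G : ℝ × E3 × E3 → ℝ := fun q => g q.1 q.2.1 q.2.2 with hG
  have hd := hg.hasFDerivAt
  have h1 : HasDerivAt (fun s => g s x v) (fderiv ℝ G (t, x, v) (1, 0, 0)) t :=
    HasFDerivAt.comp_hasDerivAt (l := G) (f := fun s : ℝ => (s, x, v)) t hd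
      ((hasDerivAt_id t).prodMk (hasDerivAt_const t (x, v)))
  have h2 : HasFDerivAt (fun y => g t y v) ((fderiv ℝ G (t, x, v)).comp
      ((ContinuousLinearMap.inr ℝ ℝ (E3 × E3)).comp (ContinuousLinearMap.inl ℝ E3 E3))) x :=
    HasFDerivAt.comp (g := G) (f := fun y : E3 => (t, y, v)) x hd
      (HasFDerivAt.comp (g := fun q : E3 × E3 => (t, q)) (f := fun y : E3 => (y, v)) x
        (hasFDerivAt_prodMk_right t (x, v)) (hasFDerivAt_prodMk_left x v))
  have h3 : HasFDerivAt (fun w => g t x w) ((fderiv ℝ G (t, x, v)).comp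
      ((ContinuousLinearMap.inr ℝ ℝ (E3 × E3)).comp (ContinuousLinearMap.inr ℝ E3 E3))) v :=
    HasFDerivAt.comp (g := G) (f := fun w : E3 => (t, x, w)) v hd
      (HasFDerivAt.comp (g := fun q : E3 × E3 => (t, q)) (f := fun w : E3 => (x, w)) v
        (hasFDerivAt_prodMk_right t (x, v)) (hasFDerivAt_prodMk_right x v))
  rw [derivWithin_Ici_of_hasDerivAt ht h1, h2.fderiv, h3.fderiv]
  have h5 : ((energy m v, v, e • (energy m v • E + cross v B)) : ℝ × E3 × E3)
      = energy m v • ((1, 0, 0) + (0, velocity m v, 0)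
        + e • (0, 0, E + cross (velocity m v) B)) := by
    have h6 : cross v B = energy m v • cross (velocity m v) B := by
      conv_lhs => rw [← energy_smul_velocity hm v]
      apply E3_ext <;> simp [cross] <;> ring
    ext1
    · simp
    · ext1
      · simp [energy_smul_velocity hm v]
      · simp [h6, smul_add, smul_smul, mul_comm]
  rw [h5, map_smul, map_add, map_add, map_smul, smul_eq_mul, smul_eq_mul]
  rfl

/-- A regular solution on a region containing `[T, ∞) × ℝ³` is a solution on `[T, ∞)`. -/
theorem RegularSolution.isSolution (h : RegularSolution m e U f E B) (hm : ∀ α, 0 < m α) {T : ℝ}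
    (hU : ∀ t x, T ≤ t → (t, x) ∈ U) : IsSolution m e T f E B := by
  have hmax : ∀ t x, T ≤ t → _ := fun t x ht =>
    (maxwellRelations_iff _ _ _ _).mp (h.maxwell (t, x) (hU t x ht))
  have dE : ∀ t x, T ≤ t → DifferentiableAt ℝ (fun q : ℝ × E3 => E q.1 q.2) (t, x) :=
    fun t x ht => (h.contDiffAt_E _ (hU t x ht)).differentiableAt one_ne_zero
  have dB : ∀ t x, T ≤ t → DifferentiableAt ℝ (fun q : ℝ × E3 => B q.1 q.2) (t, x) :=
    fun t x ht => (h.contDiffAt_B _ (hU t x ht)).differentiableAt one_ne_zero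
  constructor
  · rintro α ⟨t, x, v⟩ hp
    exact (h.contDiffAt_f α (t, x) (hU t x hp.1) v).contDiffWithinAt
  · rintro ⟨t, x⟩ hp
    exact (h.contDiffAt_E (t, x) (hU t x hp.1)).contDiffWithinAt
  · rintro ⟨t, x⟩ hp
    exact (h.contDiffAt_B (t, x) (hU t x hp.1)).contDiffWithinAt
  · exact fun α t ht x => h.integrable_f α (hU t x ht)
  · intro α t ht x v
    have h4 := vlasov_operator_eq (hm α) (e α) (E t x) (B t x) ht
      ((h.contDiffAt_f α (t, x) (hU t x ht) v).differentiableAt one_ne_zero)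
    rw [h.vlasov α (t, x) (hU t x ht) v] at h4
    exact (mul_eq_zero.mp h4.symm).resolve_left (energy_pos (hm α) v).ne'
  · intro t ht x
    rw [derivWithin_Ici_of_hasDerivAt ht (deriv_slice (dE t x ht)), curl_slice (dB t x ht)]
    exact (hmax t x ht).1
  · intro t ht x
    rw [divergence_slice (dE t x ht)]
    exact (hmax t x ht).2.1
  · intro t ht x
    rw [derivWithin_Ici_of_hasDerivAt ht (deriv_slice (dB t x ht)), curl_slice (dE t x ht)]
    exact (hmax t x ht).2.2.1
  · intro t ht x
    rw [divergence_slice (dB t x ht)]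
    exact (hmax t x ht).2.2.2

/-- Time translation of a regular solution. -/
theorem RegularSolution.shift (h : RegularSolution m e U f E B) (T : ℝ) :
    RegularSolution m e ((fun p : ℝ × E3 => (p.1 + T, p.2)) ⁻¹' U)
      (fun α t x v => f α (t + T) x v) (fun t x => E (t + T) x) (fun t x => B (t + T) x) := by
  have hs : ∀ {V : Type} [NormedAddCommGroup V] [NormedSpace ℝ V] {W : Type}
      [NormedAddCommGroup W] [NormedSpace ℝ W] (g : ℝ × V → W) (t : ℝ) (x : V),
      fderiv ℝ (fun q : ℝ × V => g (q.1 + T, q.2)) (t, x) = fderiv ℝ g (t + T, x) := by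
    intro V _ _ W _ _ g t x
    have := fderiv_comp_add_right (𝕜 := ℝ) (f := g) (x := (t, x)) (T, (0 : V))
    simpa [Prod.add_def] using this
  have hc : ∀ {V : Type} [NormedAddCommGroup V] [NormedSpace ℝ V],
      ContDiff ℝ 1 (fun q : ℝ × V => (q.1 + T, q.2)) := fun {V} _ _ =>
    (contDiff_fst.add contDiff_const).prodMk contDiff_snd
  constructor
  · intro α p hp v
    exact ContDiffAt.comp (g := fun q : ℝ × E3 × E3 => f α q.1 q.2.1 q.2.2)
      (f := fun q : ℝ × E3 × E3 => (q.1 + T, q.2)) (p.1, p.2, v)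
      (h.contDiffAt_f α _ hp v) hc.contDiffAt
  · intro p hp
    exact ContDiffAt.comp (g := fun q : ℝ × E3 => E q.1 q.2)
      (f := fun q : ℝ × E3 => (q.1 + T, q.2)) p (h.contDiffAt_E _ hp) hc.contDiffAt
  · intro p hp
    exact ContDiffAt.comp (g := fun q : ℝ × E3 => B q.1 q.2)
      (f := fun q : ℝ × E3 => (q.1 + T, q.2)) p (h.contDiffAt_B _ hp) hc.contDiffAt
  · exact fun α p hp => h.support_f α _ hp
  · intro α p hp v
    have := h.vlasov α _ hp v
    rw [← hs (fun q : ℝ × E3 × E3 => f α q.1 q.2.1 q.2.2)] at this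
    exact this
  · rintro ⟨t, x⟩ hp
    have := h.maxwell _ hp
    simp only [← hs] at this
    exact this

end

/-! ## Characteristics of the Vlasov equation -/

lemma norm_cross_le (a b : E3) : ‖cross a b‖ ≤ ‖a‖ * ‖b‖ := by
  have h : ‖cross a b‖ ^ 2 ≤ (‖a‖ * ‖b‖) ^ 2 := by
    rw [mul_pow, norm_sq_E3, norm_sq_E3, norm_sq_E3]
    simp [cross]
    nlinarith [sq_nonneg (a 0 * b 0 + a 1 * b 1 + a 2 * b 2)]
  exact le_of_sq_le_sq h (by positivity)

lemma cross_add_left (a a' b : E3) : cross (a + a') b = cross a b + cross a' b := by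
  apply E3_ext <;> simp [cross] <;> ring

lemma cross_add_right (a b b' : E3) : cross a (b + b') = cross a b + cross a b' := by
  apply E3_ext <;> simp [cross] <;> ring

lemma cross_smul_left (c : ℝ) (a b : E3) : cross (c • a) b = c • cross a b := by
  apply E3_ext <;> simp [cross] <;> ring

lemma cross_smul_right (c : ℝ) (a b : E3) : cross a (c • b) = c • cross a b := by
  apply E3_ext <;> simp [cross] <;> ring

/-- The cross product as a continuous bilinear map. -/
noncomputable def crossCLM : E3 →L[ℝ] E3 →L[ℝ] E3 :=
  (LinearMap.mk₂ ℝ cross cross_add_left cross_smul_left cross_add_right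
    cross_smul_right).mkContinuous₂ 1 fun a b => by
      simpa using norm_cross_le a b

lemma crossCLM_apply (a b : E3) : crossCLM a b = cross a b := rfl

/-- The Lorentz force on a particle of mass `m`, charge `e` and momentum `v`. -/
noncomputable def lorentzForce (m e : ℝ) (E B : ℝ → E3 → E3) (t : ℝ) (x v : E3) : E3 :=
  e • (E t x + cross (velocity m v) (B t x))

lemma norm_lorentzForce_le {m : ℝ} (hm : 0 < m) (e : ℝ) (E B : ℝ → E3 → E3) (t : ℝ) (x v : E3) :
    ‖lorentzForce m e E B t x v‖ ≤ |e| * (‖E t x‖ + ‖B t x‖) := by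
  rw [lorentzForce, norm_smul, Real.norm_eq_abs]
  refine mul_le_mul_of_nonneg_left ((norm_add_le _ _).trans ?_) (abs_nonneg e)
  gcongr
  refine (norm_cross_le _ _).trans ?_
  have := (norm_velocity_lt hm v).le
  nlinarith [norm_nonneg (B t x)]

lemma contDiffOn_lorentzForce {m : ℝ} (hm : 0 < m) (e : ℝ) {E B : ℝ → E3 → E3}
    (hE : ContDiffOn ℝ 1 (fun p : ℝ × E3 => E p.1 p.2) (Ici 0 ×ˢ univ))
    (hB : ContDiffOn ℝ 1 (fun p : ℝ × E3 => B p.1 p.2) (Ici 0 ×ˢ univ)) :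
    ContDiffOn ℝ 1 (fun q : ℝ × E3 × E3 => lorentzForce m e E B q.1 q.2.1 q.2.2)
      (Ici 0 ×ˢ univ) := by
  have hπ : ContDiff ℝ 1 (fun q : ℝ × E3 × E3 => (q.1, q.2.1)) :=
    contDiff_fst.prodMk (contDiff_fst.comp contDiff_snd)
  have hmaps : MapsTo (fun q : ℝ × E3 × E3 => (q.1, q.2.1)) (Ici 0 ×ˢ univ)
      ((Ici 0 : Set ℝ) ×ˢ (univ : Set E3)) := fun q hq => ⟨hq.1, mem_univ _⟩
  have e1 := hE.comp hπ.contDiffOn hmaps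
  have e2 := hB.comp hπ.contDiffOn hmaps
  have e3 : ContDiffOn ℝ 1 (fun q : ℝ × E3 × E3 => velocity m q.2.2) (Ici 0 ×ˢ univ) :=
    ((contDiff_velocity hm).comp (contDiff_snd.comp contDiff_snd)).contDiffOn
  have e4 := (crossCLM.contDiff.comp_contDiffOn e3).clm_apply e2
  exact (e1.add e4).const_smul e

/-- A characteristic curve of the Vlasov equation on the time interval `[0, t]`. -/
structure IsCharacteristic (m e : ℝ) (E B : ℝ → E3 → E3) (t : ℝ) (X V : ℝ → E3) : Prop where
  pos : ∀ s ∈ Icc 0 t, HasDerivWithinAt X (velocity m (V s)) (Icc 0 t) s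
  mom : ∀ s ∈ Icc 0 t, HasDerivWithinAt V (lorentzForce m e E B s (X s) (V s)) (Icc 0 t) s

lemma exists_slab_bound {V W : Type*} [NormedAddCommGroup V] [NormedAddCommGroup W]
    [ProperSpace V] {F : ℝ → V → W}
    (hF : ContinuousOn (fun p : ℝ × V => F p.1 p.2) (Ici 0 ×ˢ univ)) (t : ℝ) (x : V) (R : ℝ) :
    ∃ C, 0 ≤ C ∧ ∀ s ∈ Icc 0 t, ∀ y ∈ Metric.closedBall x R, ‖F s y‖ ≤ C := by
  have hc : IsCompact ((Icc 0 t : Set ℝ) ×ˢ Metric.closedBall x R) :=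
    isCompact_Icc.prod (isCompact_closedBall x R)
  obtain ⟨C, hC⟩ := hc.exists_bound_of_continuousOn
    (hF.mono (prod_mono (fun s hs => hs.1) (subset_univ _)))
  exact ⟨max C 0, le_max_right _ _, fun s hs y hy =>
    (hC (s, y) ⟨hs, hy⟩).trans (le_max_left _ _)⟩

/-- A comparison form of the mean value inequality: exhibiting an antiderivative `b` of the bound
replaces integrating it. The set `S` may exceed `[r, t]`, so derivatives known on `[0, t]` can be
used on subintervals. -/
lemma norm_sub_le_of_deriv_bound {V : Type*} [NormedAddCommGroup V] [NormedSpace ℝ V]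
    {F F' : ℝ → V} {b b' : ℝ → ℝ} {r t : ℝ} {S : Set ℝ} (hS : Icc r t ⊆ S)
    (hF : ∀ s ∈ Icc r t, HasDerivWithinAt F (F' s) S s)
    (hb : ∀ s ∈ Icc r t, HasDerivAt b (b' s) s) (h : ∀ s ∈ Icc r t, ‖F' s‖ ≤ b' s) :
    ∀ s ∈ Icc r t, ‖F s - F r‖ ≤ b s - b r := by
  have hF2 : ∀ s ∈ Icc r t, HasDerivWithinAt (fun s => F s - F r) (F' s) (Icc r t) s :=
    fun s hs => ((hF s hs).mono hS).sub_const _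
  have hb2 : ∀ s ∈ Icc r t, HasDerivAt (fun s => b s - b r) (b' s) s :=
    fun s hs => (hb s hs).sub_const _
  refine image_norm_le_of_norm_deriv_right_le_deriv_boundary' (f' := F')
    (fun s hs => (hF2 s hs).continuousWithinAt) ?_ (by simp)
    (fun s hs => (hb2 s hs).continuousAt.continuousWithinAt) (B' := b') ?_
    (fun s hs => h s (Ico_subset_Icc_self hs))
  · intro s hs
    exact (hF2 s (Ico_subset_Icc_self hs)).mono_of_mem_nhdsWithin
      (Icc_mem_nhdsGE_of_mem hs)
  · exact fun s hs => (hb2 s (Ico_subset_Icc_self hs)).hasDerivWithinAt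

/-- Existence of integral curves of a bounded `C¹` vector field. -/
lemma exists_backward_integralCurve {W : Type*} [NormedAddCommGroup W] [NormedSpace ℝ W]
    [ProperSpace W] [CompleteSpace W] {G : ℝ → W → W}
    (hG : ContDiffOn ℝ 1 (fun q : ℝ × W => G q.1 q.2) (Ici 0 ×ˢ univ)) {L t : ℝ} (hL : 0 ≤ L)
    (ht : 0 ≤ t) (hb : ∀ s ∈ Icc 0 t, ∀ q, ‖G s q‖ ≤ L) (w : W) :
    ∃ c : ℝ → W, c t = w ∧ ∀ s ∈ Icc 0 t, HasDerivWithinAt c (G s (c s)) (Icc 0 t) s := by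
  have hsub : (Icc 0 t : Set ℝ) ×ˢ Metric.closedBall w (L * t) ⊆ Ici 0 ×ˢ univ :=
    prod_mono (fun s hs => hs.1) (subset_univ _)
  obtain ⟨K, hK⟩ := (hG.mono hsub).exists_lipschitzOnWith one_ne_zero
    ((convex_Icc 0 t).prod (convex_closedBall _ _)) (isCompact_Icc.prod (isCompact_closedBall _ _))
  -- A curve of speed at most `L` cannot leave the ball of radius `L t` within time `t`, so
  -- Picard–Lindelöf reaches all the way back from the terminal time `t` to `0`.
  have hPL : IsPicardLindelof G (⟨t, ht, le_rfl⟩ : Icc 0 t) w ⟨L * t, by positivity⟩ 0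
      ⟨L, hL⟩ K := by
    refine ⟨fun s hs => ?_, fun q _ => ?_, fun s hs q _ => hb s hs q, ?_⟩
    · intro a ha b hb
      have h1 := hK (x := (s, a)) ⟨hs, ha⟩ (y := (s, b)) ⟨hs, hb⟩
      rwa [Prod.edist_eq (s, a) (s, b), edist_self, max_eq_right zero_le] at h1
    · have h1 : ContinuousOn (fun s : ℝ => (s, q)) (Icc 0 t) := by fun_prop
      exact ContinuousOn.comp (g := fun q : ℝ × W => G q.1 q.2) hG.continuousOn h1
        fun s hs => ⟨hs.1, mem_univ _⟩
    · change L * max (t - t) (t - 0) ≤ L * t - 0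
      rw [sub_self, sub_zero, sub_zero, max_eq_right ht]
  exact hPL.exists_eq_forall_mem_Icc_hasDerivWithinAt₀

section

variable {m e : ℝ} {E B : ℝ → E3 → E3} {t : ℝ} {X V : ℝ → E3}

/-- Particles travel slower than light, which has speed one here. -/
lemma IsCharacteristic.norm_pos_sub_le (h : IsCharacteristic m e E B t X V) (hm : 0 < m) {r s : ℝ}
    (hr : 0 ≤ r) (hrs : r ≤ s) (hst : s ≤ t) : ‖X s - X r‖ ≤ s - r :=
  norm_sub_le_of_deriv_bound (F := X) (F' := fun s => velocity m (V s)) (b := id)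
    (b' := fun _ => 1) (Icc_subset_Icc_left hr) (fun σ hσ => h.pos σ ⟨hr.trans hσ.1, hσ.2⟩)
    (fun σ _ => hasDerivAt_id σ) (fun _ _ => (norm_velocity_lt hm _).le) s ⟨hrs, hst⟩

/-- Through every point of phase space passes a characteristic, defined back to time `0`. -/
theorem exists_isCharacteristic (hm : 0 < m) (e : ℝ)
    (hE : ContDiffOn ℝ 1 (fun p : ℝ × E3 => E p.1 p.2) (Ici 0 ×ˢ univ))
    (hB : ContDiffOn ℝ 1 (fun p : ℝ × E3 => B p.1 p.2) (Ici 0 ×ˢ univ))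
    (ht : 0 ≤ t) (x v : E3) :
    ∃ X V, IsCharacteristic m e E B t X V ∧ X t = x ∧ V t = v := by
  obtain ⟨CE, hCE0, hCE⟩ := exists_slab_bound hE.continuousOn t x (t + 2)
  obtain ⟨CB, hCB0, hCB⟩ := exists_slab_bound hB.continuousOn t x (t + 2)
  -- A `C¹` field need not be bounded in space, so the force is cut off. The position moves at most
  -- `t` from `x`, so it stays where the cutoff is one and the curve solves the original equation.
  let χ : ContDiffBump x := ⟨t + 1, t + 2, by linarith, by linarith⟩
  let G : ℝ → E3 × E3 → E3 × E3 := fun s q =>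
    (velocity m q.2, χ q.1 • lorentzForce m e E B s q.1 q.2)
  have hG : ContDiffOn ℝ 1 (fun q : ℝ × E3 × E3 => G q.1 q.2) (Ici 0 ×ˢ univ) := by
    have h1 : ContDiffOn ℝ 1 (fun q : ℝ × E3 × E3 => χ q.2.1) (Ici 0 ×ˢ univ) :=
      (χ.contDiff.comp (contDiff_fst.comp contDiff_snd)).contDiffOn
    exact ContDiffOn.prodMk
      ((contDiff_velocity hm).comp (contDiff_snd.comp contDiff_snd)).contDiffOn
      (h1.smul (contDiffOn_lorentzForce hm e hE hB))
  set L : ℝ := max 1 (|e| * (CE + CB)) with hL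
  have hL0 : 0 ≤ L := le_trans zero_le_one (le_max_left _ _)
  have hbound : ∀ s ∈ Icc 0 t, ∀ q, ‖G s q‖ ≤ L := by
    intro s hs q
    refine norm_prod_le_iff.mpr ⟨(norm_velocity_lt hm _).le.trans (le_max_left _ _), ?_⟩
    refine le_trans ?_ (le_max_right _ _)
    rw [norm_smul, Real.norm_eq_abs, abs_of_nonneg χ.nonneg]
    by_cases hq : q.1 ∈ Metric.closedBall x (t + 2)
    · refine (mul_le_of_le_one_left (norm_nonneg _) χ.le_one).trans
        ((norm_lorentzForce_le hm e E B s q.1 q.2).trans ?_)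
      have := hCE s hs _ hq; have := hCB s hs _ hq
      gcongr
    · have : χ q.1 = 0 := χ.zero_of_le_dist (by
        simp only [Metric.mem_closedBall, not_le] at hq; exact hq.le)
      rw [this, zero_mul]
      positivity
  obtain ⟨c, hc0, hc⟩ := exists_backward_integralCurve hG hL0 ht hbound (x, v)
  have hX : ∀ s ∈ Icc 0 t, HasDerivWithinAt (fun s => (c s).1) (velocity m (c s).2) (Icc 0 t) s :=
    fun s hs => (hc s hs).fst
  have hX' : ∀ s ∈ Icc 0 t, ‖(c t).1 - (c s).1‖ ≤ t - s := fun s hs =>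
    norm_sub_le_of_deriv_bound (F := fun s => (c s).1) (F' := fun s => velocity m (c s).2)
      (b := id) (b' := fun _ => 1) (Icc_subset_Icc_left hs.1)
      (fun σ hσ => hX σ ⟨hs.1.trans hσ.1, hσ.2⟩)
      (fun σ _ => hasDerivAt_id σ) (fun _ _ => (norm_velocity_lt hm _).le) t ⟨hs.2, le_rfl⟩
  refine ⟨fun s => (c s).1, fun s => (c s).2, ⟨hX, fun s hs => ?_⟩, by simp [hc0], by simp [hc0]⟩
  have h1 : HasDerivWithinAt (fun s => (c s).2)
      (χ (c s).1 • lorentzForce m e E B s (c s).1 (c s).2) (Icc 0 t) s := (hc s hs).snd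
  have h2 : χ (c s).1 = 1 := by
    refine χ.one_of_mem_closedBall ?_
    have := hX' s hs
    rw [hc0] at this
    rw [Metric.mem_closedBall, dist_comm, dist_eq_norm]
    change _ ≤ t + 1
    linarith [hs.1]
  rwa [h2, one_smul] at h1

end

/-- Densities are constant along characteristics. -/
theorem IsSolution.eq_along_characteristic {N : ℕ} {m e : Fin N → ℝ}
    {f : Fin N → ℝ → E3 → E3 → ℝ} {E B : ℝ → E3 → E3} (h : IsSolution m e 0 f E B) {α : Fin N}
    {t : ℝ} {X V : ℝ → E3} (hc : IsCharacteristic (m α) (e α) E B t X V) :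
    ∀ s ∈ Icc 0 t, f α s (X s) (V s) = f α 0 (X 0) (V 0) := by
  set g : ℝ × E3 × E3 → ℝ := fun q => f α q.1 q.2.1 q.2.2 with hg
  set S : Set (ℝ × E3 × E3) := Ici 0 ×ˢ univ with hS
  have hd : ∀ s ∈ Icc 0 t, HasDerivWithinAt (fun s => f α s (X s) (V s)) 0 (Icc 0 t) s := by
    intro s hs
    have h0 : (s, X s, V s) ∈ S := ⟨hs.1, mem_univ _⟩
    -- The derivative is taken within `s ≥ 0` since the curve reaches `s = 0`, where regularity is
    -- one-sided.
    have hD := ((h.contDiff_f α).differentiableOn one_ne_zero _ h0).hasFDerivWithinAt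
    set D := fderivWithin ℝ (fun p : ℝ × E3 × E3 => f α p.1 p.2.1 p.2.2)
      (Ici 0 ×ˢ univ) (s, X s, V s) with hDdef
    have h1 : HasDerivWithinAt (fun σ => f α σ (X s) (V s)) (D (1, 0, 0)) (Ici 0) s :=
      HasFDerivWithinAt.comp_hasDerivWithinAt (l := g) (f := fun σ : ℝ => (σ, X s, V s)) s hD
        ((hasDerivAt_id s).prodMk (hasDerivAt_const s (X s, V s))).hasDerivWithinAt
        (fun σ hσ => ⟨hσ, mem_univ _⟩)
    have h2 : HasFDerivAt (fun y => f α s y (V s)) (D.comp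
        ((ContinuousLinearMap.inr ℝ ℝ (E3 × E3)).comp (ContinuousLinearMap.inl ℝ E3 E3))) (X s) := by
      rw [← hasFDerivWithinAt_univ]
      refine HasFDerivWithinAt.comp (g := g) (f := fun y : E3 => (s, y, V s)) (t := S) (X s) hD
        (HasFDerivAt.comp (g := fun q : E3 × E3 => (s, q)) (f := fun y : E3 => (y, V s)) (X s)
          (hasFDerivAt_prodMk_right s (X s, V s))
          (hasFDerivAt_prodMk_left (X s) (V s))).hasFDerivWithinAt (fun y _ => ⟨hs.1, mem_univ _⟩)
    have h3 : HasFDerivAt (fun w => f α s (X s) w) (D.comp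
        ((ContinuousLinearMap.inr ℝ ℝ (E3 × E3)).comp (ContinuousLinearMap.inr ℝ E3 E3))) (V s) := by
      rw [← hasFDerivWithinAt_univ]
      refine HasFDerivWithinAt.comp (g := g) (f := fun w : E3 => (s, X s, w)) (t := S) (V s) hD
        (HasFDerivAt.comp (g := fun q : E3 × E3 => (s, q)) (f := fun w : E3 => (X s, w)) (V s)
          (hasFDerivAt_prodMk_right s (X s, V s))
          (hasFDerivAt_prodMk_right (X s) (V s))).hasFDerivWithinAt (fun y _ => ⟨hs.1, mem_univ _⟩)
    have h4 := h.vlasov α s hs.1 (X s) (V s)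
    rw [h1.derivWithin (uniqueDiffOn_Ici 0 s hs.1), h2.fderiv, h3.fderiv] at h4
    have h5 : HasDerivWithinAt (fun s => f α s (X s) (V s))
        (D (1, velocity (m α) (V s), lorentzForce (m α) (e α) E B s (X s) (V s))) (Icc 0 t) s :=
      HasFDerivWithinAt.comp_hasDerivWithinAt (l := g) (f := fun σ : ℝ => (σ, X σ, V σ)) s hD
        ((hasDerivWithinAt_id s _).prodMk ((hc.pos s hs).prodMk (hc.mom s hs)))
        (fun σ hσ => ⟨hσ.1, mem_univ _⟩)
    convert h5 using 1
    rw [← h4, ← smul_eq_mul, ← map_smul]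
    simp only [ContinuousLinearMap.comp_apply, ContinuousLinearMap.inl_apply,
      ContinuousLinearMap.inr_apply, ← map_add]
    congr 1
    simp [lorentzForce]
  intro s hs
  exact constant_of_derivWithin_zero (fun σ hσ => (hd σ hσ).differentiableWithinAt)
    (fun σ hσ => (hd σ (Ico_subset_Icc_self hσ)).derivWithin
      (uniqueDiffOn_Icc (lt_of_le_of_lt hσ.1 hσ.2) σ (Ico_subset_Icc_self hσ))) s hs

/-! ## Finite speed of propagation -/

section

variable {N : ℕ} {m e : Fin N → ℝ} {k : ℝ} {f : Fin N → ℝ → E3 → E3 → ℝ} {E B : ℝ → E3 → E3}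

lemma StandingHypothesis.exists_characteristic (h : StandingHypothesis m e k f E B)
    (hm : ∀ α, 0 < m α) (α : Fin N) {t : ℝ} (ht : 0 ≤ t) (x v : E3) :
    ∃ X V, IsCharacteristic (m α) (e α) E B t X V ∧ X t = x ∧ V t = v ∧
      f α t x v = f α 0 (X 0) (V 0) := by
  obtain ⟨X, V, hc, rfl, rfl⟩ := exists_isCharacteristic (hm α) (e α) h.solution.contDiff_E
    h.solution.contDiff_B ht x v
  exact ⟨X, V, hc, rfl, rfl, h.solution.eq_along_characteristic hc t ⟨ht, le_rfl⟩⟩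

lemma StandingHypothesis.f_nonneg (h : StandingHypothesis m e k f E B) (hm : ∀ α, 0 < m α)
    (α : Fin N) {t : ℝ} (ht : 0 ≤ t) (x v : E3) : 0 ≤ f α t x v := by
  obtain ⟨X, V, -, -, -, hf⟩ := h.exists_characteristic hm α ht x v
  rw [hf]; exact h.init_f_nonneg _ _ _

/-- A nonzero value is transported from the initial support, and the position can have moved by at
most `t`. -/
lemma StandingHypothesis.f_eq_zero (h : StandingHypothesis m e k f E B) (hm : ∀ α, 0 < m α)
    (α : Fin N) {t : ℝ} (ht : 0 ≤ t) {x : E3} (hx : t + k < ‖x‖) (v : E3) : f α t x v = 0 := by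
  obtain ⟨X, V, hc, rfl, -, hf⟩ := h.exists_characteristic hm α ht x v
  by_contra h0
  rw [hf] at h0
  have h1 := (h.init_f_support α _ _ h0).1
  have h2 := hc.norm_pos_sub_le (hm α) le_rfl ht le_rfl
  have h3 := norm_le_norm_add_norm_sub (X 0) (X t)
  rw [norm_sub_rev] at h3
  linarith

/-- Transport preserves values, so a bound for the compactly supported data holds for all times. -/
lemma StandingHypothesis.exists_f_le (h : StandingHypothesis m e k f E B) (hm : ∀ α, 0 < m α)
    (α : Fin N) : ∃ C, 0 ≤ C ∧ ∀ t, 0 ≤ t → ∀ x v, f α t x v ≤ C := by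
  have hc : IsCompact (Metric.closedBall (0 : E3) k ×ˢ Metric.closedBall (0 : E3) k) :=
    (isCompact_closedBall _ _).prod (isCompact_closedBall _ _)
  obtain ⟨C, hC⟩ := hc.exists_bound_of_continuousOn (h.init_f_contDiff α).continuous.continuousOn
  refine ⟨max C 0, le_max_right _ _, fun t ht x v => ?_⟩
  obtain ⟨X, V, -, -, -, hf⟩ := h.exists_characteristic hm α ht x v
  rw [hf]
  by_cases h0 : f α 0 (X 0) (V 0) = 0
  · rw [h0]; exact le_max_right _ _
  · have h1 := h.init_f_support α _ _ h0
    refine (le_abs_self _).trans ((hC (X 0, V 0) ⟨?_, ?_⟩).trans (le_max_left _ _))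
    · simpa using h1.1
    · simpa using h1.2

end

/-! ### Integrals of divergences and parametric integrals -/

lemma continuous_partialDeriv {g : E3 → ℝ} (hg : ContDiff ℝ 1 g) (i : Fin 3) :
    Continuous (partialDeriv i g) :=
  (hg.continuous_fderiv one_ne_zero).clm_apply continuous_const

lemma hasCompactSupport_partialDeriv {g : E3 → ℝ} (hg : HasCompactSupport g) (i : Fin 3) :
    HasCompactSupport (partialDeriv i g) :=
  hg.fderiv_apply ℝ _

/-- Integration by parts against the constant function one. -/
lemma integral_partialDeriv_eq_zero {g : E3 → ℝ} (hg : ContDiff ℝ 1 g) (hs : HasCompactSupport g)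
    (i : Fin 3) : ∫ x, partialDeriv i g x = 0 := by
  have hi : Integrable (fun x => fderiv ℝ g x (EuclideanSpace.single i 1)) :=
    (continuous_partialDeriv hg i).integrable_of_hasCompactSupport
      (hasCompactSupport_partialDeriv hs i)
  have h := integral_mul_fderiv_eq_neg_fderiv_mul_of_integrable (μ := (volume : Measure E3))
    (f := fun _ : E3 => (1 : ℝ)) (g := g) (v := EuclideanSpace.single i 1) (by simp)
    (by simpa using hi) (by simpa using hg.continuous.integrable_of_hasCompactSupport hs)
    (fun x _ => differentiableAt_const _) (fun x _ => hg.differentiable one_ne_zero x)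
  simpa [partialDeriv] using h

lemma contDiff_coord {P : E3 → E3} (hP : ContDiff ℝ 1 P) (i : Fin 3) :
    ContDiff ℝ 1 (fun y => P y i) :=
  (EuclideanSpace.proj (𝕜 := ℝ) i : E3 →L[ℝ] ℝ).contDiff.comp hP

lemma hasCompactSupport_coord {P : E3 → E3} (hP : HasCompactSupport P) (i : Fin 3) :
    HasCompactSupport (fun y => P y i) :=
  hP.comp_left (g := fun z : E3 => z i) rfl

lemma integrable_divergence {P : E3 → E3} (hP : ContDiff ℝ 1 P) (hs : HasCompactSupport P) :
    Integrable (divergence P) :=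
  integrable_finsetSum _ fun i _ =>
    (continuous_partialDeriv (contDiff_coord hP i) i).integrable_of_hasCompactSupport
      (hasCompactSupport_partialDeriv (hasCompactSupport_coord hs i) i)

/-- The divergence theorem for compactly supported fields. -/
lemma integral_divergence_eq_zero {P : E3 → E3} (hP : ContDiff ℝ 1 P) (hs : HasCompactSupport P) :
    ∫ x, divergence P x = 0 := by
  simp only [divergence]
  rw [integral_finsetSum _ fun i _ =>
    (continuous_partialDeriv (contDiff_coord hP i) i).integrable_of_hasCompactSupport
      (hasCompactSupport_partialDeriv (hasCompactSupport_coord hs i) i)]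
  exact Finset.sum_eq_zero fun i _ =>
    integral_partialDeriv_eq_zero (contDiff_coord hP i) (hasCompactSupport_coord hs i) i

/-- On a compact time interval around `s` that avoids `0`, the derivative is bounded by a constant
times the indicator of `K`, which gives domination. Nothing is required at `s = 0`. -/
lemma hasDerivAt_integral_of_compact_support {H H' : ℝ → E3 → ℝ} {K : Set E3} (hK : IsCompact K)
    (hH : ContinuousOn (fun p : ℝ × E3 => H p.1 p.2) (Ioi 0 ×ˢ univ))
    (hH' : ContinuousOn (fun p : ℝ × E3 => H' p.1 p.2) (Ioi 0 ×ˢ univ))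
    (h0 : ∀ s y, 0 < s → y ∉ K → H s y = 0) (h0' : ∀ s y, 0 < s → y ∉ K → H' s y = 0)
    (hd : ∀ s y, 0 < s → HasDerivAt (fun σ => H σ y) (H' s y) s) {s : ℝ} (hs : 0 < s) :
    Integrable (H' s) ∧ HasDerivAt (fun σ => ∫ y, H σ y) (∫ y, H' s y) s := by
  have hslice : ∀ {G : ℝ → E3 → ℝ}, ContinuousOn (fun p : ℝ × E3 => G p.1 p.2) (Ioi 0 ×ˢ univ) →
      ∀ σ, 0 < σ → Continuous (G σ) := by
    intro G hG σ hσ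
    have h1 : Continuous (fun y : E3 => (σ, y)) := by fun_prop
    exact hG.comp_continuous h1 fun y => ⟨hσ, mem_univ _⟩
  have hsub : Icc (s / 2) (3 * s / 2) ×ˢ K ⊆ Ioi (0 : ℝ) ×ˢ univ := by
    rintro ⟨σ, y⟩ ⟨h1, -⟩
    exact ⟨lt_of_lt_of_le (by linarith) h1.1, mem_univ _⟩
  obtain ⟨C, hC⟩ := (isCompact_Icc.prod hK).exists_bound_of_continuousOn (hH'.mono hsub)
  refine hasDerivAt_integral_of_dominated_loc_of_deriv_le (s := Icc (s / 2) (3 * s / 2))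
    (bound := K.indicator fun _ => C) (Icc_mem_nhds (by linarith) (by linarith)) ?_ ?_ ?_ ?_ ?_ ?_
  · filter_upwards [Ioi_mem_nhds hs] with σ hσ
    exact (hslice hH σ hσ).aestronglyMeasurable
  · exact (hslice hH s hs).integrable_of_hasCompactSupport
      (HasCompactSupport.intro hK fun y hy => h0 s y hs hy)
  · exact (hslice hH' s hs).aestronglyMeasurable
  · refine Filter.Eventually.of_forall fun y σ hσ => ?_
    by_cases hy : y ∈ K
    · rw [indicator_of_mem hy]; exact hC (σ, y) ⟨hσ, hy⟩
    · rw [indicator_of_notMem hy, h0' σ y (lt_of_lt_of_le (by linarith) hσ.1) hy, norm_zero]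
  · exact (integrableOn_const hK.measure_ne_top).integrable_indicator hK.measurableSet
  · exact Filter.Eventually.of_forall fun y σ hσ =>
      hd σ y (lt_of_lt_of_le (by linarith) hσ.1)

/-! ### The energy estimate for the Maxwell equations -/

lemma partialDeriv_mul {g h : E3 → ℝ} {x : E3} (hg : DifferentiableAt ℝ g x)
    (hh : DifferentiableAt ℝ h x) (i : Fin 3) :
    partialDeriv i (fun y => g y * h y) x = partialDeriv i g x * h x + g x * partialDeriv i h x := by
  rw [partialDeriv, fderiv_fun_mul hg hh]
  simp [partialDeriv]; ring

lemma partialDeriv_sub {g h : E3 → ℝ} {x : E3} (hg : DifferentiableAt ℝ g x)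
    (hh : DifferentiableAt ℝ h x) (i : Fin 3) :
    partialDeriv i (fun y => g y - h y) x = partialDeriv i g x - partialDeriv i h x := by
  rw [partialDeriv, fderiv_fun_sub hg hh]
  simp [partialDeriv]

lemma differentiableAt_coord {P : E3 → E3} {x : E3} (hP : DifferentiableAt ℝ P x) (i : Fin 3) :
    DifferentiableAt ℝ (fun y => P y i) x :=
  (EuclideanSpace.proj (𝕜 := ℝ) i : E3 →L[ℝ] ℝ).differentiableAt.comp x hP

/-- Poynting's identity with a weight: the curl terms are those produced by differentiating the
energy density in time, and the gradient of the weight is the only other contribution. -/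
lemma divergence_smul_cross {c : E3 → ℝ} {E B : E3 → E3} {x : E3} (hc : DifferentiableAt ℝ c x)
    (hE : DifferentiableAt ℝ E x) (hB : DifferentiableAt ℝ B x) :
    divergence (fun y => c y • cross (E y) (B y)) x
      = partialDeriv 0 c x * cross (E x) (B x) 0 + partialDeriv 1 c x * cross (E x) (B x) 1
        + partialDeriv 2 c x * cross (E x) (B x) 2
        + c x * (inner ℝ (B x) (curl E x) - inner ℝ (E x) (curl B x)) := by
  have dE := fun i => differentiableAt_coord hE i
  have dB := fun i => differentiableAt_coord hB i
  have key : ∀ i a b, partialDeriv i (fun y => c y * (E y a * B y b - E y b * B y a)) x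
      = partialDeriv i c x * (E x a * B x b - E x b * B x a)
        + c x * (partialDeriv i (fun y => E y a) x * B x b + E x a * partialDeriv i (fun y => B y b) x
          - (partialDeriv i (fun y => E y b) x * B x a
            + E x b * partialDeriv i (fun y => B y a) x)) := by
    intro i a b
    have d1 : ∀ a b, DifferentiableAt ℝ (fun y => E y a * B y b) x := fun a b => (dE a).mul (dB b)
    have d2 : DifferentiableAt ℝ (fun y => E y a * B y b - E y b * B y a) x :=
      (d1 a b).sub (d1 b a)
    rw [partialDeriv_mul hc d2, partialDeriv_sub (d1 a b) (d1 b a), partialDeriv_mul (dE a) (dB b), partialDeriv_mul (dE b) (dB a)]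
  have k0 := key 0 1 2
  have k1 := key 1 2 0
  have k2 := key 2 0 1
  rw [divergence, Fin.sum_univ_three, inner_E3, inner_E3]
  simp [cross, curl] at k0 k1 k2 ⊢
  rw [k0, k1, k2]
  ring

/-- A smooth weight, positive inside the backward light cone with vertex `(t₀ + 2ε, x₀)` (up to a
regularisation of size `ε`). -/
noncomputable def coneWeight (ε t₀ : ℝ) (x₀ : E3) (s : ℝ) (y : E3) : ℝ :=
  expNegInvGlue (t₀ + 2 * ε - s - energy ε (y - x₀))

lemma contDiff_coneWeight {ε : ℝ} (hε : 0 < ε) (t₀ : ℝ) (x₀ : E3) :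
    ContDiff ℝ 1 (fun p : ℝ × E3 => coneWeight ε t₀ x₀ p.1 p.2) :=
  (expNegInvGlue.contDiff (n := 1)).comp ((contDiff_const.sub contDiff_fst).sub
    ((contDiff_energy hε).comp (contDiff_snd.sub contDiff_const)))

lemma hasDerivAt_expNegInvGlue (r : ℝ) : HasDerivAt expNegInvGlue (deriv expNegInvGlue r) r :=
  ((expNegInvGlue.contDiff (n := 1)).differentiable one_ne_zero r).hasDerivAt

lemma hasDerivAt_coneWeight (ε t₀ : ℝ) (x₀ : E3) (s : ℝ) (y : E3) :
    HasDerivAt (fun σ => coneWeight ε t₀ x₀ σ y)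
      (-deriv expNegInvGlue (t₀ + 2 * ε - s - energy ε (y - x₀))) s := by
  have h1 : HasDerivAt (fun σ : ℝ => t₀ + 2 * ε - σ - energy ε (y - x₀)) (-1) s := by
    simpa using ((hasDerivAt_id s).const_sub (t₀ + 2 * ε)).sub_const (energy ε (y - x₀))
  have := (hasDerivAt_expNegInvGlue _).comp s h1
  simpa [coneWeight, Function.comp_def] using this

lemma partialDeriv_coneWeight {ε : ℝ} (hε : 0 < ε) (t₀ : ℝ) (x₀ : E3) (s : ℝ) (y : E3)
    (i : Fin 3) :
    partialDeriv i (coneWeight ε t₀ x₀ s) y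
      = -deriv expNegInvGlue (t₀ + 2 * ε - s - energy ε (y - x₀)) * velocity ε (y - x₀) i := by
  have h0 : HasFDerivAt (fun z : E3 => energy ε (z - x₀)) (energyDeriv ε (y - x₀)) y :=
    HasFDerivAt.comp (g := energy ε) (f := fun z => z - x₀) y (hasFDerivAt_energy hε (y - x₀))
      ((hasFDerivAt_id y).sub_const x₀)
  have h1 := h0.const_sub (t₀ + 2 * ε - s)
  have h2 := ((hasDerivAt_expNegInvGlue _).comp_hasFDerivAt y h1).fderiv
  rw [partialDeriv]
  change fderiv ℝ (expNegInvGlue ∘ fun z => t₀ + 2 * ε - s - energy ε (z - x₀)) y _ = _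
  rw [h2]
  simp [energyDeriv_apply, velocity, real_inner_comm, EuclideanSpace.inner_single_left]

lemma deriv_expNegInvGlue_nonneg (r : ℝ) : 0 ≤ deriv expNegInvGlue r :=
  expNegInvGlue.monotone.deriv_nonneg

/-- Uniqueness for the Maxwell equations outside the domain of influence of the data and sources. -/
theorem maxwell_finite_speed {k : ℝ} {E B j : ℝ → E3 → E3}
    (hE : ContDiffOn ℝ 1 (fun p : ℝ × E3 => E p.1 p.2) (Ici 0 ×ˢ univ))
    (hB : ContDiffOn ℝ 1 (fun p : ℝ × E3 => B p.1 p.2) (Ici 0 ×ˢ univ))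
    (ampere : ∀ t, 0 ≤ t → ∀ x, derivWithin (fun s => E s x) (Ici 0) t = curl (B t) x - j t x)
    (faraday : ∀ t, 0 ≤ t → ∀ x, derivWithin (fun s => B s x) (Ici 0) t = -curl (E t) x)
    (hj : ∀ t x, 0 ≤ t → t + k < ‖x‖ → j t x = 0)
    (hE0 : ∀ x, k < ‖x‖ → E 0 x = 0) (hB0 : ∀ x, k < ‖x‖ → B 0 x = 0)
    {t₀ : ℝ} (ht₀ : 0 ≤ t₀) {x₀ : E3} (hx₀ : t₀ + k < ‖x₀‖) : E t₀ x₀ = 0 ∧ B t₀ x₀ = 0 := by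
  -- With `2ε` equal to the distance from `x₀` to the ball of radius `t₀ + k`, the support of the
  -- weight stays in `|y| > s + k`, free of sources and data, while the weight is still positive at
  -- `(t₀, x₀)`.
  set ε : ℝ := (‖x₀‖ - t₀ - k) / 2 with hεdef
  have hε : 0 < ε := by rw [hεdef]; linarith
  set c := coneWeight ε t₀ x₀ with hc
  have hc1 := contDiff_coneWeight hε t₀ x₀
  have hfar : ∀ s y, c s y ≠ 0 → s + k < ‖y‖ := by
    intro s y hy
    have h1 : 0 < t₀ + 2 * ε - s - energy ε (y - x₀) := by
      by_contra hcon
      exact hy (expNegInvGlue.zero_of_nonpos (not_lt.mp hcon))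
    have h2 := norm_le_energy ε (y - x₀)
    have h3 := norm_le_norm_add_norm_sub y x₀
    rw [hεdef] at h1
    rw [hεdef] at h2
    linarith
  have hsupp : ∀ s y, 0 ≤ s → y ∉ Metric.closedBall x₀ (t₀ + 2 * ε) → c s y = 0 := by
    intro s y hs hy
    refine expNegInvGlue.zero_of_nonpos ?_
    rw [Metric.mem_closedBall, dist_eq_norm] at hy
    have h2 := norm_le_energy ε (y - x₀)
    linarith
  set H : ℝ → E3 → ℝ := fun s y => c s y * (‖E s y‖ ^ 2 + ‖B s y‖ ^ 2) with hHdef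
  set H' : ℝ → E3 → ℝ := fun s y =>
    fderiv ℝ (fun p : ℝ × E3 => H p.1 p.2) (s, y) (stBasis 0) with hH'def
  have hH : ContDiffOn ℝ 1 (fun p : ℝ × E3 => H p.1 p.2) (Ici 0 ×ˢ univ) :=
    hc1.contDiffOn.mul ((hE.norm_sq ℝ).add (hB.norm_sq ℝ))
  have hopen : IsOpen ((Ioi 0 : Set ℝ) ×ˢ (univ : Set E3)) := isOpen_Ioi.prod isOpen_univ
  have hsub : (Ioi 0 : Set ℝ) ×ˢ (univ : Set E3) ⊆ Ici 0 ×ˢ univ :=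
    prod_mono Ioi_subset_Ici_self le_rfl
  have hdiff : ∀ {W : Type} [NormedAddCommGroup W] [NormedSpace ℝ W] {G : ℝ × E3 → W},
      ContDiffOn ℝ 1 G (Ici 0 ×ˢ univ) → ∀ s y, 0 < s → DifferentiableAt ℝ G (s, y) := by
    intro W _ _ G hG s y hs
    have hmem : (s, y) ∈ (Ioi 0 : Set ℝ) ×ˢ (univ : Set E3) := ⟨hs, mem_univ _⟩
    exact ((hG.mono hsub).contDiffAt (hopen.mem_nhds hmem)).differentiableAt one_ne_zero
  have hHd : ∀ s y, 0 < s → HasDerivAt (fun σ => H σ y) (H' s y) s := fun s y hs =>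
    deriv_slice (hdiff hH s y hs)
  have hH'c : ContinuousOn (fun p : ℝ × E3 => H' p.1 p.2) (Ioi 0 ×ˢ univ) :=
    ((hH.mono hsub).continuousOn_fderiv_of_isOpen hopen le_rfl).clm_apply continuousOn_const
  have hH0 : ∀ s y, 0 < s → y ∉ Metric.closedBall x₀ (t₀ + 2 * ε) → H s y = 0 := by
    intro s y hs hy
    simp [hHdef, hsupp s y hs.le hy]
  have hH'0 : ∀ s y, 0 < s → y ∉ Metric.closedBall x₀ (t₀ + 2 * ε) → H' s y = 0 := by
    intro s y hs hy
    refine (hHd s y hs).unique ((hasDerivAt_const s (0 : ℝ)).congr_of_eventuallyEq ?_)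
    filter_upwards [Ioi_mem_nhds hs] with σ hσ
    exact hH0 σ y hσ hy
  have hslice : ∀ {G : ℝ → E3 → E3}, ContDiffOn ℝ 1 (fun p : ℝ × E3 => G p.1 p.2) (Ici 0 ×ˢ univ) →
      ∀ s, 0 ≤ s → ContDiff ℝ 1 (G s) := by
    intro G hG s hs
    have h1 : ContDiff ℝ 1 (fun y : E3 => (s, y)) := contDiff_const.prodMk contDiff_id
    rw [← contDiffOn_univ]
    exact hG.comp h1.contDiffOn fun y _ => ⟨hs, mem_univ _⟩
  have hcs : ∀ s, ContDiff ℝ 1 (c s) := fun s =>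
    hc1.comp (contDiff_const.prodMk contDiff_id)
  set P : ℝ → E3 → E3 := fun s y => c s y • cross (E s y) (B s y) with hPdef
  have hP1 : ∀ s, 0 ≤ s → ContDiff ℝ 1 (P s) := fun s hs =>
    (hcs s).smul ((crossCLM.contDiff.comp (hslice hE s hs)).clm_apply (hslice hB s hs))
  have hP2 : ∀ s, 0 ≤ s → HasCompactSupport (P s) := fun s hs =>
    HasCompactSupport.intro (isCompact_closedBall x₀ (t₀ + 2 * ε)) fun y hy => by
      simp [hPdef, hsupp s y hs hy]
  -- The local energy inequality: the weight decreases in time at rate `d`, while its spatial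
  -- gradient has size at most `d`, so the energy lost dominates the Poynting flux `2 |E × B| ≤ |E|²
  -- + |B|²`. The source term vanishes on the support of the weight.
  have hineq : ∀ s y, 0 < s → H' s y + 2 * divergence (P s) y ≤ 0 := by
    intro s y hs
    have dE := (hslice hE s hs.le).differentiable one_ne_zero y
    have dB := (hslice hB s hs.le).differentiable one_ne_zero y
    have tE : HasDerivAt (fun σ => E σ y) (curl (B s) y - j s y) s := by
      have := deriv_slice (hdiff hE s y hs)
      rw [← ampere s hs.le y, derivWithin_Ici_of_hasDerivAt hs.le this]
      exact this
    have tB : HasDerivAt (fun σ => B σ y) (-curl (E s) y) s := by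
      have := deriv_slice (hdiff hB s y hs)
      rw [← faraday s hs.le y, derivWithin_Ici_of_hasDerivAt hs.le this]
      exact this
    set d := deriv expNegInvGlue (t₀ + 2 * ε - s - energy ε (y - x₀)) with hd
    have hd0 : 0 ≤ d := deriv_expNegInvGlue_nonneg _
    have tH : HasDerivAt (fun σ => H σ y) _ s :=
      (hasDerivAt_coneWeight ε t₀ x₀ s y).mul (tE.norm_sq.add tB.norm_sq)
    have e1 := (hHd s y hs).unique tH
    have e2 : divergence (P s) y = _ :=
      divergence_smul_cross ((hcs s).differentiable one_ne_zero y) dE dB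
    rw [hc, partialDeriv_coneWeight hε, partialDeriv_coneWeight hε, partialDeriv_coneWeight hε,
      ← hc, ← hd] at e2
    have e3 : c s y * inner ℝ (E s y) (j s y) = 0 := by
      by_cases h0 : c s y = 0
      · rw [h0, zero_mul]
      · rw [hj s y hs.le (hfar s y h0), inner_zero_right, mul_zero]
    have e4 : -(‖E s y‖ * ‖B s y‖) ≤ inner ℝ (velocity ε (y - x₀)) (cross (E s y) (B s y)) := by
      have a1 := (abs_le.mp (abs_real_inner_le_norm (velocity ε (y - x₀))
        (cross (E s y) (B s y)))).1
      have a2 := norm_cross_le (E s y) (B s y)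
      have a3 := (norm_velocity_lt hε (y - x₀)).le
      nlinarith [norm_nonneg (cross (E s y) (B s y)), norm_nonneg (velocity ε (y - x₀))]
    have e5 : H' s y + 2 * divergence (P s) y = -(d * (‖E s y‖ ^ 2 + ‖B s y‖ ^ 2
        + 2 * inner ℝ (velocity ε (y - x₀)) (cross (E s y) (B s y)))) := by
      rw [e1, e2]
      simp only [← hd, ← hc, inner_sub_right, inner_neg_right]
      rw [inner_E3 (velocity ε (y - x₀))]
      linear_combination -2 * e3
    rw [e5]
    have : 0 ≤ ‖E s y‖ ^ 2 + ‖B s y‖ ^ 2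
        + 2 * inner ℝ (velocity ε (y - x₀)) (cross (E s y) (B s y)) := by
      nlinarith [sq_nonneg (‖E s y‖ - ‖B s y‖)]
    have := mul_nonneg hd0 this
    linarith
  have hanti : AntitoneOn (fun s => ∫ y, H s y) (Icc 0 t₀) := by
    have hder : ∀ s, 0 < s → Integrable (H' s) ∧
        HasDerivAt (fun σ => ∫ y, H σ y) (∫ y, H' s y) s := fun s hs =>
      hasDerivAt_integral_of_compact_support (isCompact_closedBall x₀ (t₀ + 2 * ε))
        (hH.continuousOn.mono hsub) hH'c hH0 hH'0 hHd hs
    refine antitoneOn_of_deriv_nonpos (convex_Icc 0 t₀) ?_ ?_ ?_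
    · refine continuousOn_integral_of_compact_support (isCompact_closedBall x₀ (t₀ + 2 * ε))
        (hH.continuousOn.mono (prod_mono (fun s hs => hs.1) le_rfl)) ?_
      intro s y hs hy
      simp [hHdef, hsupp s y hs.1 hy]
    · rw [interior_Icc]
      exact fun s hs => (hder s hs.1).2.differentiableAt.differentiableWithinAt
    · rw [interior_Icc]
      intro s hs
      rw [(hder s hs.1).2.deriv]
      have h1 : ∫ y, (H' s y + 2 * divergence (P s) y) ≤ 0 :=
        integral_nonpos fun y => hineq s y hs.1
      rw [integral_add (hder s hs.1).1
        ((integrable_divergence (hP1 s hs.1.le) (hP2 s hs.1.le)).const_mul 2),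
        integral_const_mul, integral_divergence_eq_zero (hP1 s hs.1.le) (hP2 s hs.1.le)] at h1
      linarith
  have hHnn : ∀ s y, 0 ≤ H s y := fun s y =>
    mul_nonneg (expNegInvGlue.nonneg _) (by positivity)
  have hzero : ∫ y, H 0 y = 0 := by
    refine integral_eq_zero_of_ae (Filter.Eventually.of_forall fun y => ?_)
    by_cases h0 : c 0 y = 0
    · simp [hHdef, h0]
    · have := hfar 0 y h0
      rw [zero_add] at this
      simp [hHdef, hE0 y this, hB0 y this]
  have hle := hanti ⟨le_rfl, ht₀⟩ ⟨ht₀, le_rfl⟩ ht₀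
  simp only [hzero] at hle
  have hcont : Continuous (H t₀) :=
    (hcs t₀).continuous.mul (((hslice hE t₀ ht₀).continuous.norm.pow 2).add
      ((hslice hB t₀ ht₀).continuous.norm.pow 2))
  have hHx : H t₀ x₀ = 0 := by
    by_contra hne
    have := hcont.integral_pos_of_hasCompactSupport_nonneg_nonzero (μ := volume)
      (HasCompactSupport.intro (isCompact_closedBall x₀ (t₀ + 2 * ε)) fun y hy => by
        simp [hHdef, hsupp t₀ y ht₀ hy]) (hHnn t₀) hne
    linarith
  -- At the vertex the regularised distance equals `ε`, so the argument of the weight is `2ε - ε = ε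
  -- > 0`.
  have hcpos : 0 < c t₀ x₀ := by
    refine expNegInvGlue.pos_of_pos ?_
    rw [sub_self]
    simp [energy, Real.sqrt_sq hε.le]
    linarith
  have hsum : ‖E t₀ x₀‖ ^ 2 + ‖B t₀ x₀‖ ^ 2 = 0 :=
    (mul_eq_zero.mp hHx).resolve_left hcpos.ne'
  constructor
  · rw [← norm_eq_zero]; nlinarith [sq_nonneg ‖E t₀ x₀‖, sq_nonneg ‖B t₀ x₀‖]
  · rw [← norm_eq_zero]; nlinarith [sq_nonneg ‖E t₀ x₀‖, sq_nonneg ‖B t₀ x₀‖]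

section

variable {N : ℕ} {m e : Fin N → ℝ} {k : ℝ} {f : Fin N → ℝ → E3 → E3 → ℝ} {E B : ℝ → E3 → E3}

theorem StandingHypothesis.fields_eq_zero (h : StandingHypothesis m e k f E B)
    (hm : ∀ α, 0 < m α) {t : ℝ} (ht : 0 ≤ t) {x : E3} (hx : t + k < ‖x‖) :
    E t x = 0 ∧ B t x = 0 := by
  refine maxwell_finite_speed (j := fun t x => (4 * Real.pi) • currentDensity m e f t x)
    h.solution.contDiff_E h.solution.contDiff_B h.solution.ampere h.solution.faraday ?_ ?_ ?_ ht hx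
  · intro s y hs hy
    simp [currentDensity, h.f_eq_zero hm _ hs hy]
  · intro y hy
    by_contra h0
    exact absurd (h.init_E_support y h0) (not_le.mpr hy)
  · intro y hy
    by_contra h0
    exact absurd (h.init_B_support y h0) (not_le.mpr hy)

end

/-! ## Extension by zero to negative times -/

section

variable {N : ℕ} {m e : Fin N → ℝ} {k : ℝ} {f : Fin N → ℝ → E3 → E3 → ℝ} {E B : ℝ → E3 → E3}

/-- Densities have compact momentum support. -/
lemma StandingHypothesis.exists_momentum_bound (h : StandingHypothesis m e k f E B)
    (hm : ∀ α, 0 < m α) (α : Fin N) {t : ℝ} (ht : 0 ≤ t) (x : E3) :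
    ∃ R, ∀ v, f α t x v ≠ 0 → ‖v‖ ≤ R := by
  obtain ⟨CE, hCE0, hCE⟩ := exists_slab_bound h.solution.contDiff_E.continuousOn t x t
  obtain ⟨CB, hCB0, hCB⟩ := exists_slab_bound h.solution.contDiff_B.continuousOn t x t
  refine ⟨k + |e α| * (CE + CB) * t, fun v hv => ?_⟩
  obtain ⟨X, V, hc, hX, rfl, hf⟩ := h.exists_characteristic hm α ht x v
  rw [hf] at hv
  have h1 := (h.init_f_support α _ _ hv).2
  have hball : ∀ s ∈ Icc 0 t, X s ∈ Metric.closedBall x t := by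
    intro s hs
    have := hc.norm_pos_sub_le (hm α) hs.1 hs.2 le_rfl
    rw [hX] at this
    rw [Metric.mem_closedBall, dist_comm, dist_eq_norm]
    linarith [hs.1]
  -- Up to time `t` the trajectory stays in a fixed compact ball, so the force is bounded there. The
  -- bound grows with `t` but is enough for local regularity.
  have h2 := norm_sub_le_of_deriv_bound (b := fun s => |e α| * (CE + CB) * s)
    (b' := fun _ => |e α| * (CE + CB)) le_rfl hc.mom
    (fun s _ => by simpa using (hasDerivAt_id s).const_mul (|e α| * (CE + CB)))
    (fun s hs => (norm_lorentzForce_le (hm α) (e α) E B s (X s) (V s)).trans (by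
      have := hCE s hs _ (hball s hs); have := hCB s hs _ (hball s hs); gcongr)) t ⟨ht, le_rfl⟩
  have h3 := norm_le_norm_add_norm_sub' (V t) (V 0)
  simp only [mul_zero, sub_zero] at h2
  linarith

/-- The region of spacetime in which the solution, extended by zero, is regular. -/
def extendedRegion (k : ℝ) : Set (ℝ × E3) := {p | 0 < p.1 ∨ |p.1| + k < ‖p.2‖}

lemma StandingHypothesis.contDiffAt_f (h : StandingHypothesis m e k f E B) (α : Fin N) {t : ℝ}
    (ht : 0 < t) (x v : E3) :
    ContDiffAt ℝ 1 (fun q : ℝ × E3 × E3 => f α q.1 q.2.1 q.2.2) (t, x, v) := by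
  refine (h.solution.contDiff_f α).contDiffAt ?_
  exact prod_mem_nhds (Ici_mem_nhds ht) Filter.univ_mem

lemma StandingHypothesis.contDiffAt_E (h : StandingHypothesis m e k f E B) {t : ℝ}
    (ht : 0 < t) (x : E3) : ContDiffAt ℝ 1 (fun q : ℝ × E3 => E q.1 q.2) (t, x) :=
  h.solution.contDiff_E.contDiffAt (prod_mem_nhds (Ici_mem_nhds ht) Filter.univ_mem)

lemma StandingHypothesis.contDiffAt_B (h : StandingHypothesis m e k f E B) {t : ℝ}
    (ht : 0 < t) (x : E3) : ContDiffAt ℝ 1 (fun q : ℝ × E3 => B q.1 q.2) (t, x) :=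
  h.solution.contDiff_B.contDiffAt (prod_mem_nhds (Ici_mem_nhds ht) Filter.univ_mem)

lemma StandingHypothesis.regularSolution_pos (h : StandingHypothesis m e k f E B)
    (hm : ∀ α, 0 < m α) : RegularSolution m e {p : ℝ × E3 | 0 < p.1} f E B := by
  constructor
  · exact fun α p hp v => h.contDiffAt_f α hp p.2 v
  · exact fun p hp => h.contDiffAt_E hp p.2
  · exact fun p hp => h.contDiffAt_B hp p.2
  · exact fun α p hp => h.exists_momentum_bound hm α (le_of_lt hp) p.2
  · intro α p hp v
    rw [vlasov_operator_eq (hm α) (e α) (E p.1 p.2) (B p.1 p.2) (le_of_lt hp)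
      ((h.contDiffAt_f α hp p.2 v).differentiableAt one_ne_zero),
      h.solution.vlasov α p.1 (le_of_lt hp) p.2 v, mul_zero]
  · rintro ⟨t, x⟩ hp
    have ht : 0 ≤ t := le_of_lt hp
    have dE := (h.contDiffAt_E hp x).differentiableAt one_ne_zero
    have dB := (h.contDiffAt_B hp x).differentiableAt one_ne_zero
    rw [maxwellRelations_iff]
    refine ⟨?_, ?_, ?_, ?_⟩
    · rw [← curl_slice dB, ← h.solution.ampere t ht x,
        derivWithin_Ici_of_hasDerivAt ht (deriv_slice dE)]
    · rw [← divergence_slice dE, h.solution.gauss t ht x]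
    · rw [← curl_slice dE, ← h.solution.faraday t ht x,
        derivWithin_Ici_of_hasDerivAt ht (deriv_slice dB)]
    · rw [← divergence_slice dB, h.solution.gauss_magnetic t ht x]

lemma extendZero_of_nonneg {V : Type*} [Zero V] (g : ℝ → V) {t : ℝ} (ht : 0 ≤ t) :
    extendZero g t = g t := if_pos ht

lemma extendZero_of_neg {V : Type*} [Zero V] (g : ℝ → V) {t : ℝ} (ht : t < 0) :
    extendZero g t = 0 := if_neg (not_le.mpr ht)

/-- A regular solution may be modified away from the region under consideration. -/
lemma RegularSolution.congr {U : Set (ℝ × E3)} {f' : Fin N → ℝ → E3 → E3 → ℝ}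
    {E' B' : ℝ → E3 → E3} (h : RegularSolution m e U f E B)
    (hU : ∀ p ∈ U, ∀ᶠ q in nhds p, (∀ α, f' α q.1 q.2 = f α q.1 q.2) ∧ E' q.1 q.2 = E q.1 q.2 ∧
      B' q.1 q.2 = B q.1 q.2) : RegularSolution m e U f' E' B' := by
  have hf : ∀ α, ∀ p ∈ U, ∀ v, (fun q : ℝ × E3 × E3 => f' α q.1 q.2.1 q.2.2)
      =ᶠ[nhds (p.1, p.2, v)] fun q => f α q.1 q.2.1 q.2.2 := by
    intro α p hp v
    have h1 : Filter.Tendsto (fun q : ℝ × E3 × E3 => (q.1, q.2.1)) (nhds (p.1, p.2, v))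
        (nhds p) := by
      have : Continuous (fun q : ℝ × E3 × E3 => (q.1, q.2.1)) := by fun_prop
      exact this.continuousAt
    filter_upwards [h1.eventually (hU p hp)] with q hq
    exact congrFun (hq.1 α) q.2.2
  have hE : ∀ p ∈ U, (fun q : ℝ × E3 => E' q.1 q.2) =ᶠ[nhds p] fun q => E q.1 q.2 := by
    intro p hp
    filter_upwards [hU p hp] with q hq
    exact hq.2.1
  have hB : ∀ p ∈ U, (fun q : ℝ × E3 => B' q.1 q.2) =ᶠ[nhds p] fun q => B q.1 q.2 := by
    intro p hp
    filter_upwards [hU p hp] with q hq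
    exact hq.2.2
  have hf0 : ∀ p ∈ U, ∀ α, f' α p.1 p.2 = f α p.1 p.2 := fun p hp => (hU p hp).self_of_nhds.1
  constructor
  · exact fun α p hp v => (h.contDiffAt_f α p hp v).congr_of_eventuallyEq (hf α p hp v)
  · exact fun p hp => (h.contDiffAt_E p hp).congr_of_eventuallyEq (hE p hp)
  · exact fun p hp => (h.contDiffAt_B p hp).congr_of_eventuallyEq (hB p hp)
  · intro α p hp
    rw [hf0 p hp]; exact h.support_f α p hp
  · intro α p hp v
    rw [(hf α p hp v).fderiv_eq, (hU p hp).self_of_nhds.2.1, (hU p hp).self_of_nhds.2.2]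
    exact h.vlasov α p hp v
  · intro p hp
    rw [(hE p hp).fderiv_eq, (hB p hp).fderiv_eq]
    simp only [chargeDensity, currentDensity, hf0 p hp]
    exact h.maxwell p hp

lemma regularSolution_zero (U : Set (ℝ × E3)) :
    RegularSolution m e U (fun _ _ _ _ => 0) (fun _ _ => 0) (fun _ _ => 0) := by
  constructor
  · exact fun _ _ _ _ => contDiffAt_const
  · exact fun _ _ => contDiffAt_const
  · exact fun _ _ => contDiffAt_const
  · exact fun α p hp => ⟨0, fun v hv => absurd rfl hv⟩
  · intro α p hp v; simp
  · intro p hp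
    rw [maxwellRelations_iff]
    refine ⟨?_, ?_, ?_, ?_⟩
    · apply E3_ext <;> simp [currentDensity]
    · simp [chargeDensity]
    · apply E3_ext <;> simp
    · simp

lemma RegularSolution.union {U U' : Set (ℝ × E3)} (h : RegularSolution m e U f E B)
    (h' : RegularSolution m e U' f E B) : RegularSolution m e (U ∪ U') f E B where
  contDiffAt_f α p hp := hp.elim (h.contDiffAt_f α p) (h'.contDiffAt_f α p)
  contDiffAt_E p hp := hp.elim (h.contDiffAt_E p) (h'.contDiffAt_E p)
  contDiffAt_B p hp := hp.elim (h.contDiffAt_B p) (h'.contDiffAt_B p)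
  support_f α p hp := hp.elim (h.support_f α p) (h'.support_f α p)
  vlasov α p hp := hp.elim (h.vlasov α p) (h'.vlasov α p)
  maxwell p hp := hp.elim (h.maxwell p) (h'.maxwell p)

/-- The extension by zero vanishes outside the future light cone over the support of the data. -/
lemma StandingHypothesis.extendZero_eq_zero (h : StandingHypothesis m e k f E B)
    (hm : ∀ α, 0 < m α) {t : ℝ} {x : E3} (hx : t + k < ‖x‖) :
    (∀ α, extendZero (f α) t x = 0) ∧ extendZero E t x = 0 ∧ extendZero B t x = 0 := by
  rcases le_or_gt 0 t with ht | ht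
  · simp only [extendZero_of_nonneg _ ht]
    exact ⟨fun α => funext fun v => h.f_eq_zero hm α ht hx v, h.fields_eq_zero hm ht hx⟩
  · simp [extendZero_of_neg _ ht]

theorem StandingHypothesis.regularSolution (h : StandingHypothesis m e k f E B)
    (hm : ∀ α, 0 < m α) :
    RegularSolution m e (extendedRegion k) (fun α => extendZero (f α)) (extendZero E)
      (extendZero B) := by
  have h1 : RegularSolution m e {p : ℝ × E3 | 0 < p.1} (fun α => extendZero (f α)) (extendZero E)
      (extendZero B) := by
    refine (h.regularSolution_pos hm).congr fun p hp => ?_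
    have : ∀ᶠ q : ℝ × E3 in nhds p, 0 < q.1 := (isOpen_lt continuous_const continuous_fst).mem_nhds hp
    filter_upwards [this] with q hq
    simp [extendZero_of_nonneg _ hq.le]
  have h2 : RegularSolution m e {p : ℝ × E3 | |p.1| + k < ‖p.2‖} (fun α => extendZero (f α))
      (extendZero E) (extendZero B) := by
    refine (regularSolution_zero _).congr fun p hp => ?_
    have : ∀ᶠ q : ℝ × E3 in nhds p, |q.1| + k < ‖q.2‖ :=
      (isOpen_lt (by fun_prop) (by fun_prop)).mem_nhds hp
    filter_upwards [this] with q hq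
    exact h.extendZero_eq_zero hm (lt_of_le_of_lt (by linarith [le_abs_self q.1]) hq)
  exact h1.union h2

end

/-- Late times are mapped into the region where the extended solution is regular. -/
lemma lorentz_mem_extendedRegion {A : Matrix (Fin 4) (Fin 4) ℝ} (hA : A ∈ restrictedLorentz)
    {k T : ℝ} (hT : boost A * k < T) {t : ℝ} (ht : T ≤ t) (x : E3) :
    0 < timePart A t x ∨ |timePart A t x| + k < ‖spacePart A t x‖ := by
  rcases lt_or_ge 0 (timePart A t x) with h | h
  · exact Or.inl h
  · right
    -- Write `(τ, y)` for the image and `β` for the boost. If `τ ≤ 0` and `|y| ≤ -τ + k`, inverting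
    -- gives `t ≤ A₀₀ τ + β |y| ≤ (A₀₀ - β) τ + β k ≤ β k`, contradicting the choice of `T`.
    have h1 := (abs_le.mp (abs_timePart_inv_sub_le hA (timePart A t x) (spacePart A t x))).2
    rw [timePart_inv_apply hA] at h1
    rw [abs_of_nonpos h]
    by_contra hcon
    have hb := boost_nonneg A
    have hb2 := boost_lt hA
    nlinarith [mul_le_mul_of_nonneg_left (not_lt.mp hcon) hb]

/-! ## Uniform bounds along characteristics -/

lemma hasDerivAt_shift_rpow {a p s : ℝ} (h : 0 < s + a) :
    HasDerivAt (fun s => (s + a) ^ p) (p * (s + a) ^ (p - 1)) s := by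
  simpa using ((hasDerivAt_id s).add_const a).rpow_const (p := p) (Or.inl h.ne')

/-- The squared speed is `1 - m² / (m² + |v|²)`, hence at most `1 - 2d ≤ (1 - d)²` with `d` the
deficit in the statement. A momentum bound thus gives a quantitative distance from the speed of
light. -/
lemma norm_velocity_le {m P : ℝ} (hm : 0 < m) {v : E3} (hv : ‖v‖ ≤ P) :
    ‖velocity m v‖ ≤ 1 - m ^ 2 / (2 * (m ^ 2 + P ^ 2)) := by
  have hP : 0 ≤ P := (norm_nonneg v).trans hv
  have hE := energy_pos hm v
  have hm2 : 0 < m ^ 2 := by positivity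
  have hw : ‖velocity m v‖ * energy m v = ‖v‖ := by
    rw [velocity, norm_smul, norm_inv, Real.norm_eq_abs, abs_of_pos hE]
    field_simp
  have h1 : ‖velocity m v‖ ^ 2 * (m ^ 2 + ‖v‖ ^ 2) = ‖v‖ ^ 2 := by
    rw [← energy_sq, ← mul_pow, hw]
  have hs : ‖v‖ ^ 2 ≤ P ^ 2 := by gcongr
  set d := m ^ 2 / (2 * (m ^ 2 + P ^ 2)) with hd
  have hd1 : d * (2 * (m ^ 2 + P ^ 2)) = m ^ 2 := by rw [hd]; field_simp
  have hd0 : 0 < d := by rw [hd]; positivity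
  have hd2 : d ≤ 1 / 2 := by
    by_contra hcon
    push Not at hcon
    nlinarith [sq_nonneg P]
  have h2 : ‖velocity m v‖ ^ 2 ≤ (1 - d) ^ 2 := by
    have hq : ‖velocity m v‖ ^ 2 ≤ 1 - 2 * d := by
      by_contra hcon
      push Not at hcon
      have := mul_lt_mul_of_pos_right hcon (show 0 < m ^ 2 + ‖v‖ ^ 2 by positivity)
      rw [h1] at this
      nlinarith
    nlinarith [sq_nonneg d]
  exact le_of_sq_le_sq h2 (by linarith)

section

variable {N : ℕ} {m e : Fin N → ℝ} {k : ℝ} {f : Fin N → ℝ → E3 → E3 → ℝ} {E B : ℝ → E3 → E3}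

/-- The gradient estimate at the origin forces `k ≥ 1/2`. -/
lemma StandingHypothesis.one_le_two_mul (h : StandingHypothesis m e k f E B) : 1 ≤ 2 * k := by
  have hk := h.k_pos
  obtain ⟨C, hC, hdec⟩ := h.decay
  have h1 := (Real.sqrt_nonneg _).trans (hdec 0 0 le_rfl (by simpa using hk.le)).2
  simp only [norm_zero, zero_add, sub_zero] at h1
  by_contra hcon
  have h2 : Real.log (2 * k) < 0 := Real.log_neg (by linarith) (not_le.mp hcon)
  have h3 : C * Real.log (2 * k) / (2 * k * (2 * k) ^ 2) < 0 :=
    div_neg_of_neg_of_pos (by nlinarith) (by positivity)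
  linarith

lemma norm_le_sqrt_add_left (a b : E3) : ‖a‖ ≤ Real.sqrt (‖a‖ ^ 2 + ‖b‖ ^ 2) :=
  Real.le_sqrt_of_sq_le (by nlinarith [sq_nonneg ‖b‖])

lemma norm_le_sqrt_add_right (a b : E3) : ‖b‖ ≤ Real.sqrt (‖a‖ ^ 2 + ‖b‖ ^ 2) :=
  Real.le_sqrt_of_sq_le (by nlinarith [sq_nonneg ‖a‖])

lemma StandingHypothesis.exists_force_bound (h : StandingHypothesis m e k f E B)
    (hm : ∀ α, 0 < m α) (α : Fin N) :
    ∃ C, 0 < C ∧ ∀ t x v, 0 ≤ t → ‖x‖ ≤ t + k →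
      ‖lorentzForce (m α) (e α) E B t x v‖ ≤ C / ((t + 2 * k) * (t - ‖x‖ + 2 * k)) := by
  have hk := h.k_pos
  obtain ⟨C, hC, hdec⟩ := h.decay
  refine ⟨(|e α| + 1) * (2 * C), by positivity, fun t x v ht hx => ?_⟩
  have h1 := (hdec t x ht hx).1
  have hE := (norm_le_sqrt_add_left (E t x) (B t x)).trans h1
  have hB := (norm_le_sqrt_add_right (E t x) (B t x)).trans h1
  have hx0 := norm_nonneg x
  have hpos : 0 < t - ‖x‖ + 2 * k := by linarith
  have h2 : C / ((t + ‖x‖ + 2 * k) * (t - ‖x‖ + 2 * k))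
      ≤ C / ((t + 2 * k) * (t - ‖x‖ + 2 * k)) := by
    gcongr
    linarith
  refine (norm_lorentzForce_le (hm α) (e α) E B t x v).trans ?_
  calc |e α| * (‖E t x‖ + ‖B t x‖)
      ≤ (|e α| + 1) * (C / ((t + 2 * k) * (t - ‖x‖ + 2 * k))
          + C / ((t + 2 * k) * (t - ‖x‖ + 2 * k))) := by
        gcongr
        · linarith
        · exact hE.trans h2
        · exact hB.trans h2
    _ = _ := by ring

lemma IsCharacteristic.norm_pos_le {m e : ℝ} {t r : ℝ} {X V : ℝ → E3}
    (hc : IsCharacteristic m e E B t X V) {s b : ℝ} (hs : s ∈ Icc 0 t) (h0 : ‖X 0‖ ≤ r)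
    (hb : ∀ σ ∈ Icc 0 s, ‖velocity m (V σ)‖ ≤ b) : ‖X s‖ ≤ r + b * s := by
  have h1 := norm_sub_le_of_deriv_bound (F := X) (S := Icc 0 t) (b := fun σ => b * σ)
    (b' := fun _ => b) (Icc_subset_Icc_right hs.2) (fun σ hσ => hc.pos σ ⟨hσ.1, hσ.2.trans hs.2⟩)
    (fun σ _ => by simpa using (hasDerivAt_id σ).const_mul b) hb s ⟨hs.1, le_rfl⟩
  have h2 := norm_le_norm_add_norm_sub' (X s) (X 0)
  simp only [mul_zero, sub_zero] at h1
  linarith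

lemma IsCharacteristic.norm_mom_le {m e : ℝ} {t r : ℝ} {X V : ℝ → E3}
    (hc : IsCharacteristic m e E B t X V) {b b' : ℝ → ℝ} (h0 : ‖V 0‖ ≤ r)
    (hb : ∀ s ∈ Icc 0 t, HasDerivAt b (b' s) s)
    (h : ∀ s ∈ Icc 0 t, ‖lorentzForce m e E B s (X s) (V s)‖ ≤ b' s) :
    ∀ s ∈ Icc 0 t, ‖V s‖ ≤ r + (b s - b 0) := by
  intro s hs
  have h1 := norm_sub_le_of_deriv_bound le_rfl hc.mom hb h s hs
  have h2 := norm_le_norm_add_norm_sub' (V s) (V 0)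
  linarith

/-- Along characteristics issuing from the support of the data momenta stay bounded, and positions
stay away from the light cone. -/
theorem StandingHypothesis.exists_trajectory_bound (h : StandingHypothesis m e k f E B)
    (hm : ∀ α, 0 < m α) (α : Fin N) :
    ∃ P κ, 0 < P ∧ 0 < κ ∧ κ ≤ 1 / 2 ∧ ∀ t X V, IsCharacteristic (m α) (e α) E B t X V →
      ‖X 0‖ ≤ k → ‖V 0‖ ≤ k → ∀ s ∈ Icc 0 t, ‖V s‖ ≤ P ∧ ‖X s‖ ≤ k + (1 - κ) * s := by
  have hk := h.k_pos
  have hk1 := h.one_le_two_mul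
  obtain ⟨C, hC, hforce⟩ := h.exists_force_bound hm α
  have hmα := hm α
  set Q := k + 4 * (C / k) with hQ
  have hQ0 : 0 < Q := by positivity
  set c := m α ^ 2 / (2 * (m α ^ 2 + Q ^ 2)) with hc
  have hc0 : 0 < c := by positivity
  have hc1 : c ≤ 1 / 2 := by
    rw [hc, div_le_div_iff₀ (by positivity) (by norm_num)]
    nlinarith [sq_nonneg Q]
  set P := k + 2 * (C / c) with hP
  have hP0 : 0 < P := by positivity
  refine ⟨P, m α ^ 2 / (2 * (m α ^ 2 + P ^ 2)), hP0, by positivity, ?_, ?_⟩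
  · rw [div_le_div_iff₀ (by positivity) (by norm_num)]
    nlinarith [sq_nonneg P]
  intro t X V hchar hX0 hV0
  have hXle : ∀ s ∈ Icc 0 t, ‖X s‖ ≤ s + k := by
    intro s hs
    have := hchar.norm_pos_le hs hX0 fun σ _ => (norm_velocity_lt hmα (V σ)).le
    linarith
  -- First round of the bootstrap: on the support only `s - |X| + 2k ≥ k` is known, so the force is
  -- `O(1/s)`. The exponent `1/4` replaces the logarithm; any exponent below `1/2` would leave room
  -- for the last round.
  have hV1 : ∀ s ∈ Icc 0 t, ‖V s‖ ≤ Q * (s + 2 * k) ^ (1 / 4 : ℝ) := by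
    intro s hs
    have h1 := hchar.norm_mom_le (b := fun s => C / k * (4 * (s + 2 * k) ^ (1 / 4 : ℝ)))
      (b' := fun s => C / k * (4 * ((1 / 4 : ℝ) * (s + 2 * k) ^ ((1 / 4 : ℝ) - 1)))) hV0
      (fun s hs => ((hasDerivAt_shift_rpow (by linarith [hs.1])).const_mul 4).const_mul _)
      (fun s hs => ?_) s hs
    · have h2 : 1 ≤ (s + 2 * k) ^ (1 / 4 : ℝ) :=
        Real.one_le_rpow (by linarith [hs.1]) (by norm_num)
      have h3 : 0 ≤ C / k * (4 * (0 + 2 * k) ^ (1 / 4 : ℝ)) := by positivity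
      rw [hQ]
      nlinarith
    · refine (hforce s _ _ hs.1 (hXle s hs)).trans ?_
      have hs1 : 1 ≤ s + 2 * k := by linarith [hs.1]
      have h4 : (s + 2 * k) ^ (-1 : ℝ) ≤ (s + 2 * k) ^ ((1 / 4 : ℝ) - 1) :=
        Real.rpow_le_rpow_of_exponent_le hs1 (by norm_num)
      rw [Real.rpow_neg_one] at h4
      have h5 : C / ((s + 2 * k) * (s - ‖X s‖ + 2 * k)) ≤ C / ((s + 2 * k) * k) := by
        gcongr
        linarith [hXle s hs]
      refine h5.trans ?_
      calc C / ((s + 2 * k) * k) = C / k * (s + 2 * k)⁻¹ := by field_simp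
        _ ≤ C / k * (s + 2 * k) ^ ((1 / 4 : ℝ) - 1) := by gcongr
        _ = _ := by ring
  -- Second round: momenta of size `s^(1/4)` give a speed deficit of order `s^(-1/2)`, hence a
  -- distance of order `s^(1/2)` from the light cone.
  have hu : ∀ s ∈ Icc 0 t, c * (s + 2 * k) ^ (1 / 2 : ℝ) ≤ s - ‖X s‖ + 2 * k := by
    intro s hs
    have hs1 : 1 ≤ s + 2 * k := by linarith [hs.1]
    have hr : 1 ≤ (s + 2 * k) ^ (1 / 2 : ℝ) := Real.one_le_rpow hs1 (by norm_num)
    have hrr : (s + 2 * k) ^ (1 / 2 : ℝ) * (s + 2 * k) ^ (1 / 2 : ℝ) = s + 2 * k := by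
      rw [← Real.rpow_add (by linarith)]; norm_num
    have hqq : ((s + 2 * k) ^ (1 / 4 : ℝ)) ^ 2 = (s + 2 * k) ^ (1 / 2 : ℝ) := by
      rw [← Real.rpow_natCast, ← Real.rpow_mul (by linarith)]; norm_num
    set r := (s + 2 * k) ^ (1 / 2 : ℝ) with hrdef
    have hv : ∀ σ ∈ Icc 0 s, ‖velocity (m α) (V σ)‖ ≤ 1 - c / r := by
      intro σ hσ
      have hle : ‖V σ‖ ≤ Q * (s + 2 * k) ^ (1 / 4 : ℝ) := by
        refine (hV1 σ ⟨hσ.1, hσ.2.trans hs.2⟩).trans ?_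
        have : σ + 2 * k ≤ s + 2 * k := by linarith [hσ.2]
        have : 0 ≤ σ + 2 * k := by linarith [hσ.1]
        gcongr
      refine (norm_velocity_le hmα hle).trans ?_
      rw [mul_pow, hqq]
      have : c / r ≤ m α ^ 2 / (2 * (m α ^ 2 + Q ^ 2 * r)) := by
        rw [hc, div_div]
        refine div_le_div_of_nonneg_left (by positivity) (by positivity) ?_
        nlinarith [mul_le_mul_of_nonneg_left hr (sq_nonneg (m α))]
      linarith
    have hX := hchar.norm_pos_le hs hX0 hv
    have h1 : c * r = c / r * (s + 2 * k) := by
      rw [← hrr]; field_simp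
    -- This lets the spare `k` absorb `(c / r) * 2 * k`.
    have h2 : c / r ≤ 1 / 2 := (div_le_self hc0.le hr).trans hc1
    rw [h1]
    nlinarith [hs.1]
  -- Third round: the force is now `O(s^(-3/2))`, which is integrable, so momenta stay bounded.
  -- Bounded momenta then give a constant speed deficit.
  have hV2 : ∀ s ∈ Icc 0 t, ‖V s‖ ≤ P := by
    intro s hs
    have h1 := hchar.norm_mom_le (b := fun s => C / c * (-2 * (s + 2 * k) ^ (-1 / 2 : ℝ)))
      (b' := fun s => C / c * (-2 * ((-1 / 2 : ℝ) * (s + 2 * k) ^ ((-1 / 2 : ℝ) - 1)))) hV0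
      (fun s hs => ((hasDerivAt_shift_rpow (by linarith [hs.1])).const_mul (-2)).const_mul _)
      (fun s hs => ?_) s hs
    · have h2 : (0 + 2 * k) ^ (-1 / 2 : ℝ) ≤ 1 :=
        Real.rpow_le_one_of_one_le_of_nonpos (by linarith) (by norm_num)
      have h3 : 0 ≤ C / c * (2 * (s + 2 * k) ^ (-1 / 2 : ℝ)) := by
        have := hs.1
        positivity
      have h4 : C / c * (0 + 2 * k) ^ (-1 / 2 : ℝ) ≤ C / c * 1 := by gcongr
      rw [hP]
      linarith
    · refine (hforce s _ _ hs.1 (hXle s hs)).trans ?_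
      have hs1 : 1 ≤ s + 2 * k := by linarith [hs.1]
      have h5 : C / ((s + 2 * k) * (s - ‖X s‖ + 2 * k))
          ≤ C / ((s + 2 * k) * (c * (s + 2 * k) ^ (1 / 2 : ℝ))) := by
        gcongr
        exact hu s hs
      refine h5.trans (le_of_eq ?_)
      have h6 : (s + 2 * k) ^ ((-1 / 2 : ℝ) - 1)
          = ((s + 2 * k) * (s + 2 * k) ^ (1 / 2 : ℝ))⁻¹ := by
        have : (s + 2 * k) * (s + 2 * k) ^ (1 / 2 : ℝ) = (s + 2 * k) ^ (3 / 2 : ℝ) := by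
          conv_lhs => rw [← Real.rpow_one_add' (by linarith) (by norm_num)]
          norm_num
        rw [this, ← Real.rpow_neg (by linarith)]
        norm_num
      rw [h6]
      field_simp
  intro s hs
  refine ⟨hV2 s hs, ?_⟩
  exact hchar.norm_pos_le hs hX0 fun σ hσ =>
    norm_velocity_le hmα (hV2 σ ⟨hσ.1, hσ.2.trans hs.2⟩)

end

/-! ## Decay of the charge and current densities -/

/-- The squares of energy and momentum length differ by the constant `m²`; dividing by the sum of
energies, which dominates the sum of lengths, gives Lipschitz constant one. -/
lemma abs_energy_sub_le {m : ℝ} (hm : 0 < m) (v w : E3) : |energy m v - energy m w| ≤ ‖v - w‖ := by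
  have h1 := energy_sq m v
  have h2 := energy_sq m w
  have h3 := energy_pos hm v
  have h4 := energy_pos hm w
  have h5 := norm_le_energy m v
  have h6 := norm_le_energy m w
  have h7 : |energy m v - energy m w| * (energy m v + energy m w)
      = |‖v‖ - ‖w‖| * (‖v‖ + ‖w‖) := by
    have e1 : |energy m v - energy m w| * (energy m v + energy m w)
        = |(energy m v - energy m w) * (energy m v + energy m w)| := by
      rw [abs_mul, abs_of_pos (a := energy m v + energy m w) (by linarith)]
    have e2 : |‖v‖ - ‖w‖| * (‖v‖ + ‖w‖) = |(‖v‖ - ‖w‖) * (‖v‖ + ‖w‖)| := by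
      rw [abs_mul, abs_of_nonneg (a := ‖v‖ + ‖w‖) (by positivity)]
    rw [e1, e2]
    congr 1
    linear_combination h1 - h2
  have h8 : |‖v‖ - ‖w‖| * (‖v‖ + ‖w‖) ≤ |‖v‖ - ‖w‖| * (energy m v + energy m w) := by gcongr
  exact (le_of_mul_le_mul_right (h7.le.trans h8) (by linarith)).trans (abs_norm_sub_norm_le v w)

/-- On bounded sets of momenta the velocity map is bi-Lipschitz. -/
lemma norm_sub_le_velocity_sub {m P : ℝ} (hm : 0 < m) {v w : E3} (hv : ‖v‖ ≤ P) (hw : ‖w‖ ≤ P) :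
    ‖v - w‖ ≤ (m + P) / (m ^ 2 / (2 * (m ^ 2 + P ^ 2))) * ‖velocity m v - velocity m w‖ := by
  have hP : 0 ≤ P := (norm_nonneg v).trans hv
  set d := m ^ 2 / (2 * (m ^ 2 + P ^ 2)) with hd
  have hd0 : 0 < d := by rw [hd]; positivity
  have h1 : v - w = energy m v • (velocity m v - velocity m w)
      + (energy m v - energy m w) • velocity m w := by
    rw [smul_sub, sub_smul, energy_smul_velocity hm v, energy_smul_velocity hm w]; abel
  have h2 : energy m v ≤ m + P := by
    rw [energy]
    refine Real.sqrt_le_iff.mpr ⟨by positivity, ?_⟩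
    have : ‖v‖ ^ 2 ≤ P ^ 2 := by gcongr
    nlinarith
  -- The energy difference enters multiplied by a speed at most `1 - d`, so it can be absorbed into
  -- the left-hand side.
  have h3 : ‖v - w‖ ≤ (m + P) * ‖velocity m v - velocity m w‖ + ‖v - w‖ * (1 - d) := by
    conv_lhs => rw [h1]
    refine (norm_add_le _ _).trans ?_
    rw [norm_smul, norm_smul, Real.norm_eq_abs, Real.norm_eq_abs, abs_of_pos (energy_pos hm v)]
    have := abs_energy_sub_le hm v w
    have := norm_velocity_le hm hw
    gcongr
  rw [div_mul_eq_mul_div, le_div_iff₀ hd0]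
  linarith

lemma norm_fderiv_le_sqrt_gradNormSq {F : E3 → E3} {x : E3} (hF : DifferentiableAt ℝ F x) :
    ‖fderiv ℝ F x‖ ≤ Real.sqrt (gradNormSq F x) := by
  refine ContinuousLinearMap.opNorm_le_bound _ (Real.sqrt_nonneg _) fun w => ?_
  have hw : w = w 0 • EuclideanSpace.single 0 (1 : ℝ) + w 1 • EuclideanSpace.single 1 (1 : ℝ)
      + w 2 • EuclideanSpace.single 2 (1 : ℝ) := by
    apply E3_ext <;> simp
  have hcomp : ∀ i, fderiv ℝ F x w i = w 0 * partialDeriv 0 (fun y => F y i) x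
      + w 1 * partialDeriv 1 (fun y => F y i) x + w 2 * partialDeriv 2 (fun y => F y i) x := by
    intro i
    conv_lhs => rw [hw]
    simp only [map_add, map_smul, PiLp.add_apply, PiLp.smul_apply, smul_eq_mul,
      partialDeriv_apply_eq hF.hasFDerivAt]
  have cs : ∀ a b c p q r : ℝ, (a * p + b * q + c * r) ^ 2
      ≤ (p ^ 2 + q ^ 2 + r ^ 2) * (a ^ 2 + b ^ 2 + c ^ 2) := by
    intro a b c p q r
    nlinarith [sq_nonneg (a * q - b * p), sq_nonneg (a * r - c * p), sq_nonneg (b * r - c * q)]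
  rw [← Real.sqrt_sq (norm_nonneg w), ← Real.sqrt_mul' _ (by positivity)]
  refine Real.le_sqrt_of_sq_le ?_
  rw [norm_sq_E3, norm_sq_E3, hcomp, hcomp, hcomp, gradNormSq]
  simp only [Fin.sum_univ_three]
  refine (add_le_add (add_le_add (cs _ _ _ _ _ _) (cs _ _ _ _ _ _)) (cs _ _ _ _ _ _)).trans
    (le_of_eq ?_)
  ring

/-- A Gronwall-type estimate: if two trajectories meet at time `t`, their relative velocity at that
time is `O(1/t)`. -/
lemma exists_relative_velocity_bound {C k : ℝ} (hC : 0 < C) (hk : 1 ≤ 2 * k) :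
    ∃ D, 0 < D ∧ ∀ (t : ℝ) (X Z R : ℝ → E3), 0 ≤ t →
      (∀ s ∈ Icc 0 t, HasDerivWithinAt X (Z s) (Icc 0 t) s) →
      (∀ s ∈ Icc 0 t, HasDerivWithinAt Z (R s) (Icc 0 t) s) →
      (∀ s ∈ Icc 0 t, ‖R s‖ ≤ C * ((s + 2 * k) ^ (-5 / 2 : ℝ) * ‖X s‖
        + (s + 2 * k) ^ (-2 : ℝ) * ‖Z s‖)) →
      ‖X 0‖ ≤ 2 * k → (∀ s ∈ Icc 0 t, ‖Z s‖ ≤ 2) → X t = 0 →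
      ‖Z t‖ ≤ D / (t + 2 * k) := by
  -- Beyond this time `32 C (s + 2k)^(-1/2) ≤ 1`, which makes the accumulated perturbation a small
  -- fraction of `M`. Up to this time the bound `‖Z‖ ≤ 2` suffices.
  set T := (32 * C) ^ 2 with hT
  have hT0 : 0 ≤ T := by positivity
  refine ⟨3 * (2 * k + 2 * T + 2 * (T + 2 * k)), by positivity, ?_⟩
  intro t X Z R ht hX hZ hR hX0 hZ2 hXt
  rw [le_div_iff₀ (by linarith)]
  have hZt := hZ2 t ⟨ht, le_rfl⟩
  rcases le_or_gt t T with htT | htT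
  · nlinarith [norm_nonneg (Z t)]
  have hsub : Icc T t ⊆ Icc 0 t := Icc_subset_Icc_left hT0
  -- For free motion both `Y` and `Z` are constant. Here `Y' = -(s + 2k) R`, so the growth of `X` is
  -- factored out.
  set Y : ℝ → E3 := fun s => X s - (s + 2 * k) • Z s with hY
  have hYd : ∀ s ∈ Icc 0 t, HasDerivWithinAt Y (-((s + 2 * k) • R s)) (Icc 0 t) s := by
    intro s hs
    have h1 : HasDerivWithinAt (fun s => s + 2 * k) 1 (Icc 0 t) s :=
      ((hasDerivAt_id s).add_const (2 * k)).hasDerivWithinAt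
    have h2 := (hX s hs).sub (h1.smul (hZ s hs))
    refine h2.congr_deriv ?_
    simp
  have hcont : ContinuousOn (fun s => ‖Y s‖ + (s + 2 * k) * ‖Z s‖) (Icc T t) := by
    have c1 : ContinuousOn Y (Icc T t) := fun s hs =>
      ((hYd s (hsub hs)).continuousWithinAt).mono hsub
    have c2 : ContinuousOn Z (Icc T t) := fun s hs =>
      ((hZ s (hsub hs)).continuousWithinAt).mono hsub
    fun_prop
  -- The maximum over `[T, t]` replaces an iterative Gronwall argument: it controls `X`, `Z` and
  -- hence `R` at once.
  obtain ⟨s₀, hs₀, hmax⟩ := isCompact_Icc.exists_isMaxOn (nonempty_Icc.mpr htT.le) hcont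
  set M := ‖Y s₀‖ + (s₀ + 2 * k) * ‖Z s₀‖ with hM
  have hM0 : 0 ≤ M := by
    have : 0 ≤ s₀ + 2 * k := by linarith [hs₀.1]
    positivity
  have hMle : ∀ s ∈ Icc T t, ‖Y s‖ + (s + 2 * k) * ‖Z s‖ ≤ M := fun s hs => hmax hs
  have hXM : ∀ s ∈ Icc T t, ‖X s‖ ≤ M := by
    intro s hs
    refine le_trans ?_ (hMle s hs)
    have h1 : X s = Y s + (s + 2 * k) • Z s := by simp [hY]
    rw [h1]
    refine (norm_add_le _ _).trans ?_
    rw [norm_smul, Real.norm_eq_abs, abs_of_nonneg (by linarith [hs.1])]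
  have hRM : ∀ s ∈ Icc T t, ‖R s‖ ≤ 2 * C * M * (s + 2 * k) ^ (-5 / 2 : ℝ) := by
    intro s hs
    have hs1 : 1 ≤ s + 2 * k := by linarith [hs.1]
    have h1 : (s + 2 * k) * ‖Z s‖ ≤ M := by
      have := hMle s hs; have := norm_nonneg (Y s); linarith
    have h2 : (s + 2 * k) ^ (-2 : ℝ) * ‖Z s‖ ≤ (s + 2 * k) ^ (-5 / 2 : ℝ) * M := by
      have h3 : (s + 2 * k) ^ (-2 : ℝ) = (s + 2 * k) ^ (-3 : ℝ) * (s + 2 * k) := by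
        rw [← Real.rpow_add_one' (by linarith) (by norm_num)]; norm_num
      rw [h3, mul_assoc]
      have h4 : (s + 2 * k) ^ (-3 : ℝ) ≤ (s + 2 * k) ^ (-5 / 2 : ℝ) :=
        Real.rpow_le_rpow_of_exponent_le hs1 (by norm_num)
      have : 0 ≤ (s + 2 * k) * ‖Z s‖ := by positivity
      gcongr
    have h5 : (s + 2 * k) ^ (-5 / 2 : ℝ) * ‖X s‖ ≤ (s + 2 * k) ^ (-5 / 2 : ℝ) * M := by
      have := hXM s hs
      gcongr
    refine (hR s (hsub hs)).trans ?_
    nlinarith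
  have hsmall : ∀ s ∈ Icc T t, 32 * C * (s + 2 * k) ^ (-1 / 2 : ℝ) ≤ 1 := by
    intro s hs
    have hs1 : 1 ≤ s + 2 * k := by linarith [hs.1]
    have h1 : 32 * C ≤ (s + 2 * k) ^ (1 / 2 : ℝ) := by
      rw [← Real.sqrt_eq_rpow]
      refine Real.le_sqrt_of_sq_le ?_
      rw [← hT]; linarith [hs.1]
    have h2 : (s + 2 * k) ^ (-1 / 2 : ℝ) = ((s + 2 * k) ^ (1 / 2 : ℝ))⁻¹ := by
      rw [← Real.rpow_neg (by linarith)]; norm_num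
    rw [h2, ← div_eq_mul_inv]
    exact (div_le_one (by positivity)).mpr h1
  have hYdiff : ∀ s ∈ Icc T t, ‖Y t - Y s‖ ≤ M / 8 := by
    intro s hs
    have hst : Icc s t ⊆ Icc 0 t := Icc_subset_Icc_left (hT0.trans hs.1)
    have h1 := norm_sub_le_of_deriv_bound (F := Y) (S := Icc 0 t)
      (b := fun s => 2 * C * M * (-2 * (s + 2 * k) ^ (-1 / 2 : ℝ)))
      (b' := fun s => 2 * C * M * (-2 * ((-1 / 2 : ℝ) * (s + 2 * k) ^ ((-1 / 2 : ℝ) - 1)))) hst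
      (fun σ hσ => hYd σ (hst hσ))
      (fun σ hσ => ((hasDerivAt_shift_rpow (by linarith [hσ.1, hs.1])).const_mul (-2)).const_mul _)
      (fun σ hσ => ?_) t ⟨hs.2, le_rfl⟩
    · have h2 := hsmall s hs
      have h3 : 0 ≤ (t + 2 * k) ^ (-1 / 2 : ℝ) := by
        have : 0 ≤ t + 2 * k := by linarith
        positivity
      have h4 := mul_nonneg (mul_nonneg hC.le hM0) h3
      have h5 := mul_le_mul_of_nonneg_left h2 hM0
      linarith
    · have hσ' : σ ∈ Icc T t := ⟨hs.1.trans hσ.1, hσ.2⟩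
      have hσ1 : 1 ≤ σ + 2 * k := by linarith [hσ'.1]
      rw [norm_neg, norm_smul, Real.norm_eq_abs, abs_of_nonneg (by linarith)]
      have h6 : (σ + 2 * k) ^ ((-1 / 2 : ℝ) - 1)
          = (σ + 2 * k) * (σ + 2 * k) ^ (-5 / 2 : ℝ) := by
        rw [← Real.rpow_one_add' (by linarith) (by norm_num)]; norm_num
      rw [h6]
      have := mul_le_mul_of_nonneg_left (hRM σ hσ') (by linarith : 0 ≤ σ + 2 * k)
      linarith
  have hZdiff : ∀ s ∈ Icc T t, (s + 2 * k) * ‖Z t - Z s‖ ≤ M / 8 := by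
    intro s hs
    have hs1 : 1 ≤ s + 2 * k := by linarith [hs.1]
    have hst : Icc s t ⊆ Icc 0 t := Icc_subset_Icc_left (hT0.trans hs.1)
    have h1 := norm_sub_le_of_deriv_bound (F := Z) (S := Icc 0 t)
      (b := fun s => 2 * C * M * (-(2 / 3) * (s + 2 * k) ^ (-3 / 2 : ℝ)))
      (b' := fun s => 2 * C * M * (-(2 / 3) * ((-3 / 2 : ℝ) * (s + 2 * k) ^ ((-3 / 2 : ℝ) - 1)))) hst
      (fun σ hσ => hZ σ (hst hσ))
      (fun σ hσ => ((hasDerivAt_shift_rpow (by linarith [hσ.1, hs.1])).const_mul _).const_mul _)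
      (fun σ hσ => ?_) t ⟨hs.2, le_rfl⟩
    · have h2 := hsmall s hs
      have h3 : 0 ≤ (t + 2 * k) ^ (-3 / 2 : ℝ) := by
        have : 0 ≤ t + 2 * k := by linarith
        positivity
      have h4 := mul_nonneg (mul_nonneg hC.le hM0) h3
      have h5 := mul_le_mul_of_nonneg_left h2 hM0
      have h6 : (s + 2 * k) ^ (-1 / 2 : ℝ) = (s + 2 * k) * (s + 2 * k) ^ (-3 / 2 : ℝ) := by
        rw [← Real.rpow_one_add' (by linarith) (by norm_num)]; norm_num
      rw [h6] at h5
      have h7 : ‖Z t - Z s‖ ≤ 2 * C * M * (2 / 3 * (s + 2 * k) ^ (-3 / 2 : ℝ)) := by linarith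
      have h8 := mul_le_mul_of_nonneg_left h7 (by linarith : 0 ≤ s + 2 * k)
      linarith
    · have hσ' : σ ∈ Icc T t := ⟨hs.1.trans hσ.1, hσ.2⟩
      have h6 : (σ + 2 * k) ^ ((-3 / 2 : ℝ) - 1) = (σ + 2 * k) ^ (-5 / 2 : ℝ) := by norm_num
      rw [h6]
      have := hRM σ hσ'
      linarith
  have hYt : ‖Y t‖ = (t + 2 * k) * ‖Z t‖ := by
    simp only [hY, hXt, zero_sub, norm_neg]
    rw [norm_smul, Real.norm_eq_abs, abs_of_nonneg (by linarith)]
  -- Since `X t = 0`, the norm of `Y t` is `(t + 2k) ‖Z t‖`. Comparing `s₀` with `t` bounds `M` by a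
  -- multiple of this quantity; comparing `T` with `t` then bounds it by the size of `Y T`, which
  -- does not depend on `t`.
  have hMbound : M ≤ 2 * ((t + 2 * k) * ‖Z t‖) + M / 4 := by
    have h1 := hYdiff s₀ hs₀
    have h2 := hZdiff s₀ hs₀
    have h3 := norm_le_norm_add_norm_sub (Y t) (Y s₀)
    have h4 := norm_le_norm_add_norm_sub (Z t) (Z s₀)
    have h6 : (s₀ + 2 * k) * ‖Z s₀‖ ≤ (s₀ + 2 * k) * ‖Z t‖ + M / 8 := by
      have := mul_le_mul_of_nonneg_left h4 (by linarith [hs₀.1] : 0 ≤ s₀ + 2 * k)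
      linarith
    have h7 : (s₀ + 2 * k) * ‖Z t‖ ≤ (t + 2 * k) * ‖Z t‖ := by
      have := hs₀.2
      gcongr
    linarith
  have hTmem : T ∈ Icc T t := ⟨le_rfl, htT.le⟩
  have h1 := hYdiff T hTmem
  have h2 := norm_le_norm_add_norm_sub' (Y t) (Y T)
  have h3 : ‖Y T‖ ≤ ‖X T‖ + (T + 2 * k) * 2 := by
    refine (norm_sub_le _ _).trans ?_
    rw [norm_smul, Real.norm_eq_abs, abs_of_nonneg (by linarith)]
    have := hZ2 T (hsub hTmem)
    gcongr
  have h4 : ‖X T‖ ≤ 2 * k + 2 * T := by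
    have h5 := norm_sub_le_of_deriv_bound (F := X) (F' := Z) (b := fun s => 2 * s)
      (b' := fun _ => 2) le_rfl hX (fun s _ => by simpa using (hasDerivAt_id s).const_mul 2)
      hZ2 T (hsub hTmem)
    have h6 := norm_le_norm_add_norm_sub' (X T) (X 0)
    simp only [mul_zero, sub_zero] at h5
    linarith
  linarith

section

variable {N : ℕ} {m e : Fin N → ℝ} {k : ℝ} {f : Fin N → ℝ → E3 → E3 → ℝ} {E B : ℝ → E3 → E3}

lemma contDiff_slice {F : ℝ → E3 → E3} {T t : ℝ}
    (hF : ContDiffOn ℝ 1 (fun p : ℝ × E3 => F p.1 p.2) (Ici T ×ˢ univ)) (ht : T ≤ t) :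
    ContDiff ℝ 1 (F t) := by
  rw [← contDiffOn_univ]
  exact hF.comp (contDiff_const.prodMk contDiff_id : ContDiff ℝ 1 fun y : E3 => (t, y)).contDiffOn
    fun y _ => ⟨ht, mem_univ _⟩

lemma gradNormSq_nonneg (F : E3 → E3) (x : E3) : 0 ≤ gradNormSq F x :=
  Finset.sum_nonneg fun _ _ => Finset.sum_nonneg fun _ _ => sq_nonneg _

/-- Bounds for the field in a solid cone inside the light cone. -/
lemma StandingHypothesis.exists_inner_bound (h : StandingHypothesis m e k f E B) {κ : ℝ}
    (hκ0 : 0 < κ) (hκ : κ ≤ 1 / 2) :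
    ∃ D, 0 < D ∧ ∀ s y, 0 ≤ s → ‖y‖ ≤ k + (1 - κ) * s →
      ‖E s y‖ ≤ D * (s + 2 * k) ^ (-2 : ℝ) ∧ ‖B s y‖ ≤ D * (s + 2 * k) ^ (-2 : ℝ) ∧
      ‖fderiv ℝ (E s) y‖ ≤ D * (s + 2 * k) ^ (-5 / 2 : ℝ) ∧
      ‖fderiv ℝ (B s) y‖ ≤ D * (s + 2 * k) ^ (-5 / 2 : ℝ) := by
  have hk := h.k_pos
  have hk1 := h.one_le_two_mul
  obtain ⟨C, hC, hdec⟩ := h.decay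
  refine ⟨4 * C / κ ^ 2, by positivity, fun s y hs hy => ?_⟩
  have hy0 := norm_nonneg y
  have hσ : 1 ≤ s + 2 * k := by linarith
  have hyk : ‖y‖ ≤ s + k := by nlinarith
  obtain ⟨h1, h2⟩ := hdec s y hs hyk
  have hu : κ * (s + 2 * k) ≤ s - ‖y‖ + 2 * k := by nlinarith
  have hκσ : 0 < κ * (s + 2 * k) := by positivity
  have b1 : C / ((s + ‖y‖ + 2 * k) * (s - ‖y‖ + 2 * k))
      ≤ 4 * C / κ ^ 2 * (s + 2 * k) ^ (-2 : ℝ) := by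
    have e1 : (s + 2 * k) ^ (-2 : ℝ) = ((s + 2 * k) ^ 2)⁻¹ := by
      rw [Real.rpow_neg (by linarith)]; norm_num
    rw [e1, ← div_eq_mul_inv, div_div]
    have e2 : C / ((s + ‖y‖ + 2 * k) * (s - ‖y‖ + 2 * k)) ≤ C / (κ ^ 2 * (s + 2 * k) ^ 2) := by
      refine div_le_div_of_nonneg_left hC.le (by positivity) ?_
      calc κ ^ 2 * (s + 2 * k) ^ 2 = κ * (s + 2 * k) * (κ * (s + 2 * k)) := by ring
        _ ≤ (s + ‖y‖ + 2 * k) * (s - ‖y‖ + 2 * k) := by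
          gcongr
          nlinarith
    refine e2.trans ?_
    gcongr
    linarith
  have b2 : C * Real.log (s + ‖y‖ + 2 * k) / ((s + ‖y‖ + 2 * k) * (s - ‖y‖ + 2 * k) ^ 2)
      ≤ 4 * C / κ ^ 2 * (s + 2 * k) ^ (-5 / 2 : ℝ) := by
    have e1 : (s + 2 * k) ^ (-5 / 2 : ℝ) = (s + 2 * k) ^ (1 / 2 : ℝ) * ((s + 2 * k) ^ 3)⁻¹ := by
      rw [← Real.rpow_natCast, ← Real.rpow_neg (by linarith), ← Real.rpow_add (by linarith)]
      norm_num
    -- Half a power is given up to remove the logarithm; the gradient still decays like `s^(-5/2)`,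
    -- which the relative velocity estimate needs.
    have e2 : Real.log (s + ‖y‖ + 2 * k) ≤ 4 * (s + 2 * k) ^ (1 / 2 : ℝ) := by
      have l1 : Real.log (s + ‖y‖ + 2 * k) ≤ Real.log (4 * (s + 2 * k)) :=
        Real.log_le_log (by linarith) (by linarith)
      have l2 := Real.log_le_rpow_div (x := 4 * (s + 2 * k)) (ε := 1 / 2) (by linarith) (by norm_num)
      have l3 : (4 * (s + 2 * k)) ^ (1 / 2 : ℝ) = 2 * (s + 2 * k) ^ (1 / 2 : ℝ) := by
        rw [Real.mul_rpow (by norm_num) (by linarith), ← Real.sqrt_eq_rpow 4]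
        rw [show (4 : ℝ) = 2 ^ 2 by norm_num, Real.sqrt_sq (by norm_num)]
      rw [l3] at l2
      linarith
    have e3 : C * Real.log (s + ‖y‖ + 2 * k) / ((s + ‖y‖ + 2 * k) * (s - ‖y‖ + 2 * k) ^ 2)
        ≤ C * (4 * (s + 2 * k) ^ (1 / 2 : ℝ)) / ((s + 2 * k) * (κ * (s + 2 * k)) ^ 2) := by
      gcongr
      linarith
    refine e3.trans (le_of_eq ?_)
    rw [e1]
    field_simp
  have g1 := norm_fderiv_le_sqrt_gradNormSq 
    ((contDiff_slice h.solution.contDiff_E hs).differentiable one_ne_zero y)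
  have g2 := norm_fderiv_le_sqrt_gradNormSq 
    ((contDiff_slice h.solution.contDiff_B hs).differentiable one_ne_zero y)
  have g3 := gradNormSq_nonneg (E s) y
  have g4 := gradNormSq_nonneg (B s) y
  exact ⟨(norm_le_sqrt_add_left _ _).trans (h1.trans b1),
    (norm_le_sqrt_add_right _ _).trans (h1.trans b1),
    g1.trans ((Real.sqrt_le_sqrt (by linarith)).trans (h2.trans b2)),
    g2.trans ((Real.sqrt_le_sqrt (by linarith)).trans (h2.trans b2))⟩

/-- Differences of position and of velocity are separated: the former will be controlled by field
gradients, the latter by the field itself. -/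
lemma norm_lorentzForce_sub_le {m e : ℝ} (hm : 0 < m) (s : ℝ) (x y v w : E3) :
    ‖lorentzForce m e E B s x v - lorentzForce m e E B s y w‖
      ≤ |e| * (‖E s x - E s y‖ + ‖B s x - B s y‖ + ‖velocity m v - velocity m w‖ * ‖B s y‖) := by
  have h1 : lorentzForce m e E B s x v - lorentzForce m e E B s y w
      = e • ((E s x - E s y) + cross (velocity m v) (B s x - B s y)
        + cross (velocity m v - velocity m w) (B s y)) := by
    rw [lorentzForce, lorentzForce, ← smul_sub]
    congr 1
    simp only [← crossCLM_apply, map_sub, sub_apply]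
    abel
  rw [h1, norm_smul, Real.norm_eq_abs]
  have h2 : ‖cross (velocity m v) (B s x - B s y)‖ ≤ ‖B s x - B s y‖ := by
    refine (norm_cross_le _ _).trans ?_
    exact mul_le_of_le_one_left (norm_nonneg _) (norm_velocity_lt hm v).le
  have h3 := norm_cross_le (velocity m v - velocity m w) (B s y)
  refine mul_le_mul_of_nonneg_left ?_ (abs_nonneg e)
  exact (norm_add_le _ _).trans (add_le_add ((norm_add_le _ _).trans (by linarith)) h3)

/-- The momentum support at a given point of spacetime has diameter `O(1/t)`. -/
theorem StandingHypothesis.exists_momentum_diam (h : StandingHypothesis m e k f E B)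
    (hm : ∀ α, 0 < m α) (α : Fin N) :
    ∃ D, 0 < D ∧ ∀ t x v w, 0 ≤ t → f α t x v ≠ 0 → f α t x w ≠ 0 →
      ‖v - w‖ ≤ D / (t + 2 * k) := by
  have hk := h.k_pos
  have hk1 := h.one_le_two_mul
  have hmα := hm α
  obtain ⟨P, κ, hP, hκ0, hκ, htraj⟩ := h.exists_trajectory_bound hm α
  obtain ⟨D, hD, hin⟩ := h.exists_inner_bound hκ0 hκ
  -- The estimate is run for velocities, so accelerations contain the derivative of the velocity
  -- map. Both its size and its Lipschitz constant on the momentum ball are needed.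
  have hcv : ContDiff ℝ 1 (fderiv ℝ (velocity (m α))) :=
    (contDiff_velocity (n := 2) hmα).fderiv_right (by norm_num)
  obtain ⟨M₁, hM₁⟩ := (isCompact_closedBall (0 : E3) P).exists_bound_of_continuousOn
    hcv.continuous.continuousOn
  obtain ⟨K, hK⟩ := hcv.contDiffOn.exists_lipschitzOnWith one_ne_zero (convex_closedBall (0 : E3) P)
    (isCompact_closedBall _ _)
  have hM₁0 : 0 ≤ M₁ := (norm_nonneg _).trans (hM₁ 0 (by simpa using hP.le))
  set L := (m α + P) / (m α ^ 2 / (2 * (m α ^ 2 + P ^ 2))) with hL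
  have hL0 : 0 < L := by positivity
  set a := |e α| with ha
  have ha0 : 0 ≤ a := abs_nonneg _
  set C := M₁ * a * (2 * D) + (M₁ * a * D + K * L * (a * (2 * D))) + 1 with hC
  have hC0 : 0 < C := by positivity
  obtain ⟨D', hD', hgron⟩ := exists_relative_velocity_bound hC0 hk1
  refine ⟨L * D', by positivity, fun t x v w ht hv hw => ?_⟩
  obtain ⟨X₁, V₁, hc₁, hX₁, rfl, hf₁⟩ := h.exists_characteristic hm α ht x v
  obtain ⟨X₂, V₂, hc₂, hX₂, rfl, hf₂⟩ := h.exists_characteristic hm α ht x w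
  rw [hf₁] at hv
  rw [hf₂] at hw
  have s₁ := h.init_f_support α _ _ hv
  have s₂ := h.init_f_support α _ _ hw
  have t₁ := htraj t X₁ V₁ hc₁ s₁.1 s₁.2
  have t₂ := htraj t X₂ V₂ hc₂ s₂.1 s₂.2
  have hder : ∀ {X V : ℝ → E3}, IsCharacteristic (m α) (e α) E B t X V → ∀ s ∈ Icc 0 t,
      HasDerivWithinAt (fun s => velocity (m α) (V s))
        (fderiv ℝ (velocity (m α)) (V s) (lorentzForce (m α) (e α) E B s (X s) (V s)))
        (Icc 0 t) s := by
    intro X V hc s hs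
    have h1 : HasFDerivAt (velocity (m α)) (fderiv ℝ (velocity (m α)) (V s)) (V s) :=
      ((contDiff_velocity (n := 1) hmα).differentiable one_ne_zero _).hasFDerivAt
    exact h1.comp_hasDerivWithinAt s (hc.mom s hs)
  have hfin := hgron t (fun s => X₁ s - X₂ s)
    (fun s => velocity (m α) (V₁ s) - velocity (m α) (V₂ s)) _ ht
    (fun s hs => (hc₁.pos s hs).sub (hc₂.pos s hs))
    (fun s hs => (hder hc₁ s hs).sub (hder hc₂ s hs)) ?_ ?_ ?_ ?_
  · refine (norm_sub_le_velocity_sub hmα (t₁ t ⟨ht, le_rfl⟩).1 (t₂ t ⟨ht, le_rfl⟩).1).trans ?_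
    rw [← hL, mul_div_assoc]
    gcongr
  · intro s hs
    obtain ⟨hv₁, hx₁⟩ := t₁ s hs
    obtain ⟨hv₂, hx₂⟩ := t₂ s hs
    obtain ⟨bE, bB, -, -⟩ := hin s (X₂ s) hs.1 hx₂
    set σ2 := (s + 2 * k) ^ (-2 : ℝ) with hσ2
    set σ5 := (s + 2 * k) ^ (-5 / 2 : ℝ) with hσ5
    have hσ : 0 ≤ s + 2 * k := by linarith [hs.1]
    have hσ20 : 0 ≤ σ2 := by positivity
    have hσ50 : 0 ≤ σ5 := by positivity
    -- Both trajectories lie in the convex ball of radius `k + (1 - κ) s`, where the gradient bound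
    -- holds, so the mean value inequality applies on the segment joining them.
    have lE : ‖E s (X₁ s) - E s (X₂ s)‖ ≤ D * σ5 * ‖X₁ s - X₂ s‖ :=
      (convex_closedBall (0 : E3) (k + (1 - κ) * s)).norm_image_sub_le_of_norm_fderiv_le (𝕜 := ℝ)
        (fun y _ => (contDiff_slice h.solution.contDiff_E hs.1).differentiable one_ne_zero y)
        (fun y hy => (hin s y hs.1 (by simpa using hy)).2.2.1)
        (by simpa using hx₂) (by simpa using hx₁)
    have lB : ‖B s (X₁ s) - B s (X₂ s)‖ ≤ D * σ5 * ‖X₁ s - X₂ s‖ :=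
      (convex_closedBall (0 : E3) (k + (1 - κ) * s)).norm_image_sub_le_of_norm_fderiv_le (𝕜 := ℝ)
        (fun y _ => (contDiff_slice h.solution.contDiff_B hs.1).differentiable one_ne_zero y)
        (fun y hy => (hin s y hs.1 (by simpa using hy)).2.2.2)
        (by simpa using hx₂) (by simpa using hx₁)
    set δ := ‖X₁ s - X₂ s‖ with hδ
    set ζ := ‖velocity (m α) (V₁ s) - velocity (m α) (V₂ s)‖ with hζ
    have hδ0 : 0 ≤ δ := norm_nonneg _
    have hζ0 : 0 ≤ ζ := norm_nonneg _
    set K₁ := lorentzForce (m α) (e α) E B s (X₁ s) (V₁ s)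
    set K₂ := lorentzForce (m α) (e α) E B s (X₂ s) (V₂ s)
    have hK₂ : ‖K₂‖ ≤ a * (2 * D * σ2) := by
      refine (norm_lorentzForce_le hmα (e α) E B s _ _).trans ?_
      rw [← ha]
      refine mul_le_mul_of_nonneg_left ?_ ha0
      linarith
    have hK₁₂ : ‖K₁ - K₂‖ ≤ a * (2 * D * σ5 * δ + ζ * (D * σ2)) := by
      refine (norm_lorentzForce_sub_le hmα s _ _ _ _).trans ?_
      rw [← ha, ← hζ]
      refine mul_le_mul_of_nonneg_left ?_ ha0
      have := mul_le_mul_of_nonneg_left bB hζ0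
      linarith
    have hVd : ‖V₁ s - V₂ s‖ ≤ L * ζ := norm_sub_le_velocity_sub hmα hv₁ hv₂
    have hDd : ‖fderiv ℝ (velocity (m α)) (V₁ s) - fderiv ℝ (velocity (m α)) (V₂ s)‖
        ≤ K * (L * ζ) := by
      have := hK.dist_le_mul (V₁ s) (by simpa using hv₁) (V₂ s) (by simpa using hv₂)
      rw [dist_eq_norm, dist_eq_norm] at this
      exact this.trans (by gcongr)
    have hsplit : fderiv ℝ (velocity (m α)) (V₁ s) K₁ - fderiv ℝ (velocity (m α)) (V₂ s) K₂
        = fderiv ℝ (velocity (m α)) (V₁ s) (K₁ - K₂)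
          + (fderiv ℝ (velocity (m α)) (V₁ s) - fderiv ℝ (velocity (m α)) (V₂ s)) K₂ := by
      rw [map_sub, sub_apply]; abel
    rw [hsplit]
    have n1 : ‖fderiv ℝ (velocity (m α)) (V₁ s) (K₁ - K₂)‖
        ≤ M₁ * (a * (2 * D * σ5 * δ + ζ * (D * σ2))) := by
      refine (ContinuousLinearMap.le_opNorm _ _).trans ?_
      have := hM₁ (V₁ s) (by simpa using hv₁)
      gcongr
    have n2 : ‖(fderiv ℝ (velocity (m α)) (V₁ s) - fderiv ℝ (velocity (m α)) (V₂ s)) K₂‖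
        ≤ K * (L * ζ) * (a * (2 * D * σ2)) := by
      refine (ContinuousLinearMap.le_opNorm _ _).trans ?_
      gcongr
    refine (norm_add_le _ _).trans ((add_le_add n1 n2).trans ?_)
    have p1 : 0 ≤ σ5 * δ := by positivity
    have p2 : 0 ≤ σ2 * ζ := by positivity
    have q1 : M₁ * a * (2 * D) ≤ C := by
      have : 0 ≤ M₁ * a * D + K * L * (a * (2 * D)) + 1 := by positivity
      linarith
    have q2 : M₁ * a * D + K * L * (a * (2 * D)) ≤ C := by
      have : 0 ≤ M₁ * a * (2 * D) + 1 := by positivity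
      linarith
    have r1 := mul_le_mul_of_nonneg_right q1 p1
    have r2 := mul_le_mul_of_nonneg_right q2 p2
    calc M₁ * (a * (2 * D * σ5 * δ + ζ * (D * σ2))) + K * (L * ζ) * (a * (2 * D * σ2))
        = M₁ * a * (2 * D) * (σ5 * δ) + (M₁ * a * D + K * L * (a * (2 * D))) * (σ2 * ζ) := by ring
      _ ≤ C * (σ5 * δ) + C * (σ2 * ζ) := add_le_add r1 r2
      _ = _ := by ring
  · refine (norm_sub_le _ _).trans ?_
    linarith [s₁.1, s₂.1]
  · intro s _
    refine (norm_sub_le _ _).trans ?_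
    linarith [norm_velocity_lt hmα (V₁ s), norm_velocity_lt hmα (V₂ s)]
  · simp [hX₁, hX₂]

/-- Decay of the velocity averages. -/
theorem StandingHypothesis.exists_density_bound (h : StandingHypothesis m e k f E B)
    (hm : ∀ α, 0 < m α) (α : Fin N) :
    ∃ D, 0 < D ∧ ∀ t x, 0 ≤ t → ∫ v, f α t x v ≤ D / (t + 2 * k) ^ 3 := by
  have hk := h.k_pos
  obtain ⟨D, hD, hdiam⟩ := h.exists_momentum_diam hm α
  obtain ⟨C, hC, hfC⟩ := h.exists_f_le hm α
  set b := (volume (Metric.ball (0 : E3) 1)).toReal with hb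
  have hb0 : 0 ≤ b := ENNReal.toReal_nonneg
  refine ⟨C * (D ^ 3 * b) + 1, by positivity, fun t x ht => ?_⟩
  have hσ : 0 < t + 2 * k := by linarith
  by_cases hex : ∃ v, f α t x v ≠ 0
  · obtain ⟨v₀, hv₀⟩ := hex
    set R := D / (t + 2 * k) with hR
    have hR0 : 0 ≤ R := by positivity
    -- The support lies in a ball of radius `D / (t + 2k)`, and the three dimensions of momentum
    -- space give the cubic decay.
    have hvol : (volume (Metric.closedBall v₀ R)).toReal = R ^ 3 * b := by
      rw [Measure.addHaar_closedBall _ _ hR0, ENNReal.toReal_mul,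
        ENNReal.toReal_ofReal (by positivity)]
      simp [hb]
    have h1 : ∫ v, f α t x v ≤ ∫ v, (Metric.closedBall v₀ R).indicator (fun _ => C) v := by
      refine integral_mono (h.solution.integrable_f α t ht x)
        ((integrableOn_const (isCompact_closedBall v₀ R).measure_ne_top).integrable_indicator
          Metric.isClosed_closedBall.measurableSet) fun v => ?_
      by_cases hv : v ∈ Metric.closedBall v₀ R
      · rw [indicator_of_mem hv]; exact hfC t ht x v
      · rw [indicator_of_notMem hv]
        by_contra hcon
        refine hv ?_
        rw [Metric.mem_closedBall, dist_eq_norm]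
        exact hdiam t x v v₀ ht (by intro h0; exact hcon h0.le) hv₀
    rw [integral_indicator Metric.isClosed_closedBall.measurableSet, setIntegral_const, smul_eq_mul,
      Measure.real, hvol] at h1
    refine h1.trans ?_
    rw [hR, div_pow, le_div_iff₀ (by positivity)]
    have : D ^ 3 / (t + 2 * k) ^ 3 * b * C * (t + 2 * k) ^ 3 = C * (D ^ 3 * b) := by
      field_simp
    linarith
  · push Not at hex
    simp only [hex, integral_zero]
    positivity

end

/-! ## Decay of all first derivatives of the field -/

lemma norm_le_abs_add (x : E3) : ‖x‖ ≤ |x 0| + |x 1| + |x 2| := by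
  refine (sq_le_sq₀ (norm_nonneg x) (by positivity)).mp ?_
  rw [norm_sq_E3, ← sq_abs (x 0), ← sq_abs (x 1), ← sq_abs (x 2)]
  nlinarith [mul_nonneg (abs_nonneg (x 0)) (abs_nonneg (x 1)),
    mul_nonneg (abs_nonneg (x 0)) (abs_nonneg (x 2)),
    mul_nonneg (abs_nonneg (x 1)) (abs_nonneg (x 2))]

lemma abs_coord_le_norm (x : E3) (i : Fin 3) : |x i| ≤ ‖x‖ := by
  simpa using PiLp.norm_apply_le x i

lemma sq_partialDeriv_le_gradNormSq (F : E3 → E3) (x : E3) (i j : Fin 3) :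
    partialDeriv j (fun y => F y i) x ^ 2 ≤ gradNormSq F x :=
  (Finset.single_le_sum (f := fun j => partialDeriv j (fun y => F y i) x ^ 2)
    (fun _ _ => sq_nonneg _) (Finset.mem_univ j)).trans
    (Finset.single_le_sum (f := fun i => ∑ j, partialDeriv j (fun y => F y i) x ^ 2)
      (fun _ _ => Finset.sum_nonneg fun _ _ => sq_nonneg _) (Finset.mem_univ i))

lemma norm_curl_le {F : E3 → E3} {x : E3} {G : ℝ}
    (hG : ∀ i j, |partialDeriv j (fun y => F y i) x| ≤ G) : ‖curl F x‖ ≤ 6 * G := by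
  refine (norm_le_abs_add _).trans ?_
  have h1 := abs_sub (partialDeriv 1 (fun y => F y 2) x) (partialDeriv 2 (fun y => F y 1) x)
  have h2 := abs_sub (partialDeriv 2 (fun y => F y 0) x) (partialDeriv 0 (fun y => F y 2) x)
  have h3 := abs_sub (partialDeriv 0 (fun y => F y 1) x) (partialDeriv 1 (fun y => F y 0) x)
  have e0 : curl F x 0 = partialDeriv 1 (fun y => F y 2) x - partialDeriv 2 (fun y => F y 1) x := rfl
  have e1 : curl F x 1 = partialDeriv 2 (fun y => F y 0) x - partialDeriv 0 (fun y => F y 2) x := rfl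
  have e2 : curl F x 2 = partialDeriv 0 (fun y => F y 1) x - partialDeriv 1 (fun y => F y 0) x := rfl
  rw [e0, e1, e2]
  linarith [hG 2 1, hG 1 2, hG 0 2, hG 2 0, hG 1 0, hG 0 1]

lemma norm_fderiv_stBasis_succ_le {F : ℝ → E3 → E3} {t : ℝ} {x : E3}
    (hF : DifferentiableAt ℝ (fun q : ℝ × E3 => F q.1 q.2) (t, x)) {G : ℝ}
    (hG : ∀ i j, |partialDeriv j (fun y => F t y i) x| ≤ G) (i : Fin 3) :
    ‖fderiv ℝ (fun q : ℝ × E3 => F q.1 q.2) (t, x) (stBasis i.succ)‖ ≤ 3 * G := by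
  refine (norm_le_abs_add _).trans ?_
  rw [← partialDeriv_slice hF, ← partialDeriv_slice hF, ← partialDeriv_slice hF]
  linarith [hG 0 i, hG 1 i, hG 2 i]

section

variable {N : ℕ} {m e : Fin N → ℝ} {k : ℝ} {f : Fin N → ℝ → E3 → E3 → ℝ} {E B : ℝ → E3 → E3}

/-- Decay of the current density. -/
lemma StandingHypothesis.exists_current_bound (h : StandingHypothesis m e k f E B)
    (hm : ∀ α, 0 < m α) :
    ∃ C, 0 ≤ C ∧ ∀ t x, 0 ≤ t → ‖x‖ ≤ t + k →
      ‖currentDensity m e f t x‖ ≤ C / ((t + ‖x‖ + 2 * k) * (t - ‖x‖ + 2 * k) ^ 2) := by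
  have hk := h.k_pos
  choose D hD hbound using h.exists_density_bound hm
  refine ⟨∑ α, |e α| * (2 * D α), Finset.sum_nonneg fun α _ => by have := hD α; positivity,
    fun t x ht hx => ?_⟩
  have hx0 := norm_nonneg x
  have hw : 0 < t - ‖x‖ + 2 * k := by linarith
  rw [currentDensity, Finset.sum_div]
  refine (norm_sum_le _ _).trans (Finset.sum_le_sum fun α _ => ?_)
  rw [norm_smul, Real.norm_eq_abs, mul_div_assoc]
  refine mul_le_mul_of_nonneg_left ?_ (abs_nonneg _)
  have h1 : ‖∫ v : E3, f α t x v • velocity (m α) v‖ ≤ ∫ v, f α t x v := by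
    refine norm_integral_le_of_norm_le (h.solution.integrable_f α t ht x)
      (Filter.Eventually.of_forall fun v => ?_)
    rw [norm_smul, Real.norm_of_nonneg (h.f_nonneg hm α ht x v)]
    exact mul_le_of_le_one_right (h.f_nonneg hm α ht x v) (norm_velocity_lt (hm α) v).le
  refine h1.trans ((hbound α t x ht).trans ?_)
  have hDα := hD α
  have hσ : 0 < t + 2 * k := by linarith
  rw [div_le_div_iff₀ (by positivity) (by positivity)]
  -- Inside the cone the weight is at most `2 (t + 2k)³`, so cubic decay in time implies the
  -- weighted form.
  have h2 : (t + ‖x‖ + 2 * k) * (t - ‖x‖ + 2 * k) ^ 2 ≤ (2 * (t + 2 * k)) * (t + 2 * k) ^ 2 := by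
    gcongr <;> linarith
  nlinarith

/-- Decay of all first derivatives of the field in spacetime. -/
lemma StandingHypothesis.exists_fderiv_bound (h : StandingHypothesis m e k f E B)
    (hm : ∀ α, 0 < m α) :
    ∃ C, 0 ≤ C ∧ ∀ t x, 0 < t → ‖x‖ ≤ t + k → ∀ μ,
      ‖fderiv ℝ (fun q : ℝ × E3 => E q.1 q.2) (t, x) (stBasis μ)‖
        ≤ C * (1 + Real.log (t + ‖x‖ + 2 * k))
          / ((t + ‖x‖ + 2 * k) * (t - ‖x‖ + 2 * k) ^ 2) ∧
      ‖fderiv ℝ (fun q : ℝ × E3 => B q.1 q.2) (t, x) (stBasis μ)‖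
        ≤ C * (1 + Real.log (t + ‖x‖ + 2 * k))
          / ((t + ‖x‖ + 2 * k) * (t - ‖x‖ + 2 * k) ^ 2) := by
  have hk := h.k_pos
  have hk1 := h.one_le_two_mul
  obtain ⟨C, hC, hdec⟩ := h.decay
  obtain ⟨J, hJ, hcur⟩ := h.exists_current_bound hm
  refine ⟨6 * C + 4 * Real.pi * J, by positivity, fun t x ht hx μ => ?_⟩
  have hx0 := norm_nonneg x
  have hw : 0 < t - ‖x‖ + 2 * k := by linarith
  have hl : 0 ≤ Real.log (t + ‖x‖ + 2 * k) := Real.log_nonneg (by linarith)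
  have hg := (hdec t x ht.le hx).2
  have hj := hcur t x ht.le hx
  set l := Real.log (t + ‖x‖ + 2 * k) with hl_def
  set W := (t + ‖x‖ + 2 * k) * (t - ‖x‖ + 2 * k) ^ 2 with hW
  have hW0 : 0 < W := by positivity
  set G := Real.sqrt (gradNormSq (E t) x + gradNormSq (B t) x) with hG
  have hGE : ∀ i j, |partialDeriv j (fun y => E t y i) x| ≤ G := fun i j =>
    Real.abs_le_sqrt ((sq_partialDeriv_le_gradNormSq (E t) x i j).trans
      (le_add_of_nonneg_right (gradNormSq_nonneg _ _)))
  have hGB : ∀ i j, |partialDeriv j (fun y => B t y i) x| ≤ G := fun i j =>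
    Real.abs_le_sqrt ((sq_partialDeriv_le_gradNormSq (B t) x i j).trans
      (le_add_of_nonneg_left (gradNormSq_nonneg _ _)))
  have dE := (h.contDiffAt_E ht x).differentiableAt one_ne_zero
  have dB := (h.contDiffAt_B ht x).differentiableAt one_ne_zero
  have hG0 : 0 ≤ G := Real.sqrt_nonneg _
  have hpi := Real.pi_pos
  have key : 6 * G + 4 * Real.pi * ‖currentDensity m e f t x‖
      ≤ (6 * C + 4 * Real.pi * J) * (1 + l) / W := by
    rw [le_div_iff₀ hW0] at hg hj ⊢
    have := mul_le_mul_of_nonneg_left hj (by positivity : 0 ≤ 4 * Real.pi)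
    have : 0 ≤ 4 * Real.pi * J * l := by positivity
    nlinarith
  have hc0 : 0 ≤ 4 * Real.pi * ‖currentDensity m e f t x‖ := by positivity
  -- Time derivatives are recovered from Ampère and Faraday, and only the former needs decay of the
  -- current; spatial ones are assumed.
  refine Fin.cases ?_ (fun i => ?_) μ
  · rw [← derivWithin_Ici_of_hasDerivAt ht.le (deriv_slice dE),
      ← derivWithin_Ici_of_hasDerivAt ht.le (deriv_slice dB), h.solution.ampere t ht.le x,
      h.solution.faraday t ht.le x, norm_neg]
    refine ⟨(norm_sub_le _ _).trans (le_trans ?_ key), (norm_curl_le hGE).trans ?_⟩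
    · rw [norm_smul, Real.norm_of_nonneg (by positivity)]
      gcongr
      exact norm_curl_le hGB
    · linarith
  · exact ⟨(norm_fderiv_stBasis_succ_le dE hGE i).trans (by linarith),
      (norm_fderiv_stBasis_succ_le dB hGB i).trans (by linarith)⟩

end

/-! ## Decay of the transformed field -/

lemma exists_lorentz_norm_le (A : Matrix (Fin 4) (Fin 4) ℝ) :
    ∃ L, 1 ≤ L ∧ ∀ t x, |timePart A t x| + ‖spacePart A t x‖ ≤ L * (|t| + ‖x‖) := by
  refine ⟨max 1 (2 * ‖lorentzMap A‖), le_max_left _ _, fun t x => ?_⟩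
  have h1 := (lorentzMap A).le_opNorm (t, x)
  have h2 : ‖((t, x) : ℝ × E3)‖ ≤ |t| + ‖x‖ := by
    rw [Prod.norm_def]
    exact max_le (by simp) (by simp)
  have h3 := norm_fst_le (lorentzMap A (t, x))
  have h4 := norm_snd_le (lorentzMap A (t, x))
  have h5 : ‖lorentzMap A‖ * ‖((t, x) : ℝ × E3)‖ ≤ ‖lorentzMap A‖ * (|t| + ‖x‖) := by gcongr
  calc |timePart A t x| + ‖spacePart A t x‖ ≤ 2 * ‖lorentzMap A‖ * (|t| + ‖x‖) := by
        rw [lorentzMap_apply, Real.norm_eq_abs] at h3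
        rw [lorentzMap_apply] at h4
        rw [lorentzMap_apply] at h1
        dsimp only at h1 h3 h4
        linarith
    _ ≤ _ := by gcongr; exact le_max_right _ _

/-- Comparison of the light-cone weights before and after a Lorentz transformation. -/
lemma exists_weight_comparison {A : Matrix (Fin 4) (Fin 4) ℝ} (hA : A ∈ restrictedLorentz)
    {k k' T : ℝ} (hk : 0 < k) (hk' : 0 < k') (hT : 0 < T) :
    ∃ K, 1 ≤ K ∧ ∀ t x, 0 ≤ t → 0 < timePart A (t + T) x →
      ‖spacePart A (t + T) x‖ ≤ timePart A (t + T) x + k →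
      t + ‖x‖ + 2 * k' ≤ K * (timePart A (t + T) x + ‖spacePart A (t + T) x‖ + 2 * k) ∧
      t - ‖x‖ + 2 * k' ≤ K * (timePart A (t + T) x - ‖spacePart A (t + T) x‖ + 2 * k) ∧
      timePart A (t + T) x + ‖spacePart A (t + T) x‖ + 2 * k ≤ K * (t + ‖x‖ + 2 * k') := by
  obtain ⟨L, hL, hLb⟩ := exists_lorentz_norm_le A
  obtain ⟨L', hL', hLb'⟩ := exists_lorentz_norm_le A⁻¹
  have c1 : 0 < 2 * k' / k := by positivity
  have c2 : 0 < (L * T + 2 * k) / (2 * k') := by positivity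
  -- The operator bounds `L` and `L'` handle the linear parts; the two quotients absorb the additive
  -- constants `2k'` and `L T + 2k`.
  refine ⟨L + L' + 2 * k' / k + (L * T + 2 * k) / (2 * k'), by linarith, fun t x ht hτ hy => ?_⟩
  have b1 := hLb (t + T) x
  have b2 := hLb' (timePart A (t + T) x) (spacePart A (t + T) x)
  have hform := minkowski_form_invariant hA (t + T) x
  rw [timePart_inv_apply hA, spacePart_inv_apply hA] at b2
  set τ := timePart A (t + T) x
  set r := ‖spacePart A (t + T) x‖
  rw [abs_of_pos hτ] at b1 b2
  rw [abs_of_pos (by linarith)] at b1 b2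
  have hr : 0 ≤ r := norm_nonneg _
  have hx := norm_nonneg x
  set K := L + L' + 2 * k' / k + (L * T + 2 * k) / (2 * k')
  have hKL : L ≤ K := by linarith
  have hKL' : L' ≤ K := by linarith
  have hK1 : 2 * k' ≤ K * k := by
    rw [← div_le_iff₀ hk]; linarith
  have hK2 : L * T + 2 * k ≤ K * (2 * k') := by
    rw [← div_le_iff₀ (by positivity)]; linarith
  have hp : 0 ≤ τ + r := by linarith
  refine ⟨?_, ?_, ?_⟩
  · nlinarith [mul_le_mul_of_nonneg_right hKL' hp]
  -- Inside the cone, the invariant `(t + T)² - |x|² = τ² - r²` is factored and divided by `t + T +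
  -- |x|`, using `τ + r ≤ L (t + T + |x|)`. Outside it, the left side is less than `2k'`, while the
  -- right side is at least `K k` because `r ≤ τ + k`.
  · rcases le_or_gt ‖x‖ (t + T) with hc | hc
    · have hd : 0 ≤ τ - r := by
        by_contra hcon
        push Not at hcon
        nlinarith
      have h3 : (t + T - ‖x‖) * (t + T + ‖x‖) ≤ L * (τ - r) * (t + T + ‖x‖) := by
        nlinarith [mul_le_mul_of_nonneg_left b1 hd]
      have h4 := le_of_mul_le_mul_right h3 (by linarith)
      nlinarith [mul_le_mul_of_nonneg_right hKL hd]
    · have h5 : K * k ≤ K * (τ - r + 2 * k) := by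
        refine mul_le_mul_of_nonneg_left (by linarith) (by linarith)
      linarith
  · have h6 : 0 ≤ t + ‖x‖ := by linarith
    nlinarith [mul_le_mul_of_nonneg_right hKL h6]

/-- There are eighteen entries of size at most `G`, and `√18 ≤ 5`. -/
lemma sqrt_gradNormSq_add_le {F F' : E3 → E3} {x : E3} {G : ℝ} (hG0 : 0 ≤ G)
    (hF : ∀ i j, |partialDeriv j (fun y => F y i) x| ≤ G)
    (hF' : ∀ i j, |partialDeriv j (fun y => F' y i) x| ≤ G) :
    Real.sqrt (gradNormSq F x + gradNormSq F' x) ≤ 5 * G := by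
  have h : ∀ {F : E3 → E3}, (∀ i j, |partialDeriv j (fun y => F y i) x| ≤ G) →
      gradNormSq F x ≤ 9 * G ^ 2 := by
    intro F hF
    calc gradNormSq F x ≤ ∑ _i : Fin 3, ∑ _j : Fin 3, G ^ 2 :=
          Finset.sum_le_sum fun i _ => Finset.sum_le_sum fun j _ => by
            rw [← sq_abs]; exact pow_le_pow_left₀ (abs_nonneg _) (hF i j) 2
      _ = 9 * G ^ 2 := by simp; ring
  rw [Real.sqrt_le_left (by positivity)]
  nlinarith [h hF, h hF', sq_nonneg G]

section

variable {N : ℕ} {m e : Fin N → ℝ} {k : ℝ} {f : Fin N → ℝ → E3 → E3 → ℝ} {E B : ℝ → E3 → E3}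

/-- The exterior of the support cone is open, so vanishing there passes to derivatives. -/
lemma StandingHypothesis.fderiv_extendZero_eq_zero (h : StandingHypothesis m e k f E B)
    (hm : ∀ α, 0 < m α) {p : ℝ × E3} (hp : p.1 + k < ‖p.2‖) :
    fderiv ℝ (fun q : ℝ × E3 => extendZero E q.1 q.2) p = 0 ∧
      fderiv ℝ (fun q : ℝ × E3 => extendZero B q.1 q.2) p = 0 := by
  have hev : ∀ᶠ q : ℝ × E3 in nhds p, q.1 + k < ‖q.2‖ :=
    (isOpen_lt (by fun_prop) (by fun_prop)).mem_nhds hp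
  constructor
  · have : (fun q : ℝ × E3 => extendZero E q.1 q.2) =ᶠ[nhds p] fun _ => 0 := by
      filter_upwards [hev] with q hq using (h.extendZero_eq_zero hm hq).2.1
    rw [this.fderiv_eq, fderiv_const_apply]
  · have : (fun q : ℝ × E3 => extendZero B q.1 q.2) =ᶠ[nhds p] fun _ => 0 := by
      filter_upwards [hev] with q hq using (h.extendZero_eq_zero hm hq).2.2
    rw [this.fderiv_eq, fderiv_const_apply]

lemma fderiv_extendZero (F : ℝ → E3 → E3) {p : ℝ × E3} (hp : 0 < p.1) :
    fderiv ℝ (fun q : ℝ × E3 => extendZero F q.1 q.2) p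
      = fderiv ℝ (fun q : ℝ × E3 => F q.1 q.2) p := by
  refine Filter.EventuallyEq.fderiv_eq ?_
  have hev : ∀ᶠ q : ℝ × E3 in nhds p, 0 < q.1 :=
    (isOpen_lt continuous_const continuous_fst).mem_nhds hp
  filter_upwards [hev] with q hq
  rw [extendZero_of_nonneg _ hq.le]

/-- Pointwise bounds for the field and its derivatives carry over to the transformed field. -/
lemma exists_field_transform_bound (A : Matrix (Fin 4) (Fin 4) ℝ) :
    ∃ M, 0 < M ∧ ∀ (E B : ℝ → E3 → E3) (t : ℝ) (x : E3) (b d : ℝ), 0 ≤ b → 0 ≤ d →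
      (∀ F ∈ ({E, B} : Set (ℝ → E3 → E3)),
        ContDiffAt ℝ 1 (fun q : ℝ × E3 => F q.1 q.2) (lorentzMap A (t, x)) ∧
        ‖F (timePart A t x) (spacePart A t x)‖ ≤ b ∧
        ∀ μ, ‖fderiv ℝ (fun q : ℝ × E3 => F q.1 q.2) (lorentzMap A (t, x)) (stBasis μ)‖ ≤ d) →
      Real.sqrt (‖electricMap A (E (timePart A t x) (spacePart A t x),
            B (timePart A t x) (spacePart A t x))‖ ^ 2
          + ‖magneticMap A (E (timePart A t x) (spacePart A t x),
            B (timePart A t x) (spacePart A t x))‖ ^ 2) ≤ M * b ∧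
      Real.sqrt (gradNormSq (fun y => electricMap A (E (timePart A t y) (spacePart A t y),
            B (timePart A t y) (spacePart A t y))) x
          + gradNormSq (fun y => magneticMap A (E (timePart A t y) (spacePart A t y),
            B (timePart A t y) (spacePart A t y))) x) ≤ M * d := by
  set n := ‖electricMap A‖ + ‖magneticMap A‖ with hn
  set a := ∑ μ, ∑ γ, |A μ γ| with ha
  have hn0 : 0 ≤ n := by positivity
  have ha0 : 0 ≤ a := by positivity
  refine ⟨2 * n + 5 * (n * a) + 1, by positivity, fun E B t x b d hb hd hF => ?_⟩
  obtain ⟨cE, bE, dE⟩ := hF E (by simp)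
  obtain ⟨cB, bB, dB⟩ := hF B (by simp)
  have hop : ∀ (q : E3 × E3) (c : ℝ), ‖q‖ ≤ c →
      ‖electricMap A q‖ ≤ n * c ∧ ‖magneticMap A q‖ ≤ n * c := by
    intro q c hq
    have hc : 0 ≤ c := (norm_nonneg _).trans hq
    refine ⟨((electricMap A).le_opNorm q).trans ?_, ((magneticMap A).le_opNorm q).trans ?_⟩
    · gcongr; exact le_add_of_nonneg_right (norm_nonneg _)
    · gcongr; exact le_add_of_nonneg_left (norm_nonneg _)
  constructor
  · obtain ⟨h1, h2⟩ := hop _ b (max_le bE bB : ‖(E (timePart A t x) (spacePart A t x),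
      B (timePart A t x) (spacePart A t x))‖ ≤ b)
    have h3 : 0 ≤ n * b := by positivity
    have h4 : Real.sqrt (‖electricMap A (E (timePart A t x) (spacePart A t x),
            B (timePart A t x) (spacePart A t x))‖ ^ 2
          + ‖magneticMap A (E (timePart A t x) (spacePart A t x),
            B (timePart A t x) (spacePart A t x))‖ ^ 2) ≤ 2 * (n * b) := by
      rw [Real.sqrt_le_left (by positivity)]
      nlinarith [pow_le_pow_left₀ (norm_nonneg _) h1 2, pow_le_pow_left₀ (norm_nonneg _) h2 2,
        sq_nonneg (n * b)]
    have h5 : 0 ≤ n * a * b := by positivity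
    nlinarith
  · have hsum : ∀ γ, ‖∑ μ, A μ γ •
        (fderiv ℝ (fun q : ℝ × E3 => E q.1 q.2) (lorentzMap A (t, x)) (stBasis μ),
          fderiv ℝ (fun q : ℝ × E3 => B q.1 q.2) (lorentzMap A (t, x)) (stBasis μ))‖ ≤ a * d := by
      intro γ
      rw [ha, Finset.sum_mul]
      refine (norm_sum_le _ _).trans (Finset.sum_le_sum fun μ _ => ?_)
      rw [norm_smul, Real.norm_eq_abs]
      refine mul_le_mul ?_ (max_le (dE μ) (dB μ)) (norm_nonneg _)
        (Finset.sum_nonneg fun _ _ => abs_nonneg _)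
      exact Finset.single_le_sum (f := fun γ => |A μ γ|) (fun _ _ => abs_nonneg _)
        (Finset.mem_univ γ)
    have hpair : ContDiffAt ℝ 1
      (fun q : ℝ × E3 => (E (timePart A q.1 q.2) (spacePart A q.1 q.2),
        B (timePart A q.1 q.2) (spacePart A q.1 q.2))) (t, x) :=
      ContDiffAt.comp (g := fun q : ℝ × E3 => (E q.1 q.2, B q.1 q.2)) (f := lorentzMap A) (t, x)
        (cE.prodMk cB) (lorentzMap A).contDiff.contDiffAt
    have h0 : 0 ≤ n * (a * d) := by positivity
    have h1 := sqrt_gradNormSq_add_le (x := x) h0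
      (F := fun y => electricMap A (E (timePart A t y) (spacePart A t y),
            B (timePart A t y) (spacePart A t y)))
      (F' := fun y => magneticMap A (E (timePart A t y) (spacePart A t y),
            B (timePart A t y) (spacePart A t y)))
      (fun i j => by
        rw [partialDeriv_slice (F := fun s y => electricMap A (E (timePart A s y) (spacePart A s y),
            B (timePart A s y) (spacePart A s y)))
          (((electricMap A).contDiff.contDiffAt.comp (t, x) hpair).differentiableAt one_ne_zero),
          (fderiv_fields_lorentz cE cB _).1]
        exact (abs_coord_le_norm _ _).trans (hop _ _ (hsum _)).1)
      (fun i j => by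
        rw [partialDeriv_slice (F := fun s y => magneticMap A (E (timePart A s y) (spacePart A s y),
            B (timePart A s y) (spacePart A s y)))
          (((magneticMap A).contDiff.contDiffAt.comp (t, x) hpair).differentiableAt one_ne_zero),
          (fderiv_fields_lorentz cE cB _).2]
        exact (abs_coord_le_norm _ _).trans (hop _ _ (hsum _)).2)
    have h2 : 0 ≤ n * d := by positivity
    nlinarith

/-- Decay estimates for the Lorentz transform of the field. -/
theorem StandingHypothesis.exists_lorentz_decay (h : StandingHypothesis m e k f E B)
    (hm : ∀ α, 0 < m α) {A : Matrix (Fin 4) (Fin 4) ℝ} (hA : A ∈ restrictedLorentz) {T k' : ℝ}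
    (hT0 : 0 < T) (hT : boost A * k < T) (hk' : 2 ≤ k') :
    ∃ C₀ : ℝ, 0 < C₀ ∧ ∀ t x, 0 ≤ t → ‖x‖ ≤ t + k' →
      Real.sqrt (‖lorentzE A E B (t + T) x‖ ^ 2 + ‖lorentzB A E B (t + T) x‖ ^ 2)
          ≤ C₀ / ((t + ‖x‖ + 2 * k') * (t - ‖x‖ + 2 * k')) ∧
      Real.sqrt (gradNormSq (lorentzE A E B (t + T)) x + gradNormSq (lorentzB A E B (t + T)) x)
          ≤ C₀ * Real.log (t + ‖x‖ + 2 * k')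
            / ((t + ‖x‖ + 2 * k') * (t - ‖x‖ + 2 * k') ^ 2) := by
  have hk := h.k_pos
  have hk1 := h.one_le_two_mul
  obtain ⟨K, hK, hcomp⟩ := exists_weight_comparison hA hk (by linarith : 0 < k') hT0
  obtain ⟨M, hM, htrans⟩ := exists_field_transform_bound A
  obtain ⟨C, hC, hdec⟩ := h.decay
  obtain ⟨D, hD, hder⟩ := h.exists_fderiv_bound hm
  have hreg := h.regularSolution hm
  have hlK : 0 ≤ Real.log K := Real.log_nonneg hK
  set c := C * K ^ 2 + D * (2 + Real.log K) * K ^ 3 with hc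
  have hc0 : 0 < c := by positivity
  refine ⟨M * c, by positivity, fun t x ht hx => ?_⟩
  have hx0 := norm_nonneg x
  set z := t + ‖x‖ + 2 * k' with hz
  set w := t - ‖x‖ + 2 * k' with hw
  have hz0 : 4 ≤ z := by linarith
  have hw0 : 0 < w := by linarith
  -- The condition `k' ≥ 2` forces `z ≥ 4 > e`, so `1` and `log K` are absorbed into a multiple of
  -- `log z`.
  have hlz : 1 ≤ Real.log z := by
    rw [Real.le_log_iff_exp_le (by linarith)]
    linarith [Real.exp_one_lt_d9]
  have hmem := lorentz_mem_extendedRegion hA hT (by linarith : T ≤ t + T) x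
  have hsuff : ∀ F ∈ ({extendZero E, extendZero B} : Set (ℝ → E3 → E3)),
        ContDiffAt ℝ 1 (fun q : ℝ × E3 => F q.1 q.2) (lorentzMap A (t + T, x)) ∧
        ‖F (timePart A (t + T) x) (spacePart A (t + T) x)‖ ≤ c / (z * w) ∧
        ∀ μ, ‖fderiv ℝ (fun q : ℝ × E3 => F q.1 q.2) (lorentzMap A (t + T, x)) (stBasis μ)‖
          ≤ c * Real.log z / (z * w ^ 2) := by
    have r1 : 0 ≤ c / (z * w) := by positivity
    have r2 : 0 ≤ c * Real.log z / (z * w ^ 2) := by positivity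
    have cE := hreg.contDiffAt_E (lorentzMap A (t + T, x)) hmem
    have cB := hreg.contDiffAt_B (lorentzMap A (t + T, x)) hmem
    by_cases hcone : timePart A (t + T) x + k < ‖spacePart A (t + T) x‖
    · obtain ⟨-, zE, zB⟩ := h.extendZero_eq_zero hm hcone
      obtain ⟨fE, fB⟩ := h.fderiv_extendZero_eq_zero hm (p := lorentzMap A (t + T, x)) hcone
      rintro F (rfl | rfl)
      · exact ⟨cE, by simpa [zE] using r1, fun μ => by simpa [fE] using r2⟩
      · exact ⟨cB, by simpa [zB] using r1, fun μ => by simpa [fB] using r2⟩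
    · have hτ : 0 < timePart A (t + T) x := by
        rcases hmem with h1 | h1
        · exact h1
        · exact absurd (lt_of_le_of_lt (by gcongr; exact le_abs_self _) h1) hcone
      have hle := not_lt.mp hcone
      obtain ⟨k1, k2, k3⟩ := hcomp t x ht hτ hle
      have hb := (hdec _ _ hτ.le hle).1
      have hd := hder _ _ hτ hle
      rw [← hz] at k1 k3
      rw [← hw] at k2
      have e1 := fderiv_extendZero E (p := lorentzMap A (t + T, x)) hτ
      have e2 := fderiv_extendZero B (p := lorentzMap A (t + T, x)) hτ
      rw [lorentzMap_apply] at e1 e2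
      rw [lorentzMap_apply] at cE cB ⊢
      dsimp only at e1 e2 cE cB ⊢
      set τ := timePart A (t + T) x
      set y := spacePart A (t + T) x
      have hy0 := norm_nonneg y
      have hζ : 0 < τ + ‖y‖ + 2 * k := by linarith
      have hω : 0 < τ - ‖y‖ + 2 * k := by linarith
      have hl : 1 + Real.log (τ + ‖y‖ + 2 * k) ≤ (2 + Real.log K) * Real.log z := by
        have h1 := Real.log_le_log hζ k3
        rw [Real.log_mul (by linarith) (by linarith)] at h1
        nlinarith
      have hbound : C / ((τ + ‖y‖ + 2 * k) * (τ - ‖y‖ + 2 * k)) ≤ c / (z * w) := by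
        rw [div_le_div_iff₀ (by positivity) (by positivity)]
        have h1 : z * w ≤ (K * (τ + ‖y‖ + 2 * k)) * (K * (τ - ‖y‖ + 2 * k)) := by gcongr
        have h2 : 0 ≤ D * (2 + Real.log K) * K ^ 3 * ((τ + ‖y‖ + 2 * k) * (τ - ‖y‖ + 2 * k)) := by
          positivity
        rw [hc, add_mul]
        nlinarith [mul_le_mul_of_nonneg_left h1 hC.le]
      have hbound' : D * (1 + Real.log (τ + ‖y‖ + 2 * k))
          / ((τ + ‖y‖ + 2 * k) * (τ - ‖y‖ + 2 * k) ^ 2) ≤ c * Real.log z / (z * w ^ 2) := by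
        rw [div_le_div_iff₀ (by positivity) (by positivity)]
        have h1 : z * w ^ 2 ≤ (K * (τ + ‖y‖ + 2 * k)) * (K * (τ - ‖y‖ + 2 * k)) ^ 2 := by gcongr
        calc D * (1 + Real.log (τ + ‖y‖ + 2 * k)) * (z * w ^ 2)
            ≤ D * ((2 + Real.log K) * Real.log z)
              * ((K * (τ + ‖y‖ + 2 * k)) * (K * (τ - ‖y‖ + 2 * k)) ^ 2) := by gcongr
          _ = D * (2 + Real.log K) * K ^ 3 * Real.log z
              * ((τ + ‖y‖ + 2 * k) * (τ - ‖y‖ + 2 * k) ^ 2) := by ring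
          _ ≤ _ := by
            gcongr
            rw [hc]
            exact le_add_of_nonneg_left (by positivity)
      rintro F (rfl | rfl)
      · refine ⟨cE, ?_, fun μ => ?_⟩
        · rw [extendZero_of_nonneg _ hτ.le]
          refine (Real.le_sqrt_of_sq_le ?_).trans (hb.trans hbound)
          exact le_add_of_nonneg_right (sq_nonneg _)
        · rw [e1]
          exact (hd μ).1.trans hbound'
      · refine ⟨cB, ?_, fun μ => ?_⟩
        · rw [extendZero_of_nonneg _ hτ.le]
          refine (Real.le_sqrt_of_sq_le ?_).trans (hb.trans hbound)
          exact le_add_of_nonneg_left (sq_nonneg _)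
        · rw [e2]
          exact (hd μ).2.trans hbound'
  obtain ⟨h1, h2⟩ := htrans (extendZero E) (extendZero B) (t + T) x _ _ (by positivity)
    (by positivity) hsuff
  refine ⟨h1.trans_eq ?_, h2.trans_eq ?_⟩
  · ring
  · ring

end

/-! ## The transformed data -/

section

variable {N : ℕ} {m e : Fin N → ℝ} {k : ℝ} {f : Fin N → ℝ → E3 → E3 → ℝ} {E B : ℝ → E3 → E3}

lemma IsSolution.contDiff_f_slice {T t : ℝ} (h : IsSolution m e T f E B) (ht : T ≤ t)
    (α : Fin N) : ContDiff ℝ 1 (fun p : E3 × E3 => f α t p.1 p.2) := by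
  rw [← contDiffOn_univ]
  exact (h.contDiff_f α).comp
    (contDiff_const.prodMk contDiff_id : ContDiff ℝ 1 fun p : E3 × E3 => (t, p)).contDiffOn
    fun y _ => ⟨ht, mem_univ _⟩

lemma hasCompactSupport_of_norm_le {V W : Type*} [NormedAddCommGroup V] [ProperSpace V] [Zero W]
    {g : V → W} {R : ℝ} (h : ∀ x, g x ≠ 0 → ‖x‖ ≤ R) : HasCompactSupport g :=
  HasCompactSupport.intro (isCompact_closedBall (0 : V) R) fun x hx => by
    by_contra h0
    exact hx (by simpa using h x h0)

/-- Gauss's law for a compactly supported field implies neutrality. -/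
lemma neutral_of_gauss {g : Fin N → E3 → E3 → ℝ} {F : E3 → E3} {R : ℝ}
    (hg : ∀ α, Continuous fun p : E3 × E3 => g α p.1 p.2)
    (hgs : ∀ α x v, g α x v ≠ 0 → ‖x‖ ≤ R ∧ ‖v‖ ≤ R) (hF : ContDiff ℝ 1 F)
    (hFs : ∀ x, F x ≠ 0 → ‖x‖ ≤ R)
    (hgauss : ∀ x, divergence F x = 4 * Real.pi * ∑ α, e α * ∫ v, g α x v) :
    ∑ α, e α * ∫ p : E3 × E3, g α p.1 p.2 = 0 := by
  have hi : ∀ α, Integrable (fun p : E3 × E3 => g α p.1 p.2) (volume.prod volume) := fun α =>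
    (hg α).integrable_of_hasCompactSupport (hasCompactSupport_of_norm_le (R := R) fun p hp =>
      max_le (hgs α _ _ hp).1 (hgs α _ _ hp).2)
  have h1 : ∀ α, ∫ p : E3 × E3, g α p.1 p.2 = ∫ x, ∫ v, g α x v := fun α => integral_prod _ (hi α)
  have h2 : ∫ x, ∑ α, e α * ∫ v, g α x v = ∑ α, e α * ∫ p : E3 × E3, g α p.1 p.2 := by
    rw [integral_finsetSum _ fun α _ => (hi α).integral_prod_left.const_mul (e α)]
    exact Finset.sum_congr rfl fun α _ => by rw [integral_const_mul, h1]
  have h3 := integral_divergence_eq_zero hF (hasCompactSupport_of_norm_le hFs)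
  simp only [hgauss] at h3
  rw [integral_const_mul, h2] at h3
  exact (mul_eq_zero.mp h3).resolve_left (by positivity)

/-- Uniform momentum bound for the densities. -/
lemma StandingHypothesis.exists_uniform_momentum_bound (h : StandingHypothesis m e k f E B)
    (hm : ∀ α, 0 < m α) (α : Fin N) :
    ∃ P, ∀ t, 0 ≤ t → ∀ x v, f α t x v ≠ 0 → ‖v‖ ≤ P := by
  obtain ⟨P, _, -, -, -, hP⟩ := h.exists_trajectory_bound hm α
  refine ⟨P, fun t ht x v hv => ?_⟩
  obtain ⟨X, V, hc, -, rfl, hf⟩ := h.exists_characteristic hm α ht x v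
  rw [hf] at hv
  have h1 := h.init_f_support α _ _ hv
  exact (hP t X V hc h1.1 h1.2 t ⟨ht, le_rfl⟩).1

/-- At a fixed late time, only a bounded part of space is mapped into the support cone. -/
lemma exists_radius_of_lorentz_mem {A : Matrix (Fin 4) (Fin 4) ℝ} (hA : A ∈ restrictedLorentz)
    {k T : ℝ} (hT : boost A * k < T) :
    ∃ R, ∀ x, ‖spacePart A T x‖ ≤ timePart A T x + k → ‖x‖ ≤ R := by
  obtain ⟨L, hL, hLb⟩ := exists_lorentz_norm_le A⁻¹
  have hβ := boost_lt hA
  have hβ0 := boost_nonneg A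
  refine ⟨L * (2 * ((T + boost A * k) / (A 0 0 - boost A)) + k), fun x hx => ?_⟩
  have b := hLb (timePart A T x) (spacePart A T x)
  have c := (abs_le.mp (abs_timePart_inv_sub_le hA (timePart A T x) (spacePart A T x))).1
  have hmem := lorentz_mem_extendedRegion hA hT le_rfl x
  rw [timePart_inv_apply hA, spacePart_inv_apply hA] at b
  rw [timePart_inv_apply hA] at c
  set τ := timePart A T x
  have hτ : 0 < τ := by
    rcases hmem with h1 | h1
    · exact h1
    · linarith [le_abs_self τ]
  -- Inverting the map gives `A₀₀ τ - β r ≤ T`, and `r ≤ τ + k` turns this into a bound on `τ`, as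
  -- `β < A₀₀`. The old position and then `x` are bounded in turn.
  have h1 : τ ≤ (T + boost A * k) / (A 0 0 - boost A) := by
    rw [le_div_iff₀ (by linarith)]
    nlinarith [mul_le_mul_of_nonneg_left hx hβ0]
  rw [abs_of_pos hτ] at b
  have h2 : L * (τ + ‖spacePart A T x‖)
      ≤ L * (2 * ((T + boost A * k) / (A 0 0 - boost A)) + k) :=
    mul_le_mul_of_nonneg_left (by linarith) (by linarith)
  linarith [abs_nonneg T]

/-- The transformed solution, on the preimage of the region of regularity. -/
lemma StandingHypothesis.regularSolution_lorentz (h : StandingHypothesis m e k f E B)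
    (hm : ∀ α, 0 < m α) {A : Matrix (Fin 4) (Fin 4) ℝ} (hA : A ∈ restrictedLorentz) :
    RegularSolution m e (lorentzMap A ⁻¹' extendedRegion k) (lorentzDensity m A f)
      (lorentzE A E B) (lorentzB A E B) :=
  (h.regularSolution hm).lorentz hm hA

/-- The support of the transformed data at a fixed late time is compact. -/
lemma StandingHypothesis.exists_lorentz_support (h : StandingHypothesis m e k f E B)
    (hm : ∀ α, 0 < m α) {A : Matrix (Fin 4) (Fin 4) ℝ} (hA : A ∈ restrictedLorentz) {T : ℝ}
    (hT : boost A * k < T) :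
    ∃ R, (∀ α x v, lorentzDensity m A f α T x v ≠ 0 → ‖x‖ ≤ R ∧ ‖v‖ ≤ R) ∧
      ∀ x, (lorentzE A E B T x ≠ 0 ∨ lorentzB A E B T x ≠ 0) → ‖x‖ ≤ R := by
  obtain ⟨R, hR⟩ := exists_radius_of_lorentz_mem hA hT
  choose P hP using h.exists_uniform_momentum_bound hm
  have hQ : ∀ α, ∃ Q, ∀ w, ‖w‖ ≤ P α → ‖momentumMap A⁻¹ (m α) w‖ ≤ Q := by
    intro α
    obtain ⟨Q, hQ⟩ := ((isCompact_closedBall (0 : E3) (P α)).image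
      (contDiff_momentumMap (n := 1) A⁻¹ (hm α)).continuous).isBounded.exists_norm_le
    exact ⟨Q, fun w hw => hQ _ ⟨w, by simpa using hw, rfl⟩⟩
  choose Q hQ using hQ
  have hsum : ∀ α, Q α ≤ ∑ β, |Q β| := fun α => (le_abs_self _).trans
    (Finset.single_le_sum (f := fun β => |Q β|) (fun _ _ => abs_nonneg _) (Finset.mem_univ α))
  refine ⟨max R (∑ β, |Q β|), fun α x v hv => ⟨?_, ?_⟩, fun x hx => ?_⟩
  · refine (hR x ?_).trans (le_max_left _ _)
    by_contra hcon
    exact hv (congrFun ((h.extendZero_eq_zero hm (not_le.mp hcon)).1 α) _)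
  · refine le_trans ?_ ((hsum α).trans (le_max_right _ _))
    rw [← momentumMap_inv_apply hA (hm α) v]
    refine hQ α _ ?_
    rw [lorentzDensity] at hv
    rcases le_or_gt 0 (timePart A T x) with ht | ht
    · rw [extendZero_of_nonneg _ ht] at hv
      exact hP α _ ht _ _ hv
    · rw [extendZero_of_neg _ ht] at hv
      exact absurd rfl hv
  · refine (hR x ?_).trans (le_max_left _ _)
    by_contra hcon
    obtain ⟨-, h1, h2⟩ := h.extendZero_eq_zero hm (not_le.mp hcon)
    have hEB : electricMap A (extendZero E (timePart A T x) (spacePart A T x),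
        extendZero B (timePart A T x) (spacePart A T x)) = 0 ∧
        magneticMap A (extendZero E (timePart A T x) (spacePart A T x),
        extendZero B (timePart A T x) (spacePart A T x)) = 0 := by
      rw [h1, h2, Prod.mk_zero_zero, map_zero, map_zero]
      exact ⟨rfl, rfl⟩
    exact hx.elim (fun h0 => h0 hEB.1) (fun h0 => h0 hEB.2)

lemma StandingHypothesis.lorentzDensity_nonneg (h : StandingHypothesis m e k f E B)
    (hm : ∀ α, 0 < m α) (A : Matrix (Fin 4) (Fin 4) ℝ) (α : Fin N) (t : ℝ) (x v : E3) :
    0 ≤ lorentzDensity m A f α t x v := by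
  rw [lorentzDensity]
  rcases le_or_gt 0 (timePart A t x) with ht | ht
  · rw [extendZero_of_nonneg _ ht]
    exact h.f_nonneg hm α ht _ _
  · rw [extendZero_of_neg _ ht]
    exact le_rfl

/-- The standing hypothesis is preserved by Lorentz transformations, up to a time shift. -/
theorem StandingHypothesis.lorentz (h : StandingHypothesis m e k f E B)
    (hm : ∀ α, 0 < m α) {A : Matrix (Fin 4) (Fin 4) ℝ} (hA : A ∈ restrictedLorentz) {T : ℝ}
    (hT0 : 0 < T) (hT : boost A * k < T) :
    ∃ k', StandingHypothesis m e k' (fun α t x v => lorentzDensity m A f α (t + T) x v)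
      (fun t x => lorentzE A E B (t + T) x) (fun t x => lorentzB A E B (t + T) x) := by
  obtain ⟨R, hRf, hRF⟩ := h.exists_lorentz_support hm hA hT
  have hsol := ((h.regularSolution_lorentz hm hA).shift T).isSolution hm (T := 0)
    fun t x ht => lorentz_mem_extendedRegion hA hT (by linarith : T ≤ t + T) x
  have hf0 : ∀ α x v, lorentzDensity m A f α (0 + T) x v ≠ 0 → ‖x‖ ≤ max R 2 ∧ ‖v‖ ≤ max R 2 := by
    intro α x v hv
    rw [zero_add] at hv
    exact ⟨(hRf α x v hv).1.trans (le_max_left _ _), (hRf α x v hv).2.trans (le_max_left _ _)⟩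
  have hE0 : ∀ x, lorentzE A E B (0 + T) x ≠ 0 → ‖x‖ ≤ max R 2 := by
    intro x hx
    rw [zero_add] at hx
    exact (hRF x (Or.inl hx)).trans (le_max_left _ _)
  have hB0 : ∀ x, lorentzB A E B (0 + T) x ≠ 0 → ‖x‖ ≤ max R 2 := by
    intro x hx
    rw [zero_add] at hx
    exact (hRF x (Or.inr hx)).trans (le_max_left _ _)
  have hEc := contDiff_slice (F := fun t x => lorentzE A E B (t + T) x) hsol.contDiff_E le_rfl
  have hBc := contDiff_slice (F := fun t x => lorentzB A E B (t + T) x) hsol.contDiff_B le_rfl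
  -- The radius contains the supports of all data and is at least `2`, as the decay estimate
  -- requires.
  exact ⟨max R 2,
    { solution := hsol
      k_pos := lt_of_lt_of_le two_pos (le_max_right _ _)
      init_f_nonneg := fun α x v => h.lorentzDensity_nonneg hm A α _ x v
      init_f_contDiff := hsol.contDiff_f_slice le_rfl
      init_f_support := hf0
      init_E_contDiff := hEc
      init_B_contDiff := hBc
      init_E_support := hE0
      init_B_support := hB0
      init_gauss := hsol.gauss 0 le_rfl
      init_gauss_magnetic := hsol.gauss_magnetic 0 le_rfl
      init_neutral := neutral_of_gauss (fun α => (hsol.contDiff_f_slice le_rfl α).continuous) hf0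
        hEc hE0 (hsol.gauss 0 le_rfl)
      decay := h.exists_lorentz_decay hm hA hT0 hT (le_max_right _ _) }⟩

end

end VlasovMaxwell

theorem mainTheorem5 {N : ℕ} (hN : 2 ≤ N) (m e : Fin N → ℝ)
    (hm : ∀ α, 0 < m α) (he : ∀ α, e α ≠ 0)
    (k : ℝ) (f : Fin N → ℝ → E3 → E3 → ℝ) (E B : ℝ → E3 → E3)
    (hyp : StandingHypothesis m e k f E B)
    (A : Matrix (Fin 4) (Fin 4) ℝ) (hA : A ∈ restrictedLorentz) :
    ∃ T : ℝ, 0 < T ∧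
      (∀ t x, T ≤ t → (timePart A t x, spacePart A t x) ∈ extendedDomain k) ∧
      IsSolution m e T (lorentzDensity m A f) (lorentzE A E B) (lorentzB A E B) ∧
      ∃ k' : ℝ, StandingHypothesis m e k'
        (fun α t x v => lorentzDensity m A f α (t + T) x v)
        (fun t x => lorentzE A E B (t + T) x)
        (fun t x => lorentzB A E B (t + T) x) := by
  have hk := hyp.k_pos
  -- Any time strictly above `boost A * k` would do; adding one also ensures positivity when `A` is
  -- a pure rotation.
  have hT0 : 0 < boost A * k + 1 := by have := boost_nonneg A; positivity
  have hT : boost A * k < boost A * k + 1 := lt_add_one _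
  refine ⟨boost A * k + 1, hT0, fun t x ht => ?_, ?_, hyp.lorentz hm hA hT0 hT⟩
  · rcases lorentz_mem_extendedRegion hA hT ht x with h | h
    · exact Or.inl h.le
    · rcases le_total 0 (timePart A t x) with h0 | h0
      · exact Or.inl h0
      · exact Or.inr ⟨h0, by rw [abs_of_nonpos h0] at h; exact h.le⟩
  · exact (hyp.regularSolution_lorentz hm hA).isSolution hm
      fun t x ht => lorentz_mem_extendedRegion hA hT ht x
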